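/- For a sequence $\vec x=\langle x_n\mid n\in\mathbb N\rangle$ of natural numbers let $$\mathrm{AFS}^2(\vec x)=\Big\{\Big(\sum_{k=k_0}^{k_1}x_k,\ \sum_{k=k_1+1}^{k_2}x_k\Big)\ \Big|\ k_0\le k_1<k_2\Big\}.$$ An instance of $\mathsf{AHT}^2$ is a colouring $c:\mathbb N^2\to\{0,\dots,k-1\}$ with $k$ finite, and a solution to it is an infinite set $Y\subseteq\mathbb N$ such that $c$ is constant on $\mathrm{AFS}^2(\vec y)$, where $\vec y$ is the increasing enumeration of $Y$; $\mathsf{AHT}^2$ is the statement that every instance has a solution. $\mathbb Z\text{-}\mathsf{RT}^3$ is the statement that for every finite $k$ and every colouring $c:[\mathbb N]^3\to\{0,\dots,k-1\}$ of the three-element subsets of $\mathbb N$ with $c(\{x,y,z\})=c(\{x+t,y+t,z+t\})$ for all $\{x,y,z\}\in[\mathbb N]^3$ and $t\in\mathbb N$, there is an infinite $X\subseteq\mathbb N$ such that $c$ is constant on $[X]^3$. Let $\mathsf{RCA}_0$ be the theory in the language of second-order arithmetic that consists of the basic axioms of arithmetic, $\Sigma^0_1$ induction and $\Delta^0_1$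 comprehension, and let $\mathsf{ACA}_0$ consist of the basic axioms, the induction axiom for sets and arithmetical comprehension. Then: 1. There is a computable colouring $c:\mathbb N^2\to\{0,1,2,3\}$, that is, a computable instance of $\mathsf{AHT}^2$ with four colours, such that every solution to $c$ computes the halting set $0'$. 2. Over $\mathsf{RCA}_0$, the statements $\mathsf{AHT}^2$ and $\mathbb Z\text{-}\mathsf{RT}^3$ are equivalent, and each of them implies $\mathsf{ACA}_0$: every axiom of $\mathsf{ACA}_0$ is a consequence of $\mathsf{RCA}_0+\mathsf{AHT}^2$, and of $\mathsf{RCA}_0+\mathbb Z\text{-}\mathsf{RT}^3$. -/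

import Mathlib

universe u

/-! ## Computability: two-dimensional adjacent sums and the halting set -/

namespace AdjacentHindman

/-- The set of adjacent pairs of adjacent finite sums of the sequence `x`. -/
def AFS2 (x : ℕ → ℕ) : Set (ℕ × ℕ) :=
  {p | ∃ k₀ k₁ k₂ : ℕ, k₀ ≤ k₁ ∧ k₁ < k₂ ∧
    p = (∑ k ∈ Finset.Icc k₀ k₁, x k, ∑ k ∈ Finset.Icc (k₁ + 1) k₂, x k)}

/-- `Y` is a solution to the instance `c`: it is infinite, and `c` is constant on the adjacent
pairs of adjacent sums of the increasing enumeration of `Y`. -/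
def IsSolution {κ : Type*} (c : ℕ → ℕ → κ) (Y : Set ℕ) : Prop :=
  Y.Infinite ∧ ∃ i : κ, ∀ p ∈ AFS2 (Nat.nth (· ∈ Y)), c p.1 p.2 = i

open Classical in
/-- The characteristic function of a set of natural numbers, as an oracle. -/
noncomputable def charFun (A : Set ℕ) : ℕ →. ℕ :=
  fun n => Part.some (if n ∈ A then 1 else 0)

/-- The halting set: the `e` such that the `e`-th program halts on input `e`. -/
def haltingSet : Set ℕ :=
  {e | (Nat.Partrec.Code.eval (Denumerable.ofNat Nat.Partrec.Code e) e).Dom}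

/-- The set `B` computes the set `A`. -/
def Computes (B A : Set ℕ) : Prop :=
  TuringReducible (charFun A) (charFun B)

end AdjacentHindman

/-! ## Second-order arithmetic -/

namespace SecondOrderArith

/-- Number terms; number variables are named by natural numbers. -/
inductive Term : Type
  | var (x : ℕ)
  | zero
  | one
  | add (s t : Term)
  | mul (s t : Term)

namespace Term

instance : Zero Term := ⟨Term.zero⟩
instance : One Term := ⟨Term.one⟩
instance : Add Term := ⟨Term.add⟩
instance : Mul Term := ⟨Term.mul⟩

/-- The number variable `x` occurs in the term. -/
def Occurs (x : ℕ) : Term → Prop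
  | var y => x = y
  | zero => False
  | one => False
  | add s t => Occurs x s ∨ Occurs x t
  | mul s t => Occurs x s ∨ Occurs x t

/-- The pairing `⟨s, t⟩ = (s + t)² + s`. -/
def pair (s t : Term) : Term := (s + t) * (s + t) + s

end Term

/-- Formulas of the two-sorted language of second-order arithmetic. Number variables and set
variables are separately named by natural numbers. -/
inductive Formula : Type
  | eq (s t : Term)
  | lt (s t : Term)
  | mem (t : Term) (X : ℕ)
  | neg (φ : Formula)
  | and (φ ψ : Formula)
  | all (x : ℕ) (φ : Formula)
  | allSet (X : ℕ) (φ : Formula)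

namespace Formula

def or (φ ψ : Formula) : Formula := neg (and (neg φ) (neg ψ))

def imp (φ ψ : Formula) : Formula := neg (and φ (neg ψ))

def iff (φ ψ : Formula) : Formula := and (imp φ ψ) (imp ψ φ)

/-- Existential number quantifier. -/
def ex (x : ℕ) (φ : Formula) : Formula := neg (all x (neg φ))

/-- Existential set quantifier. -/
def exSet (X : ℕ) (φ : Formula) : Formula := neg (allSet X (neg φ))

/-- Universal quantification over a list of number variables. -/
def alls (xs : List ℕ) (φ : Formula) : Formula := xs.foldr all φ

/-- Existential quantification over a list of number variables. -/
def exs (xs : List ℕ) (φ : Formula) : Formula := xs.foldr ex φ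

def le (s t : Term) : Formula := or (lt s t) (eq s t)

/-- The number variable `x` occurs free. -/
def NumFree (x : ℕ) : Formula → Prop
  | eq s t => s.Occurs x ∨ t.Occurs x
  | lt s t => s.Occurs x ∨ t.Occurs x
  | mem t _ => t.Occurs x
  | neg φ => NumFree x φ
  | and φ ψ => NumFree x φ ∨ NumFree x ψ
  | all y φ => x ≠ y ∧ NumFree x φ
  | allSet _ φ => NumFree x φ

/-- The set variable `X` occurs free. -/
def SetFree (X : ℕ) : Formula → Prop
  | eq _ _ => False
  | lt _ _ => False
  | mem _ Y => X = Y
  | neg φ => SetFree X φ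
  | and φ ψ => SetFree X φ ∨ SetFree X ψ
  | all _ φ => SetFree X φ
  | allSet Y φ => X ≠ Y ∧ SetFree X φ

/-- Bounded quantifier (`Σ⁰₀`) formulas. Bounded existential quantifiers arise from
`∀ x < t` by negation. -/
inductive IsBounded : Formula → Prop
  | eq (s t : Term) : IsBounded (eq s t)
  | lt (s t : Term) : IsBounded (lt s t)
  | mem (t : Term) (X : ℕ) : IsBounded (mem t X)
  | neg {φ : Formula} : IsBounded φ → IsBounded (neg φ)
  | and {φ ψ : Formula} : IsBounded φ → IsBounded ψ → IsBounded (and φ ψ)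
  | ball {x : ℕ} {t : Term} {φ : Formula} : ¬ t.Occurs x → IsBounded φ →
      IsBounded (all x (imp (lt (.var x) t) φ))

/-- `Σ⁰₁` formulas: `∃ x θ` with `θ` bounded. -/
def IsSigma01 (φ : Formula) : Prop := ∃ x θ, IsBounded θ ∧ φ = ex x θ

/-- `Π⁰₁` formulas: `∀ x θ` with `θ` bounded. -/
def IsPi01 (φ : Formula) : Prop := ∃ x θ, IsBounded θ ∧ φ = all x θ

/-- Arithmetical formulas: no set quantifiers, free set variables allowed. -/
def IsArithmetical : Formula → Prop
  | eq _ _ => True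
  | lt _ _ => True
  | mem _ _ => True
  | neg φ => IsArithmetical φ
  | and φ ψ => IsArithmetical φ ∧ IsArithmetical ψ
  | all _ φ => IsArithmetical φ
  | allSet _ _ => False

end Formula

/-! ### Semantics -/

/-- A (Henkin) structure: an arbitrary, possibly nonstandard, first-order part, together with a
nonempty collection of subsets of it over which the set quantifiers range. -/
structure Model : Type (u + 1) where
  Num : Type u
  zero : Num
  one : Num
  add : Num → Num → Num
  mul : Num → Num → Num
  lt : Num → Num → Prop
  Sets : Set (Set Num)
  sets_nonempty : Sets.Nonempty

namespace Model

variable (M : Model.{u})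

/-- The value of a term under an assignment of the number variables. -/
def eval (v : ℕ → M.Num) : Term → M.Num
  | .var x => v x
  | .zero => M.zero
  | .one => M.one
  | .add s t => M.add (eval v s) (eval v t)
  | .mul s t => M.mul (eval v s) (eval v t)

/-- Satisfaction of a formula under assignments of the number and the set variables. -/
def Sat : (ℕ → M.Num) → (ℕ → M.Sets) → Formula → Prop
  | v, _, .eq s t => M.eval v s = M.eval v t
  | v, _, .lt s t => M.lt (M.eval v s) (M.eval v t)
  | v, w, .mem t X => M.eval v t ∈ (w X : Set M.Num)
  | v, w, .neg φ => ¬ Sat v w φ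
  | v, w, .and φ ψ => Sat v w φ ∧ Sat v w ψ
  | v, w, .all x φ => ∀ a : M.Num, Sat (Function.update v x a) w φ
  | v, w, .allSet X φ => ∀ A : M.Sets, Sat v (Function.update w X A) φ

/-- A formula is true in `M` if its universal closure is, i.e. if it is satisfied under all
assignments. -/
def Models (φ : Formula) : Prop := ∀ v w, M.Sat v w φ

end Model

/-- `T` entails `φ`: every model of `T` is a model of `φ`. Since arbitrary Henkin models are
allowed, this is provability of `φ` from `T`. -/
def Entails (T : Set Formula) (φ : Formula) : Prop :=
  ∀ M : Model.{u}, (∀ ψ ∈ T, M.Models ψ) → M.Models φ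

/-! ### The axiom systems -/

open Formula

/-- Abbreviation for number variables. -/
abbrev nv (x : ℕ) : Term := Term.var x

/-- The basic axioms of arithmetic. -/
def basicAxioms : Set Formula :=
  { neg (eq (nv 0 + 1) 0),
    imp (eq (nv 0 + 1) (nv 1 + 1)) (eq (nv 0) (nv 1)),
    eq (nv 0 + 0) (nv 0),
    eq (nv 0 + (nv 1 + 1)) ((nv 0 + nv 1) + 1),
    eq (nv 0 * 0) 0,
    eq (nv 0 * (nv 1 + 1)) (nv 0 * nv 1 + nv 0),
    neg (lt (nv 0) 0),
    iff (lt (nv 0) (nv 1 + 1)) (or (lt (nv 0) (nv 1)) (eq (nv 0) (nv 1))) }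

/-- `φ(t)` for the formula `φ(x)`, written as `∀ x (x = t → φ(x))`; used only when `x` does not
occur in `t` and the variables of `t` are not free in `φ`. -/
def atTerm (x : ℕ) (t : Term) (φ : Formula) : Formula := all x (imp (eq (nv x) t) φ)

/-- Induction for `φ(x)`: `φ(0) ∧ ∀ y (φ(y) → φ(y + 1)) → ∀ x φ(x)`. -/
def inductionFor (x y : ℕ) (φ : Formula) : Formula :=
  imp (and (atTerm x 0 φ) (all y (imp (atTerm x (nv y) φ) (atTerm x (nv y + 1) φ)))) (all x φ)

/-- Comprehension for `φ(x)`: `∃ X ∀ x (x ∈ X ↔ φ(x))`. -/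
def comprehensionFor (x X : ℕ) (φ : Formula) : Formula :=
  exSet X (all x (iff (mem (nv x) X) φ))

/-- `Σ⁰₁` induction, with number and set parameters. -/
def sigma01Induction : Set Formula :=
  {χ | ∃ (φ : Formula) (x y : ℕ), IsSigma01 φ ∧ y ≠ x ∧ ¬ NumFree y φ ∧ χ = inductionFor x y φ}

/-- `Δ⁰₁` comprehension, with number and set parameters. -/
def delta01Comprehension : Set Formula :=
  {χ | ∃ (φ ψ : Formula) (x X : ℕ), IsSigma01 φ ∧ IsPi01 ψ ∧ ¬ SetFree X φ ∧
    χ = imp (all x (iff φ ψ)) (comprehensionFor x X φ)}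

/-- Arithmetical comprehension, with number and set parameters. -/
def arithmeticalComprehension : Set Formula :=
  {χ | ∃ (φ : Formula) (x X : ℕ), IsArithmetical φ ∧ ¬ SetFree X φ ∧
    χ = comprehensionFor x X φ}

/-- The single induction axiom `0 ∈ X ∧ ∀ n (n ∈ X → n + 1 ∈ X) → ∀ n (n ∈ X)`. -/
def inductionAxiom : Formula :=
  imp (and (mem 0 0) (all 0 (imp (mem (nv 0) 0) (mem (nv 0 + 1) 0)))) (all 0 (mem (nv 0) 0))

def RCA₀ : Set Formula := basicAxioms ∪ sigma01Induction ∪ delta01Comprehension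

def ACA₀ : Set Formula := basicAxioms ∪ {inductionAxiom} ∪ arithmeticalComprehension

/-! ### The combinatorial principles

The auxiliary formulas below have only set variables as parameters (with the exception of the
number of colours, which is always the number variable `0`), so no variable is captured. -/

/-- `X` is infinite, i.e. unbounded. -/
def isInfinite (X : ℕ) : Formula := all 1 (ex 2 (and (lt (nv 1) (nv 2)) (mem (nv 2) X)))

/-- `F` is (the graph of) a function from numbers to numbers. -/
def isFunction (F : ℕ) : Formula :=
  and (all 1 (imp (mem (nv 1) F) (exs [2, 3] (eq (nv 1) ((nv 2).pair (nv 3))))))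
    (all 1 (ex 2 (and (mem ((nv 1).pair (nv 2)) F)
      (all 3 (imp (mem ((nv 1).pair (nv 3)) F) (eq (nv 3) (nv 2)))))))

/-- `F` is the increasing enumeration of `Y`. -/
def isIncreasingEnumeration (F Y : ℕ) : Formula :=
  and (isFunction F) (and
    (alls [1, 2, 3, 4] (imp (and (lt (nv 1) (nv 2))
        (and (mem ((nv 1).pair (nv 3)) F) (mem ((nv 2).pair (nv 4)) F)))
      (lt (nv 3) (nv 4))))
    (all 1 (iff (mem (nv 1) Y) (ex 2 (mem ((nv 2).pair (nv 1)) F)))))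

/-- `G` is the function of partial sums of the function `F`:
`G(0) = 0` and `G(n + 1) = G(n) + F(n)`, that is, `G(n) = ∑ k < n, F(k)`. -/
def isPartialSums (G F : ℕ) : Formula :=
  and (isFunction G) (and (mem (Term.pair 0 0) G)
    (alls [1, 2, 3] (imp (and (mem ((nv 1).pair (nv 2)) G) (mem ((nv 1).pair (nv 3)) F))
      (mem ((nv 1 + 1).pair (nv 2 + nv 3)) G))))

/-- `C` is a colouring of the pairs of numbers with colours `< k`, where `k` is the number
variable `0`; the colour of `(x, y)` is the `i` with `⟨⟨x, y⟩, i⟩ ∈ C`. -/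
def isColouringOfPairs (C : ℕ) : Formula :=
  and (all 1 (imp (mem (nv 1) C) (exs [2, 3, 4]
      (and (lt (nv 4) (nv 0)) (eq (nv 1) (((nv 2).pair (nv 3)).pair (nv 4)))))))
    (alls [1, 2] (ex 3 (and (mem (((nv 1).pair (nv 2)).pair (nv 3)) C)
      (all 4 (imp (mem (((nv 1).pair (nv 2)).pair (nv 4)) C) (eq (nv 4) (nv 3)))))))

/-- `C` is a colouring of the three-element sets of numbers, represented as triples
`x < y < z`, with colours `< k`, where `k` is the number variable `0`; the colour of `{x, y, z}` is
the `i` with `⟨⟨⟨x, y⟩, z⟩, i⟩ ∈ C`. -/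
def isColouringOfTriples (C : ℕ) : Formula :=
  and (all 1 (imp (mem (nv 1) C) (exs [2, 3, 4, 5]
      (and (and (lt (nv 2) (nv 3)) (lt (nv 3) (nv 4))) (and (lt (nv 5) (nv 0))
        (eq (nv 1) ((((nv 2).pair (nv 3)).pair (nv 4)).pair (nv 5))))))))
    (alls [1, 2, 3] (imp (and (lt (nv 1) (nv 2)) (lt (nv 2) (nv 3)))
      (ex 4 (and (mem ((((nv 1).pair (nv 2)).pair (nv 3)).pair (nv 4)) C)
        (all 5 (imp (mem ((((nv 1).pair (nv 2)).pair (nv 3)).pair (nv 5)) C)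
          (eq (nv 5) (nv 4))))))))

/-- The colouring `C` of triples is invariant under translation. -/
def isTranslationInvariant (C : ℕ) : Formula :=
  alls [1, 2, 3, 4, 5] (imp (and (lt (nv 1) (nv 2)) (lt (nv 2) (nv 3)))
    (iff (mem ((((nv 1).pair (nv 2)).pair (nv 3)).pair (nv 5)) C)
      (mem ((((nv 1 + nv 4).pair (nv 2 + nv 4)).pair (nv 3 + nv 4)).pair (nv 5)) C)))

/-- Some colour `i < k` is the colour under `C` of all adjacent pairs of adjacent sums of the
sequence whose partial sums are `G`: for all `k₀ ≤ k₁ < k₂`, if `p = G(k₁ + 1) - G(k₀)` and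
`q = G(k₂ + 1) - G(k₁ + 1)` then `(p, q)` has colour `i`. Variables: `k = 0`, `i = 1`,
`k₀, k₁, k₂ = 2, 3, 4`, the three values of `G` are `5, 6, 7`, and `p, q = 8, 9`. -/
def isMonochromaticAFS2 (C G : ℕ) : Formula :=
  ex 1 (and (lt (nv 1) (nv 0)) (alls [2, 3, 4, 5, 6, 7, 8, 9] (imp
    (and (and (le (nv 2) (nv 3)) (lt (nv 3) (nv 4))) (and
      (and (mem ((nv 2).pair (nv 5)) G)
        (and (mem ((nv 3 + 1).pair (nv 6)) G) (mem ((nv 4 + 1).pair (nv 7)) G)))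
      (and (eq (nv 5 + nv 8) (nv 6)) (eq (nv 6 + nv 9) (nv 7)))))
    (mem (((nv 8).pair (nv 9)).pair (nv 1)) C))))

/-- The two-dimensional adjacent Hindman theorem, for all finite numbers `k` of colours. The
set variables are: the colouring `0`, the solution `1`, its increasing enumeration `2`, and the
partial sums `3` of the latter. -/
def AHT2 : Formula :=
  all 0 (allSet 0 (imp (isColouringOfPairs 0)
    (exSet 1 (and (isInfinite 1) (exSet 2 (and (isIncreasingEnumeration 2 1)
      (exSet 3 (and (isPartialSums 3 2) (isMonochromaticAFS2 0 3)))))))))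

/-- The Ramsey theorem for triples, for translation invariant colourings with any finite number
`k` of colours. -/
def ZRT3 : Formula :=
  all 0 (allSet 0 (imp (and (isColouringOfTriples 0) (isTranslationInvariant 0))
    (exSet 1 (and (isInfinite 1) (ex 1 (and (lt (nv 1) (nv 0)) (alls [2, 3, 4] (imp
      (and (and (lt (nv 2) (nv 3)) (lt (nv 3) (nv 4)))
        (and (mem (nv 2) 1) (and (mem (nv 3) 1) (mem (nv 4) 1))))
      (mem ((((nv 2).pair (nv 3)).pair (nv 4)).pair (nv 1)) 0)))))))))

end SecondOrderArith

/-! Colour `(p, q)` by two bits: whether the 2-adic valuation of `p` is smaller than that of `q`,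
and whether the approximations to the halting set at stages `p` and `q` agree below the valuation of
`p`. On a solution both bits are constant over pairs of adjacent interval sums. The first bit cannot
be constantly false: valuations would never increase from an interval to the next, while two
adjacent sums of equal valuation add up to one of larger valuation, so the valuation would have to
drop again and again. Hence valuations strictly increase, and extending an interval to the right
preserves its valuation. Only finitely many programs lie below that fixed valuation, so far enough
out the approximations have settled there; one pair agrees, and therefore all do. Since the second
sum can be arbitrarily late, every sum `p` (of positive valuation) decides halting below its
valuation, and these valuations are unbounded. This is `haltsWithin_iff_of_constant`;
`computes_haltingSet_of_val2` turns it into a search through the solution.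

The two combinatorial principles encode each other. A translation invariant colouring of `x < y < z`
sees only the gaps `(y - x, z - y)`, and partial sums turn adjacent sums into adjacent gaps
(`AdjacentHindman.translationRamsey`, `TranslationRamsey.adjacentHindman`).

For `ACA₀` the jump argument is repeated inside an arbitrary model, with gaps of a homogeneous set,
powers of two in place of exponents, and any `Σ⁰₁` set in place of the halting set
(`mem_sets_of_homogeneous`). The settling stage comes from `strong_collection`, a counting argument
that needs primitive recursion and hence codes of finite sets. Once `Σ⁰₁` sets exist, arithmetical
comprehension follows by induction on formulas.

Inside a model, definability is handled semantically by `Bdd`, with number and set parameters;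
`Bdd.exists_formula` supplies the formulas for the axioms. As sets are allowed as parameters, `Δ⁰₁`
predicates are again `Bdd` (`bdd_of_delta`), so definable functions can be substituted freely. -/

namespace AdjacentHindman

/-! ## A computable colouring whose solutions compute the halting set -/

open Nat.Partrec (Code)

/-! ### Valuations of sums. -/

/-- The exponent of the largest power of two that divides `p`, and `0` for `p = 0`. -/
def val2 (p : ℕ) : ℕ := Nat.findGreatest (fun k => 2 ^ k ∣ p) p

theorem pow_dvd_iff_le_val2 {p k : ℕ} (hp : p ≠ 0) : 2 ^ k ∣ p ↔ k ≤ val2 p := by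
  constructor
  · intro h
    -- Every candidate exponent lies within the search bound, as `k < 2 ^ k ≤ p`.
    exact Nat.le_findGreatest (k.lt_two_pow_self.le.trans (Nat.le_of_dvd (Nat.pos_of_ne_zero hp) h)) h
  · intro h
    have : 2 ^ val2 p ∣ p := Nat.findGreatest_spec (P := fun k => 2 ^ k ∣ p) (Nat.zero_le p) (by simp)
    exact (pow_dvd_pow 2 h).trans this

theorem val2_add_of_lt {p q : ℕ} (hp : p ≠ 0) (hq : q ≠ 0) (h : val2 p < val2 q) :
    val2 (p + q) = val2 p := by
  have hpq : p + q ≠ 0 := by omega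
  apply le_antisymm
  · by_contra! hc
    have h₁ := (pow_dvd_iff_le_val2 hpq).2 hc
    have h₂ := (pow_dvd_iff_le_val2 hq).2 h
    have := (pow_dvd_iff_le_val2 hp).1 ((Nat.dvd_add_iff_left h₂).2 h₁)
    omega
  · exact (pow_dvd_iff_le_val2 hpq).1 (dvd_add ((pow_dvd_iff_le_val2 hp).2 le_rfl)
      ((pow_dvd_iff_le_val2 hq).2 h.le))

/-- The odd cofactors add up to an even number, which gives one more factor of two. -/
theorem val2_lt_add_of_eq {p q : ℕ} (hp : p ≠ 0) (hq : q ≠ 0) (h : val2 p = val2 q) :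
    val2 p < val2 (p + q) := by
  have odd : ∀ {r}, r ≠ 0 → ∃ a, r = 2 ^ val2 r * (2 * a + 1) := by
    intro r hr
    obtain ⟨b, hb⟩ := (pow_dvd_iff_le_val2 hr).2 le_rfl
    rcases Nat.even_or_odd' b with ⟨a, rfl | rfl⟩
    · have : 2 ^ (val2 r + 1) ∣ r := ⟨a, by rw [pow_succ, mul_assoc]; exact hb⟩
      have := (pow_dvd_iff_le_val2 hr).1 this
      omega
    · exact ⟨a, hb⟩
  obtain ⟨a, ha⟩ := odd hp
  obtain ⟨b, hb⟩ := odd hq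
  refine (pow_dvd_iff_le_val2 (by omega)).1 ⟨a + b + 1, ?_⟩
  nth_rw 1 [ha, hb]
  rw [← h, Nat.succ_eq_add_one, pow_succ]
  ring

/-! ### Finite approximations to the halting set. -/

/-- The `e`-th program halts on input `e` within `s` steps. -/
def haltsWithin (s e : ℕ) : Bool := (Code.evaln s (Denumerable.ofNat Code e) e).isSome

theorem haltsWithin_mono {s t e : ℕ} (h : s ≤ t) (hs : haltsWithin s e = true) :
    haltsWithin t e = true := by
  obtain ⟨x, hx⟩ := Option.isSome_iff_exists.1 hs
  exact Option.isSome_iff_exists.2 ⟨x, Code.evaln_mono h hx⟩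

theorem mem_haltingSet_iff {e : ℕ} : e ∈ haltingSet ↔ ∃ s, haltsWithin s e = true := by
  constructor
  · intro h
    obtain ⟨s, hs⟩ := Code.evaln_complete.1 (Part.get_mem h)
    exact ⟨s, Option.isSome_iff_exists.2 ⟨_, hs⟩⟩
  · rintro ⟨s, hs⟩
    obtain ⟨x, hx⟩ := Option.isSome_iff_exists.1 hs
    exact Part.dom_iff_mem.2 ⟨x, Code.evaln_sound hx⟩

/-- Each answer changes at most once, from no to yes, so finitely many answers have a common last
stage of change. The stage is not computed: the proof splits on the true answer. -/
theorem exists_settling_stage (m : ℕ) :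
    ∃ s, ∀ t, s ≤ t → ∀ e < m, (haltsWithin t e = true ↔ e ∈ haltingSet) := by
  induction m with
  | zero => exact ⟨0, fun _ _ e he => (Nat.not_lt_zero e he).elim⟩
  | succ m ih =>
    obtain ⟨s, hs⟩ := ih
    have : ∃ s', ∀ t, s' ≤ t → (haltsWithin t m = true ↔ m ∈ haltingSet) := by
      by_cases hm : m ∈ haltingSet
      · obtain ⟨s', hs'⟩ := mem_haltingSet_iff.1 hm
        exact ⟨s', fun t ht => iff_of_true (haltsWithin_mono ht hs') hm⟩
      · exact ⟨0, fun t _ => iff_of_false (fun h => hm (mem_haltingSet_iff.2 ⟨t, h⟩)) hm⟩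
    obtain ⟨s', hs'⟩ := this
    refine ⟨max s s', fun t ht e he => ?_⟩
    rcases Nat.lt_succ_iff_lt_or_eq.1 he with h | rfl
    · exact hs t (by omega) e h
    · exact hs' t (by omega)

/-- The stages `p` and `q` agree below `val2 p`. -/
def Agree (p q : ℕ) : Prop := ∀ e < val2 p, haltsWithin p e = haltsWithin q e

instance (p q : ℕ) : Decidable (Agree p q) :=
  inferInstanceAs (Decidable (∀ e < val2 p, haltsWithin p e = haltsWithin q e))

/-- The colouring: one bit compares valuations, the other the halting set at two stages. -/
def jumpColouring (p q : ℕ) : Fin 4 :=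
  if val2 p < val2 q then (if Agree p q then 0 else 1) else (if Agree p q then 2 else 3)

/-! ### The colouring is primitive recursive. -/

theorem primrec_val2 : Primrec val2 := by
  refine Primrec.nat_findGreatest Primrec.id ?_
  have hpow : Primrec₂ ((· ^ ·) : ℕ → ℕ → ℕ) := Primrec₂.unpaired'.1 Nat.Primrec.pow
  have : PrimrecRel fun p k : ℕ => p % 2 ^ k = 0 :=
    Primrec.eq.comp (Primrec.nat_mod.comp Primrec.fst (hpow.comp (Primrec.const 2) Primrec.snd))
      (Primrec.const 0)
  exact this.of_eq fun p k => (Nat.dvd_iff_mod_eq_zero).symm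

theorem primrec_haltsWithin : Primrec₂ haltsWithin :=
  Primrec.option_isSome.comp (Code.primrec_evaln.comp
    ((Primrec.fst.pair ((Primrec.ofNat Code).comp Primrec.snd)).pair Primrec.snd))

theorem primrecRel_agree : PrimrecRel Agree := by
  have : PrimrecRel fun (e : ℕ) (r : ℕ × ℕ) => haltsWithin r.1 e = haltsWithin r.2 e :=
    Primrec.eq.comp (primrec_haltsWithin.comp (Primrec.fst.comp Primrec.snd) Primrec.fst)
      (primrec_haltsWithin.comp (Primrec.snd.comp Primrec.snd) Primrec.fst)
  have h : PrimrecPred fun r : ℕ × ℕ => ∀ e < val2 r.1, haltsWithin r.1 e = haltsWithin r.2 e :=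
    (this.forall_mem_list.comp (Primrec.list_range.comp (primrec_val2.comp Primrec.fst))
      Primrec.id).of_eq fun r => by simp
  exact h

theorem primrec_jumpColouring : Primrec₂ jumpColouring :=
  Primrec.ite (Primrec.nat_lt.comp (primrec_val2.comp Primrec.fst) (primrec_val2.comp Primrec.snd))
    (Primrec.ite primrecRel_agree (Primrec.const 0) (Primrec.const 1))
    (Primrec.ite primrecRel_agree (Primrec.const 2) (Primrec.const 3))

/-- The four colours code the two bits injectively. -/
theorem val2_lt_iff_of_eq {p q p' q' : ℕ} (h : jumpColouring p q = jumpColouring p' q') :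
    (val2 p < val2 q ↔ val2 p' < val2 q') ∧ (Agree p q ↔ Agree p' q') := by
  unfold jumpColouring at h
  split_ifs at h <;> simp_all [not_lt_of_ge]

/-! ### Solutions decide the halting set. -/

/-- A function of intervals, additive, unbounded and with constant jump colour of adjacent
intervals, decides the halting set. -/
theorem haltsWithin_iff_of_constant {D : ℕ → ℕ → ℕ} {i : Fin 4}
    (hadd : ∀ a b c, a < b → b < c → D a b + D b c = D a c)
    (hpos : ∀ a b, 0 < a → a < b → D a b ≠ 0)
    (hunb : ∀ b s, ∃ c, b < c ∧ s ≤ D b c)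
    (hcol : ∀ a b c, a < b → b < c → jumpColouring (D a b) (D b c) = i) :
    (∀ a b e, a < b → e < val2 (D a b) → (haltsWithin (D a b) e = true ↔ e ∈ haltingSet)) ∧
      ∀ e, ∃ a, e < val2 (D a (a + 1)) := by
  have bits : ∀ a b c a' b' c', a < b → b < c → a' < b' → b' < c' →
      (val2 (D a b) < val2 (D b c) ↔ val2 (D a' b') < val2 (D b' c')) ∧
      (Agree (D a b) (D b c) ↔ Agree (D a' b') (D b' c')) := fun a b c a' b' c' h₁ h₂ h₃ h₄ =>
    val2_lt_iff_of_eq ((hcol a b c h₁ h₂).trans (hcol a' b' c' h₃ h₄).symm)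
  have hlt : ∀ a b c, a < b → b < c → val2 (D a b) < val2 (D b c) := by
    by_contra! hc
    obtain ⟨a₀, b₀, c₀, h₁, h₂, h₃⟩ := hc
    have ge : ∀ a b c, a < b → b < c → val2 (D b c) ≤ val2 (D a b) := fun a b c hab hbc =>
      not_lt.1 fun h => h₃.not_gt ((bits a b c a₀ b₀ c₀ hab hbc h₁ h₂).1.1 h)
    -- Here `n` counts forced drops of the valuation. The descent starts at index `1` because sums
    -- are only known to be nonzero from there on.
    have desc : ∀ n, ∃ a b, 0 < a ∧ a < b ∧ val2 (D a b) + n ≤ val2 (D 1 2) := by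
      intro n
      induction n with
      | zero => exact ⟨1, 2, by omega, by omega, le_rfl⟩
      | succ n ih =>
        obtain ⟨a, b, ha, hab, hn⟩ := ih
        have l₁ := ge a b (b + 1) hab (by omega)
        have l₂ := ge b (b + 1) (b + 2) (by omega) (by omega)
        have l₃ := ge a b (b + 2) hab (by omega)
        by_cases e₁ : val2 (D b (b + 1)) = val2 (D a b)
        · by_cases e₂ : val2 (D (b + 1) (b + 2)) = val2 (D b (b + 1))
          · have := val2_lt_add_of_eq (hpos b (b + 1) (by omega) (by omega))
              (hpos (b + 1) (b + 2) (by omega) (by omega)) e₂.symm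
            rw [hadd b (b + 1) (b + 2) (by omega) (by omega)] at this
            omega
          · exact ⟨b + 1, b + 2, by omega, by omega, by omega⟩
        · exact ⟨b, b + 1, by omega, by omega, by omega⟩
    obtain ⟨a, b, _, _, h⟩ := desc (val2 (D 1 2) + 1)
    omega
  have hpart : ∀ c, 2 < c → val2 (D 1 c) = val2 (D 1 2) := fun c hc => by
    rw [← hadd 1 2 c (by omega) hc]
    exact val2_add_of_lt (hpos 1 2 (by omega) (by omega)) (hpos 2 c (by omega) hc)
      (hlt 1 2 c (by omega) hc)
  -- All sums `D 1 c` share the valuation of `D 1 2`, so a single settling stage `s` serves them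
  -- all. With `b` and `c` past that stage one pair agrees, which fixes the second bit everywhere.
  have hagree : ∀ a b c, a < b → b < c → Agree (D a b) (D b c) := by
    obtain ⟨s, hs⟩ := exists_settling_stage (val2 (D 1 2))
    obtain ⟨b, hb, hsb⟩ := hunb 2 s
    obtain ⟨c, hbc, hsc⟩ := hunb b s
    have : Agree (D 1 b) (D b c) := by
      intro e he
      rw [hpart b hb] at he
      have := hadd 1 2 b (by omega) hb
      rw [Bool.eq_iff_iff, hs _ (by omega) e he, hs _ hsc e he]
    exact fun a' b' c' h₁ h₂ => (bits 1 b c a' b' c' (by omega) hbc h₁ h₂).2.1 this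
  refine ⟨fun a b e hab he => ⟨fun h => mem_haltingSet_iff.2 ⟨_, h⟩, fun h => ?_⟩, fun e => ?_⟩
  · obtain ⟨s, hs⟩ := mem_haltingSet_iff.1 h
    obtain ⟨c, hbc, hsc⟩ := hunb b s
    -- The halting computation is visible at the late stage `D b c`; agreement carries it back to
    -- stage `D a b`.
    rw [hagree a b c hab hbc e he]
    exact haltsWithin_mono hsc hs
  · have : ∀ n, n ≤ val2 (D n (n + 1)) := by
      intro n
      induction n with
      | zero => exact Nat.zero_le _
      | succ n ih => exact ih.trans_lt (hlt n (n + 1) (n + 2) (by omega) (by omega))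
    exact ⟨e + 1, this (e + 1)⟩

theorem IsSolution.exists_val2 {Y : Set ℕ} (h : IsSolution jumpColouring Y) :
    (∀ n ∈ Y, ∀ e < val2 n, (haltsWithin n e = true ↔ e ∈ haltingSet)) ∧
      ∀ e, ∃ n ∈ Y, e < val2 n := by
  obtain ⟨hinf, i, hi⟩ := h
  have hmono : StrictMono (Nat.nth (· ∈ Y)) := Nat.nth_strictMono hinf
  have hD : ∀ a b : ℕ, a < b → Finset.Icc a (b - 1) = Finset.Ico a b := by
    intro a b hab
    ext k
    simp only [Finset.mem_Icc, Finset.mem_Ico]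
    omega
  -- Index `0` is excluded because the solution may contain the number `0`.
  have hpos : ∀ a b, 0 < a → a < b → ∑ k ∈ Finset.Ico a b, Nat.nth (· ∈ Y) k ≠ 0 := by
    intro a b ha hab h0
    have := Finset.sum_eq_zero_iff.1 h0 a (Finset.left_mem_Ico.2 hab)
    have := hmono.le_apply (x := a)
    omega
  have hunb : ∀ b s, ∃ c, b < c ∧ s ≤ ∑ k ∈ Finset.Ico b c, Nat.nth (· ∈ Y) k := by
    intro b s
    refine ⟨b + s + 1, by omega, ?_⟩
    have h₁ : Nat.nth (· ∈ Y) (b + s) ≤ ∑ k ∈ Finset.Ico b (b + s + 1), Nat.nth (· ∈ Y) k :=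
      Finset.single_le_sum (fun _ _ => Nat.zero_le _) (Finset.mem_Ico.2 ⟨by omega, by omega⟩)
    have := hmono.le_apply (x := b + s)
    omega
  have hcol : ∀ a b c, a < b → b < c → jumpColouring (∑ k ∈ Finset.Ico a b, Nat.nth (· ∈ Y) k)
      (∑ k ∈ Finset.Ico b c, Nat.nth (· ∈ Y) k) = i := by
    intro a b c hab hbc
    exact hi (∑ k ∈ Finset.Ico a b, Nat.nth (· ∈ Y) k, ∑ k ∈ Finset.Ico b c, Nat.nth (· ∈ Y) k)
      ⟨a, b - 1, c - 1, by omega, by omega,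
        by rw [hD a b hab, show b - 1 + 1 = b by omega, hD b c hbc]⟩
  obtain ⟨h₁, h₂⟩ := haltsWithin_iff_of_constant
    (D := fun a b => ∑ k ∈ Finset.Ico a b, Nat.nth (· ∈ Y) k) (i := i)
    (fun a b c hab hbc => Finset.sum_Ico_consecutive _ hab.le hbc.le) hpos hunb hcol
  have single : ∀ a, ∑ k ∈ Finset.Ico a (a + 1), Nat.nth (· ∈ Y) k = Nat.nth (· ∈ Y) a := by
    intro a; simp
  constructor
  · intro n hn e he
    obtain ⟨a, rfl⟩ : n ∈ Set.range (Nat.nth (· ∈ Y)) := by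
      rw [Nat.range_nth_of_infinite (p := fun x => x ∈ Y) hinf]; exact hn
    have := h₁ a (a + 1) e (by omega)
    rw [single] at this
    exact this he
  · intro e
    obtain ⟨a, ha⟩ := h₂ e
    rw [single] at ha
    exact ⟨_, Nat.nth_mem_of_infinite hinf a, ha⟩

-- On input `e`, search the oracle set for `n` with `e < val2 n` and run the `e`-th program with
-- bound `n`; unboundedness of the valuations makes the search total.
open Classical in
theorem computes_haltingSet_of_val2 {Y : Set ℕ}
    (h₁ : ∀ n ∈ Y, ∀ e < val2 n, (haltsWithin n e = true ↔ e ∈ haltingSet))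
    (h₂ : ∀ e, ∃ n ∈ Y, e < val2 n) : Computes Y haltingSet := by
  rw [Computes, TuringReducible, RecursiveIn.iff_nat]
  have prim : ∀ {f : ℕ → ℕ}, Primrec f → Nat.RecursiveIn {charFun Y} fun n => f n := fun hf =>
    (Primrec.nat_iff.1 hf).recursiveIn
  -- The argument is the oracle's answer for `n` paired with `(e, n)`. Success is coded by `0`, the
  -- value that `rfind` looks for.
  have test : Primrec fun m : ℕ => if m.unpair.1 = 1 ∧
      m.unpair.2.unpair.1 < val2 m.unpair.2.unpair.2 then 0 else 1 := by
    have u₁ : Primrec fun m : ℕ => m.unpair.1 := Primrec.fst.comp Primrec.unpair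
    have u₂ : Primrec fun m : ℕ => m.unpair.2 := Primrec.snd.comp Primrec.unpair
    exact Primrec.ite (PrimrecPred.and (Primrec.eq.comp u₁ (Primrec.const 1))
      (Primrec.nat_lt.comp (u₁.comp u₂) (primrec_val2.comp (u₂.comp u₂)))) (Primrec.const 0)
      (Primrec.const 1)
  have out : Primrec fun m : ℕ => if haltsWithin m.unpair.2 m.unpair.1 = true then 1 else 0 :=
    Primrec.ite (Primrec.eq.comp (primrec_haltsWithin.comp (Primrec.snd.comp Primrec.unpair)
      (Primrec.fst.comp Primrec.unpair)) (Primrec.const true)) (Primrec.const 1) (Primrec.const 0)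
  have oracle : Nat.RecursiveIn {charFun Y} (charFun Y) := .oracle _ rfl
  have tested : Nat.RecursiveIn {charFun Y} fun m => Part.some
      (if m.unpair.2 ∈ Y ∧ m.unpair.1 < val2 m.unpair.2 then 0 else 1) := by
    refine ((prim test).comp ((oracle.comp .right).pair (prim Primrec.id))).of_eq fun m => ?_
    have hb : (Part.some m.unpair.2 >>= charFun Y) =
        Part.some (if m.unpair.2 ∈ Y then 1 else 0) := Part.bind_some _ _
    by_cases hm : m.unpair.2 ∈ Y <;> simp [hb, Seq.seq, hm]
  have search : Nat.RecursiveIn {charFun Y} fun e => Part.some (Nat.find (h₂ e)) := by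
    refine tested.rfind.of_eq fun e => Part.eq_some_iff.2 (Nat.mem_rfind.2 ⟨?_, fun {m} hm => ?_⟩)
    · simpa using Nat.find_spec (h₂ e)
    · simpa using Nat.find_min (h₂ e) hm
  refine ((prim out).comp ((prim Primrec.id).pair search)).of_eq fun e => ?_
  obtain ⟨hY, he⟩ := Nat.find_spec (h₂ e)
  simp [charFun, Seq.seq, h₁ _ hY e he]

theorem exists_colouring_computing_haltingSet : ∃ c : ℕ → ℕ → Fin 4, Computable₂ c ∧
    ∀ Y : Set ℕ, IsSolution c Y → Computes Y haltingSet :=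
  ⟨jumpColouring, primrec_jumpColouring.to_comp, fun _ h =>
    computes_haltingSet_of_val2 h.exists_val2.1 h.exists_val2.2⟩

end AdjacentHindman

namespace SecondOrderArith

/-! ## Renaming variables -/

/-- Rename the number variables of a term. -/
def Term.rename (ρ : ℕ → ℕ) : Term → Term
  | .var x => .var (ρ x)
  | .zero => .zero
  | .one => .one
  | .add s t => .add (s.rename ρ) (t.rename ρ)
  | .mul s t => .mul (s.rename ρ) (t.rename ρ)

theorem Term.occurs_rename {ρ : ℕ → ℕ} {x : ℕ} :
    ∀ {t : Term}, (t.rename ρ).Occurs x → ∃ y, t.Occurs y ∧ ρ y = x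
  | .var y, h => ⟨y, rfl, h.symm⟩
  | .zero, h => h.elim
  | .one, h => h.elim
  | .add s t, h => h.elim
      (fun h => let ⟨y, hy, e⟩ := Term.occurs_rename (t := s) h; ⟨y, .inl hy, e⟩)
      (fun h => let ⟨y, hy, e⟩ := Term.occurs_rename (t := t) h; ⟨y, .inr hy, e⟩)
  | .mul s t, h => h.elim
      (fun h => let ⟨y, hy, e⟩ := Term.occurs_rename (t := s) h; ⟨y, .inl hy, e⟩)
      (fun h => let ⟨y, hy, e⟩ := Term.occurs_rename (t := t) h; ⟨y, .inr hy, e⟩)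

/-- Rename all (free and bound) number and set variables of a formula. -/
def Formula.rename (ρ σ : ℕ → ℕ) : Formula → Formula
  | .eq s t => .eq (s.rename ρ) (t.rename ρ)
  | .lt s t => .lt (s.rename ρ) (t.rename ρ)
  | .mem t X => .mem (t.rename ρ) (σ X)
  | .neg φ => .neg (φ.rename ρ σ)
  | .and φ ψ => .and (φ.rename ρ σ) (ψ.rename ρ σ)
  | .all x φ => .all (ρ x) (φ.rename ρ σ)
  | .allSet X φ => .allSet (σ X) (φ.rename ρ σ)

/-- Renaming away from `x` supplies the freshness condition of the induction scheme;
`setFree_rename` does so for comprehension. -/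
theorem Formula.numFree_rename {ρ σ : ℕ → ℕ} {x : ℕ} (hx : ∀ y, ρ y ≠ x) :
    ∀ φ : Formula, ¬ (φ.rename ρ σ).NumFree x
  | .eq _ _, h => h.elim (fun h => let ⟨y, _, e⟩ := Term.occurs_rename h; hx y e)
      (fun h => let ⟨y, _, e⟩ := Term.occurs_rename h; hx y e)
  | .lt _ _, h => h.elim (fun h => let ⟨y, _, e⟩ := Term.occurs_rename h; hx y e)
      (fun h => let ⟨y, _, e⟩ := Term.occurs_rename h; hx y e)
  | .mem _ _, h => let ⟨y, _, e⟩ := Term.occurs_rename h; hx y e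
  | .neg φ, h => numFree_rename hx φ h
  | .and φ ψ, h => h.elim (numFree_rename hx φ) (numFree_rename hx ψ)
  | .all _ φ, h => numFree_rename hx φ h.2
  | .allSet _ φ, h => numFree_rename hx φ h

theorem Formula.setFree_rename {ρ σ : ℕ → ℕ} {X : ℕ} (hX : ∀ Y, σ Y ≠ X) :
    ∀ φ : Formula, ¬ (φ.rename ρ σ).SetFree X
  | .eq _ _, h => h
  | .lt _ _, h => h
  | .mem _ Y, h => hX Y h.symm
  | .neg φ, h => setFree_rename hX φ h
  | .and φ ψ, h => h.elim (setFree_rename hX φ) (setFree_rename hX ψ)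
  | .all _ φ, h => setFree_rename hX φ h
  | .allSet _ φ, h => setFree_rename hX φ h.2

theorem Formula.IsBounded.rename {ρ σ : ℕ → ℕ} (hρ : Function.Injective ρ) {φ : Formula}
    (h : φ.IsBounded) : (φ.rename ρ σ).IsBounded := by
  induction h with
  | eq s t => exact .eq _ _
  | lt s t => exact .lt _ _
  | mem t X => exact .mem _ _
  | neg _ ih => exact .neg ih
  | and _ _ ih₁ ih₂ => exact .and ih₁ ih₂
  | ball hx _ ih =>
    refine .ball (fun h => ?_) ih
    obtain ⟨y, hy, e⟩ := Term.occurs_rename h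
    exact hx (hρ e ▸ hy)

namespace Model

variable {M : Model.{u}}

theorem eval_rename (v : ℕ → M.Num) (ρ : ℕ → ℕ) :
    ∀ t : Term, M.eval v (t.rename ρ) = M.eval (v ∘ ρ) t
  | .var _ => rfl
  | .zero => rfl
  | .one => rfl
  | .add s t => congrArg₂ M.add (eval_rename v ρ s) (eval_rename v ρ t)
  | .mul s t => congrArg₂ M.mul (eval_rename v ρ s) (eval_rename v ρ t)

/-- Bound variables are renamed too; injectivity rules out capture, since it makes updating an
assignment commute with the renaming. -/
theorem sat_rename {ρ σ : ℕ → ℕ} (hρ : Function.Injective ρ) (hσ : Function.Injective σ)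
    (φ : Formula) : ∀ (v : ℕ → M.Num) (w : ℕ → M.Sets),
      M.Sat v w (φ.rename ρ σ) ↔ M.Sat (v ∘ ρ) (w ∘ σ) φ := by
  induction φ with
  | eq s t => intro v w; simp only [Formula.rename, Sat, eval_rename]
  | lt s t => intro v w; simp only [Formula.rename, Sat, eval_rename]
  | mem t X => intro v w; simp only [Formula.rename, Sat, eval_rename, Function.comp_apply]
  | neg φ ih => intro v w; simp only [Formula.rename, Sat, ih]
  | and φ ψ ih₁ ih₂ => intro v w; simp only [Formula.rename, Sat, ih₁, ih₂]
  | all x φ ih =>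
    intro v w
    simp only [Formula.rename, Sat, ih, Function.update_comp_eq_of_injective v hρ]
  | allSet X φ ih =>
    intro v w
    simp only [Formula.rename, Sat, ih, Function.update_comp_eq_of_injective w hσ]

theorem sat_congr_set {w w' : ℕ → M.Sets} {φ : Formula} (v : ℕ → M.Num)
    (h : ∀ X, φ.SetFree X → w X = w' X) : M.Sat v w φ ↔ M.Sat v w' φ := by
  induction φ generalizing v w w' with
  | eq s t => rfl
  | lt s t => rfl
  | mem t X => simp only [Sat, h X rfl]
  | neg φ ih => simp only [Sat, ih v h]
  | and φ ψ ih₁ ih₂ =>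
    simp only [Sat, ih₁ v fun X hX => h X (.inl hX), ih₂ v fun X hX => h X (.inr hX)]
  | all x φ ih => exact forall_congr' fun a => ih _ h
  | allSet X φ ih =>
    refine forall_congr' fun A => ih _ fun Y hY => ?_
    by_cases e : Y = X
    · subst e; simp
    · simp [e, h Y ⟨e, hY⟩]

/-! ## Definability with parameters

Predicates and functions are given on environments `ℕ → M.Num`; binding is in the style of
de Bruijn, the bound variable being the entry `0` of the environment. -/

/-- Extend an environment by a new first entry. -/
def cons {α : Type*} (a : α) (v : ℕ → α) : ℕ → α
  | 0 => a
  | i + 1 => v i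

@[simp] theorem cons_zero {α : Type*} (a : α) (v : ℕ → α) : cons a v 0 = a := rfl

@[simp] theorem cons_succ {α : Type*} (a : α) (v : ℕ → α) (i : ℕ) : cons a v (i + 1) = v i := rfl

instance : Zero M.Num := ⟨M.zero⟩
instance : One M.Num := ⟨M.one⟩
instance : Add M.Num := ⟨M.add⟩
instance : Mul M.Num := ⟨M.mul⟩
instance : LT M.Num := ⟨M.lt⟩

/-- Polynomial functions with parameters. -/
inductive Poly : ((ℕ → M.Num) → M.Num) → Prop
  | var (i : ℕ) : Poly fun v => v i
  | const (a : M.Num) : Poly fun _ => a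
  | add {s t : (ℕ → M.Num) → M.Num} : Poly s → Poly t → Poly fun v => s v + t v
  | mul {s t : (ℕ → M.Num) → M.Num} : Poly s → Poly t → Poly fun v => s v * t v

/-- Predicates defined by a bounded formula with number and set parameters. -/
inductive Bdd : ((ℕ → M.Num) → Prop) → Prop
  | eq {s t : (ℕ → M.Num) → M.Num} : Poly s → Poly t → Bdd fun v => s v = t v
  | lt {s t : (ℕ → M.Num) → M.Num} : Poly s → Poly t → Bdd fun v => s v < t v
  | mem {t : (ℕ → M.Num) → M.Num} {A : Set M.Num} : Poly t → A ∈ M.Sets → Bdd fun v => t v ∈ A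
  | not {P : (ℕ → M.Num) → Prop} : Bdd P → Bdd fun v => ¬ P v
  | and {P Q : (ℕ → M.Num) → Prop} : Bdd P → Bdd Q → Bdd fun v => P v ∧ Q v
  | ball_cons {t : (ℕ → M.Num) → M.Num} {P : (ℕ → M.Num) → Prop} : Poly t → Bdd P →
      Bdd fun v => ∀ a, a < t v → P (cons a v)

theorem Poly.subst {t : (ℕ → M.Num) → M.Num} (ht : Poly t) {σ : ℕ → (ℕ → M.Num) → M.Num}
    (hσ : ∀ i, Poly (σ i)) : Poly fun v => t fun i => σ i v := by
  induction ht with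
  | var i => exact hσ i
  | const a => exact .const a
  | add _ _ ih₁ ih₂ => exact .add ih₁ ih₂
  | mul _ _ ih₁ ih₂ => exact .mul ih₁ ih₂

theorem Poly.lift {t : (ℕ → M.Num) → M.Num} (ht : Poly t) : Poly fun v => t fun i => v (i + 1) :=
  ht.subst fun i => .var (i + 1)

theorem Bdd.of_iff {P Q : (ℕ → M.Num) → Prop} (hP : Bdd P) (h : ∀ v, Q v ↔ P v) : Bdd Q :=
  (funext fun v => propext (h v) : Q = P) ▸ hP

theorem Bdd.subst {P : (ℕ → M.Num) → Prop} (hP : Bdd P) {σ : ℕ → (ℕ → M.Num) → M.Num}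
    (hσ : ∀ i, Poly (σ i)) : Bdd fun v => P fun i => σ i v := by
  induction hP generalizing σ with
  | eq hs ht => exact .eq (hs.subst hσ) (ht.subst hσ)
  | lt hs ht => exact .lt (hs.subst hσ) (ht.subst hσ)
  | mem ht hA => exact .mem (ht.subst hσ) hA
  | not _ ih => exact .not (ih hσ)
  | and _ _ ih₁ ih₂ => exact .and (ih₁ hσ) (ih₂ hσ)
  | @ball_cons t P ht _ ih =>
    -- Under the binder entry `0` is kept, and the substituted functions read the environment behind
    -- it.
    have := Bdd.ball_cons (ht.subst hσ)
      (ih (σ := fun i => cons (fun v => v 0) (fun i v => σ i fun j => v (j + 1)) i)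
        (fun i => match i with | 0 => .var 0 | i + 1 => (hσ i).lift))
    refine this.of_iff fun v => forall₂_congr fun a _ => ?_
    have : (cons a fun i => σ i v) = fun i =>
        cons (fun v : ℕ → M.Num => v 0) (fun i v => σ i fun j => v (j + 1)) i (cons a v) := by
      funext i; cases i <;> rfl
    rw [this]

theorem Bdd.lift {P : (ℕ → M.Num) → Prop} (hP : Bdd P) : Bdd fun v => P fun i => v (i + 1) :=
  hP.subst fun i => .var (i + 1)

theorem Poly.exists_support {t : (ℕ → M.Num) → M.Num} (ht : Poly t) :
    ∃ n : ℕ, ∀ v v' : ℕ → M.Num, (∀ i < n, v i = v' i) → t v = t v' := by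
  induction ht with
  | var i => exact ⟨i + 1, fun v v' h => h i (Nat.lt_succ_self i)⟩
  | const a => exact ⟨0, fun _ _ _ => rfl⟩
  | add _ _ ih₁ ih₂ =>
    obtain ⟨n₁, h₁⟩ := ih₁
    obtain ⟨n₂, h₂⟩ := ih₂
    exact ⟨max n₁ n₂, fun v v' h => congrArg₂ _ (h₁ v v' fun i hi => h i (by omega))
      (h₂ v v' fun i hi => h i (by omega))⟩
  | mul _ _ ih₁ ih₂ =>
    obtain ⟨n₁, h₁⟩ := ih₁
    obtain ⟨n₂, h₂⟩ := ih₂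
    exact ⟨max n₁ n₂, fun v v' h => congrArg₂ _ (h₁ v v' fun i hi => h i (by omega))
      (h₂ v v' fun i hi => h i (by omega))⟩

/-- Only finitely many entries matter. This allows all of them to be packed into one by pairing, or
replaced one at a time. -/
theorem Bdd.exists_support {P : (ℕ → M.Num) → Prop} (hP : Bdd P) :
    ∃ n : ℕ, ∀ v v' : ℕ → M.Num, (∀ i < n, v i = v' i) → (P v ↔ P v') := by
  induction hP with
  | eq hs ht =>
    obtain ⟨n₁, h₁⟩ := hs.exists_support
    obtain ⟨n₂, h₂⟩ := ht.exists_support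
    exact ⟨max n₁ n₂, fun v v' h => by
      beta_reduce; rw [h₁ v v' fun i hi => h i (by omega), h₂ v v' fun i hi => h i (by omega)]⟩
  | lt hs ht =>
    obtain ⟨n₁, h₁⟩ := hs.exists_support
    obtain ⟨n₂, h₂⟩ := ht.exists_support
    exact ⟨max n₁ n₂, fun v v' h => by
      beta_reduce; rw [h₁ v v' fun i hi => h i (by omega), h₂ v v' fun i hi => h i (by omega)]⟩
  | mem ht _ =>
    obtain ⟨n, hn⟩ := ht.exists_support
    exact ⟨n, fun v v' h => by beta_reduce; rw [hn v v' h]⟩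
  | not _ ih =>
    obtain ⟨n, hn⟩ := ih
    exact ⟨n, fun v v' h => by beta_reduce; rw [hn v v' h]⟩
  | and _ _ ih₁ ih₂ =>
    obtain ⟨n₁, h₁⟩ := ih₁
    obtain ⟨n₂, h₂⟩ := ih₂
    exact ⟨max n₁ n₂, fun v v' h => by
      beta_reduce; rw [h₁ v v' fun i hi => h i (by omega), h₂ v v' fun i hi => h i (by omega)]⟩
  | ball_cons ht _ ih =>
    obtain ⟨n₁, h₁⟩ := ht.exists_support
    obtain ⟨n₂, h₂⟩ := ih
    refine ⟨max n₁ n₂, fun v v' h => ?_⟩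
    beta_reduce
    rw [h₁ v v' fun i hi => h i (by omega)]
    refine forall₂_congr fun a _ => h₂ _ _ fun i hi => ?_
    cases i with
    | zero => rfl
    | succ i => exact h i (by omega)

/-! ### From definable predicates to formulas -/

/-- `u` assigns the parameters `p` to the odd variables. -/
def Fits (p u : ℕ → M.Num) : Prop := ∀ i, u (2 * i + 1) = p i

/-- The even part of an assignment. -/
def evens {α : Type*} (u : ℕ → α) : ℕ → α := fun i => u (2 * i)

/-- The assignment with even part `v` and odd part `p`. -/
def interleave {α : Type*} (v p : ℕ → α) : ℕ → α :=
  fun i => if i % 2 = 0 then v (i / 2) else p (i / 2)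

@[simp] theorem interleave_even {α : Type*} (v p : ℕ → α) (i : ℕ) :
    interleave v p (2 * i) = v i := by
  simp [interleave]

@[simp] theorem interleave_odd {α : Type*} (v p : ℕ → α) (i : ℕ) :
    interleave v p (2 * i + 1) = p i := by
  have h₁ : (2 * i + 1) % 2 ≠ 0 := by omega
  have h₂ : (2 * i + 1) / 2 = i := by omega
  simp [interleave, h₂]

/-- Keep the even numbers, and map the `i`-th odd number to the `f i`-th one. -/
def oddMap (f : ℕ → ℕ) : ℕ → ℕ := interleave (fun i => 2 * i) fun i => 2 * f i + 1

theorem oddMap_injective {f : ℕ → ℕ} (hf : Function.Injective f) :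
    Function.Injective (oddMap f) := by
  intro i j h
  rcases Nat.even_or_odd' i with ⟨a, rfl | rfl⟩ <;> rcases Nat.even_or_odd' j with ⟨b, rfl | rfl⟩ <;>
    simp only [oddMap, interleave_even, interleave_odd] at h
  · omega
  · omega
  · omega
  · rw [hf (a₁ := a) (a₂ := b) (by omega)]

theorem evens_comp_oddMap {α : Type*} (u : ℕ → α) (f : ℕ → ℕ) : evens (u ∘ oddMap f) = evens u := by
  funext i; simp [evens, oddMap]

theorem Fits.oddMap {p u : ℕ → M.Num} (h : Fits p u) (f : ℕ → ℕ) :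
    Fits (p ∘ f) (u ∘ oddMap f) := by
  intro i; simp [Model.oddMap, h (f i)]

/-- Move the variable `0` to `1`, the other even variables two down, the odd variables two up. -/
def bindMap : ℕ → ℕ := interleave (cons 1 fun i => 2 * i) fun i => 2 * i + 3

theorem bindMap_injective : Function.Injective bindMap := by
  intro i j h
  rcases Nat.even_or_odd' i with ⟨a, rfl | rfl⟩ <;> rcases Nat.even_or_odd' j with ⟨b, rfl | rfl⟩ <;>
    simp only [bindMap, interleave_even, interleave_odd] at h
  · rcases a with _ | a <;> rcases b with _ | b <;> simp only [cons_zero, cons_succ] at h <;> omega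
  · rcases a with _ | a <;> simp only [cons_zero, cons_succ] at h <;> omega
  · rcases b with _ | b <;> simp only [cons_zero, cons_succ] at h <;> omega
  · omega

/-- Environment entries live on even variables and parameters on odd ones, so the parameters of two
subterms can be interleaved without disturbing the entries. -/
theorem Poly.exists_term {t : (ℕ → M.Num) → M.Num} (ht : Poly t) :
    ∃ (τ : Term) (p : ℕ → M.Num), ∀ u, Fits p u → M.eval u τ = t (evens u) := by
  induction ht with
  | var i => exact ⟨.var (2 * i), fun _ => 0, fun _ _ => rfl⟩
  | const a => exact ⟨.var 1, fun _ => a, fun u hu => hu 0⟩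
  | add _ _ ih₁ ih₂ =>
    obtain ⟨τ₁, p₁, h₁⟩ := ih₁
    obtain ⟨τ₂, p₂, h₂⟩ := ih₂
    refine ⟨.add (τ₁.rename (oddMap fun i => 2 * i)) (τ₂.rename (oddMap fun i => 2 * i + 1)),
      interleave p₁ p₂, fun u hu => congrArg₂ M.add ?_ ?_⟩
    · rw [eval_rename, h₁, evens_comp_oddMap]
      convert hu.oddMap fun i => 2 * i using 1; funext i; simp
    · rw [eval_rename, h₂, evens_comp_oddMap]
      convert hu.oddMap fun i => 2 * i + 1 using 1; funext i; simp
  | mul _ _ ih₁ ih₂ =>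
    obtain ⟨τ₁, p₁, h₁⟩ := ih₁
    obtain ⟨τ₂, p₂, h₂⟩ := ih₂
    refine ⟨.mul (τ₁.rename (oddMap fun i => 2 * i)) (τ₂.rename (oddMap fun i => 2 * i + 1)),
      interleave p₁ p₂, fun u hu => congrArg₂ M.mul ?_ ?_⟩
    · rw [eval_rename, h₁, evens_comp_oddMap]
      convert hu.oddMap fun i => 2 * i using 1; funext i; simp
    · rw [eval_rename, h₂, evens_comp_oddMap]
      convert hu.oddMap fun i => 2 * i + 1 using 1; funext i; simp

theorem Poly.exists_terms {s t : (ℕ → M.Num) → M.Num} (hs : Poly s) (ht : Poly t) :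
    ∃ (σ τ : Term) (p : ℕ → M.Num), ∀ u, Fits p u →
      M.eval u σ = s (evens u) ∧ M.eval u τ = t (evens u) := by
  obtain ⟨σ, p, hp⟩ := hs.exists_term
  obtain ⟨τ, q, hq⟩ := ht.exists_term
  refine ⟨σ.rename (oddMap fun i => 2 * i), τ.rename (oddMap fun i => 2 * i + 1),
    interleave p q, fun u hu => ⟨?_, ?_⟩⟩
  · rw [eval_rename, hp, evens_comp_oddMap]
    convert hu.oddMap fun i => 2 * i using 1; funext i; simp
  · rw [eval_rename, hq, evens_comp_oddMap]
    convert hu.oddMap fun i => 2 * i + 1 using 1; funext i; simp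

theorem sat_imp (v : ℕ → M.Num) (w : ℕ → M.Sets) (φ ψ : Formula) :
    M.Sat v w (.imp φ ψ) ↔ (M.Sat v w φ → M.Sat v w ψ) := by
  simp [Formula.imp, Sat]

theorem sat_or (v : ℕ → M.Num) (w : ℕ → M.Sets) (φ ψ : Formula) :
    M.Sat v w (.or φ ψ) ↔ (M.Sat v w φ ∨ M.Sat v w ψ) := by
  simp only [Formula.or, Sat]; tauto

theorem sat_iff (v : ℕ → M.Num) (w : ℕ → M.Sets) (φ ψ : Formula) :
    M.Sat v w (.iff φ ψ) ↔ (M.Sat v w φ ↔ M.Sat v w ψ) := by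
  simp only [Formula.iff, Sat, sat_imp]; tauto

theorem sat_ex (v : ℕ → M.Num) (w : ℕ → M.Sets) (x : ℕ) (φ : Formula) :
    M.Sat v w (.ex x φ) ↔ ∃ a, M.Sat (Function.update v x a) w φ := by
  simp [Formula.ex, Sat]

theorem sat_exSet (v : ℕ → M.Num) (w : ℕ → M.Sets) (X : ℕ) (φ : Formula) :
    M.Sat v w (.exSet X φ) ↔ ∃ A, M.Sat v (Function.update w X A) φ := by
  simp [Formula.exSet, Sat]

/-- The bounded formula `θ` defines `P` under the number parameters `p` and set parameters `w`. -/
def Defines (θ : Formula) (p : ℕ → M.Num) (w : ℕ → M.Sets) (P : (ℕ → M.Num) → Prop) : Prop :=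
  θ.IsBounded ∧ ∀ u, Fits p u → (M.Sat u w θ ↔ P (evens u))

theorem exists_common {P Q : (ℕ → M.Num) → Prop} (hP : ∃ θ p w, Defines θ p w P)
    (hQ : ∃ θ p w, Defines θ p w Q) :
    ∃ θ₁ θ₂ p w, Defines θ₁ p w P ∧ Defines θ₂ p w Q := by
  obtain ⟨θ₁, p₁, w₁, hθ₁, h₁⟩ := hP
  obtain ⟨θ₂, p₂, w₂, hθ₂, h₂⟩ := hQ
  have i₁ : Function.Injective fun i : ℕ => 2 * i := fun i j h => by
    simp only at h; omega
  have i₂ : Function.Injective fun i : ℕ => 2 * i + 1 := fun i j h => by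
    simp only at h; omega
  refine ⟨θ₁.rename (oddMap fun i => 2 * i) fun i => 2 * i,
    θ₂.rename (oddMap fun i => 2 * i + 1) fun i => 2 * i + 1, interleave p₁ p₂, interleave w₁ w₂,
    ⟨hθ₁.rename (oddMap_injective i₁), fun u hu => ?_⟩,
    ⟨hθ₂.rename (oddMap_injective i₂), fun u hu => ?_⟩⟩
  · rw [sat_rename (oddMap_injective i₁) i₁]
    have : interleave w₁ w₂ ∘ (fun i => 2 * i) = w₁ := by funext i; simp
    rw [this, h₁, evens_comp_oddMap]
    convert hu.oddMap fun i => 2 * i using 1; funext i; simp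
  · rw [sat_rename (oddMap_injective i₂) i₂]
    have : interleave w₁ w₂ ∘ (fun i => 2 * i + 1) = w₂ := by funext i; simp
    rw [this, h₂, evens_comp_oddMap]
    convert hu.oddMap fun i => 2 * i + 1 using 1; funext i; simp

theorem Bdd.exists_formula {P : (ℕ → M.Num) → Prop} (hP : Bdd P) :
    ∃ (θ : Formula) (p : ℕ → M.Num) (w : ℕ → M.Sets), Defines θ p w P := by
  obtain ⟨A₀, hA₀⟩ := M.sets_nonempty
  induction hP with
  | eq hs ht =>
    obtain ⟨σ, τ, p, h⟩ := hs.exists_terms ht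
    exact ⟨.eq σ τ, p, fun _ => ⟨A₀, hA₀⟩, .eq _ _, fun u hu => by
      simp only [Sat, (h u hu).1, (h u hu).2]⟩
  | lt hs ht =>
    obtain ⟨σ, τ, p, h⟩ := hs.exists_terms ht
    exact ⟨.lt σ τ, p, fun _ => ⟨A₀, hA₀⟩, .lt _ _, fun u hu => by
      simp only [Sat, (h u hu).1, (h u hu).2]; rfl⟩
  | @mem t A ht hA =>
    obtain ⟨τ, p, h⟩ := ht.exists_term
    exact ⟨.mem τ 0, p, fun _ => ⟨A, hA⟩, .mem _ _, fun u hu => by simp only [Sat, h u hu]⟩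
  | not _ ih =>
    obtain ⟨θ, p, w, hθ, h⟩ := ih
    exact ⟨.neg θ, p, w, .neg hθ, fun u hu => not_congr (h u hu)⟩
  | and _ _ ih₁ ih₂ =>
    obtain ⟨θ₁, θ₂, p, w, h₁, h₂⟩ := exists_common ih₁ ih₂
    exact ⟨.and θ₁ θ₂, p, w, .and h₁.1 h₂.1, fun u hu => and_congr (h₁.2 u hu) (h₂.2 u hu)⟩
  | @ball_cons t P ht _ ih =>
    obtain ⟨θ, p, w, hθ, h⟩ := ih
    obtain ⟨τ, q, hq⟩ := ht.exists_term
    -- `bindMap` moves the bound entry to variable `1`, the parameter slot `0`. Slots `2 * i + 1`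
    -- then hold the parameters of `θ` and slots `2 * i + 2` those of `τ`.
    have hb : Function.Injective (oddMap (cons 0 fun i => 2 * i + 1) ∘ bindMap) := by
      refine (oddMap_injective ?_).comp bindMap_injective
      rintro (_ | i) (_ | j) h <;> simp only [cons_zero, cons_succ] at h <;> omega
    refine ⟨.all 1 (.imp (.lt (.var 1) (τ.rename (oddMap fun i => 2 * i + 2)))
      (θ.rename (oddMap (cons 0 fun i => 2 * i + 1) ∘ bindMap) id)),
      interleave (cons 0 q) p, w, .ball ?_ (hθ.rename hb), fun u hu => ?_⟩
    · intro h
      obtain ⟨y, _, hy⟩ := Term.occurs_rename h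
      rcases Nat.even_or_odd' y with ⟨a, rfl | rfl⟩ <;>
        simp only [oddMap, interleave_even, interleave_odd] at hy <;> omega
    · simp only [Sat, sat_imp]
      refine forall_congr' fun a => ?_
      have e₁ : M.eval (Function.update u 1 a) (.var 1) = a := by simp [eval]
      have e₂ : M.eval (Function.update u 1 a) (τ.rename (oddMap fun i => 2 * i + 2)) =
          t (evens u) := by
        rw [eval_rename, hq, evens_comp_oddMap]
        · congr 1; funext i; simp only [evens]; rw [Function.update_of_ne (by omega)]
        · intro i
          have := hu (2 * (i + 1))
          rw [interleave_even] at this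
          simp only [Function.comp, oddMap, interleave_odd]
          rw [Function.update_of_ne (by omega)]
          exact this
      rw [e₁, e₂]
      refine imp_congr_right fun _ => ?_
      rw [sat_rename hb Function.injective_id, Function.comp_id, h]
      · have : evens (Function.update u 1 a ∘ oddMap (cons 0 fun i => 2 * i + 1) ∘ bindMap) =
            cons a (evens u) := by
          funext i
          cases i with
          | zero => simp [evens, bindMap, oddMap, interleave]
          | succ i =>
            simp only [evens, bindMap, Function.comp, interleave_even, cons_succ, oddMap]
            rw [Function.update_of_ne (by omega)]
        rw [this]
      · intro i
        have := hu (2 * i + 1)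
        rw [interleave_odd] at this
        have e : oddMap (cons 0 fun i => 2 * i + 1) (bindMap (2 * i + 1)) =
            2 * (2 * i + 1) + 1 := by
          have : bindMap (2 * i + 1) = 2 * (i + 1) + 1 := by
            rw [bindMap, interleave_odd]; ring
          rw [this, oddMap, interleave_odd, cons_succ]
        simp only [Function.comp, e]
        rw [Function.update_of_ne (by omega)]
        exact this

end Model

end SecondOrderArith

namespace SecondOrderArith

namespace Model

open Formula

variable {M : Model.{u}}

/-! ### Induction and comprehension for definable predicates. -/

/-- `M` is a model of `RCA₀`. -/
class IsRCA (M : Model.{u}) : Prop where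
  models : ∀ ψ ∈ RCA₀, M.Models ψ

/-- The shift frees number variable `1` and set variable `0`, which are needed for the auxiliary
variable of induction and for the set asserted by comprehension. -/
theorem Defines.sat_rename_succ {θ : Formula} {p : ℕ → M.Num} {w : ℕ → M.Sets}
    {P : (ℕ → M.Num) → Prop} (h : Defines θ p w P) (A : M.Sets) {u : ℕ → M.Num}
    (hu : ∀ i, u (2 * i + 3) = p i) :
    M.Sat u (cons A w) (θ.rename (oddMap Nat.succ) Nat.succ) ↔ P (evens u) := by
  rw [sat_rename (oddMap_injective Nat.succ_injective) Nat.succ_injective]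
  have : cons A w ∘ Nat.succ = w := rfl
  rw [this, h.2, evens_comp_oddMap]
  intro i
  simp only [Function.comp, oddMap, interleave_odd]
  exact hu i

theorem oddMap_succ_ne_one (i : ℕ) : oddMap Nat.succ i ≠ 1 := by
  rcases Nat.even_or_odd' i with ⟨a, rfl | rfl⟩ <;>
    simp only [oddMap, interleave_even, interleave_odd] <;> omega

theorem Bdd.imp {P Q : (ℕ → M.Num) → Prop} (hP : Bdd P) (hQ : Bdd Q) :
    Bdd fun v => P v → Q v :=
  (hP.and hQ.not).not.of_iff fun v => by tauto

theorem Bdd.or {P Q : (ℕ → M.Num) → Prop} (hP : Bdd P) (hQ : Bdd Q) :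
    Bdd fun v => P v ∨ Q v :=
  (hP.not.and hQ.not).not.of_iff fun v => by tauto

theorem Bdd.iff {P Q : (ℕ → M.Num) → Prop} (hP : Bdd P) (hQ : Bdd Q) :
    Bdd fun v => P v ↔ Q v :=
  ((hP.imp hQ).and (hQ.imp hP)).of_iff fun v => by tauto

variable [hM : IsRCA M]

theorem basic_models {ψ : Formula} (h : ψ ∈ basicAxioms) : M.Models ψ :=
  hM.models ψ (.inl (.inl h))

theorem sigma_induction {P : M.Num → M.Num → Prop} (hP : Bdd fun v => P (v 0) (v 1))
    (h₀ : ∃ y, P y 0) (h₁ : ∀ x, (∃ y, P y x) → ∃ y, P y (x + 1)) : ∀ x, ∃ y, P y x := by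
  obtain ⟨θ, p, w, h⟩ := hP.exists_formula
  obtain ⟨A₀, hA₀⟩ := M.sets_nonempty
  -- Variables `0` and `2` carry the entries `0` and `1`: the witness and the induction variable.
  have ax := hM.models (inductionFor 2 1 (ex 0 (θ.rename (oddMap Nat.succ) Nat.succ)))
    (.inl (.inr ⟨_, 2, 1, ⟨0, _, h.1.rename (oddMap_injective Nat.succ_injective), rfl⟩,
      by decide, fun hf => numFree_rename (x := 1) oddMap_succ_ne_one θ hf.2, rfl⟩))
    (interleave (fun _ => 0) (cons 0 p)) (cons ⟨A₀, hA₀⟩ w)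
  have key : ∀ a b c : M.Num, M.Sat (Function.update (Function.update (Function.update
      (interleave (fun _ => 0) (cons 0 p)) 1 a) 2 b) 0 c) (cons ⟨A₀, hA₀⟩ w)
      (θ.rename (oddMap Nat.succ) Nat.succ) ↔ P c b := by
    intro a b c
    rw [h.sat_rename_succ]
    · simp [evens]
    · intro i
      rw [Function.update_of_ne (by omega), Function.update_of_ne (by omega),
        Function.update_of_ne (by omega)]
      exact interleave_odd _ _ (i + 1)
  have key' : ∀ b c : M.Num, M.Sat (Function.update (Function.update
      (interleave (fun _ => 0) (cons 0 p)) 2 b) 0 c) (cons ⟨A₀, hA₀⟩ w)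
      (θ.rename (oddMap Nat.succ) Nat.succ) ↔ P c b := by
    intro b c
    rw [← key 0 b c]
    have : Function.update (interleave (fun _ => 0) (cons 0 p)) 1 0 =
        interleave (fun _ => (0 : M.Num)) (cons 0 p) := by
      rw [Function.update_eq_self_iff]; exact (interleave_odd (fun _ => (0 : M.Num)) (cons 0 p) 0).symm
    rw [this]
  simp only [inductionFor, atTerm, sat_imp, Sat, sat_ex, key, key'] at ax
  refine ax ⟨fun a ha => ?_, fun a ih b hb => ?_⟩
  · have e : a = 0 := by simp only [eval, Function.update_self] at ha; exact ha
    rw [e]; exact h₀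
  · have e : b = a + 1 := by
      simp only [eval, Function.update_self] at hb
      exact hb
    rw [e]
    exact h₁ a (ih a (by simp [eval]))

theorem delta_comprehension {P Q : M.Num → M.Num → Prop} (hP : Bdd fun v => P (v 0) (v 1))
    (hQ : Bdd fun v => Q (v 0) (v 1)) (h : ∀ x, (∃ y, P y x) ↔ ∀ y, Q y x) :
    {x | ∃ y, P y x} ∈ M.Sets := by
  obtain ⟨θ₁, θ₂, p, w, h₁, h₂⟩ := exists_common hP.exists_formula hQ.exists_formula
  obtain ⟨A₀, hA₀⟩ := M.sets_nonempty
  have ax := hM.models _ (.inr ⟨ex 0 (θ₁.rename (oddMap Nat.succ) Nat.succ),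
    all 0 (θ₂.rename (oddMap Nat.succ) Nat.succ), 2, 0,
    ⟨0, _, h₁.1.rename (oddMap_injective Nat.succ_injective), rfl⟩,
    ⟨0, _, h₂.1.rename (oddMap_injective Nat.succ_injective), rfl⟩,
    fun hf => setFree_rename (X := 0) Nat.succ_ne_zero θ₁ hf, rfl⟩)
    (interleave (fun _ => 0) (cons 0 p)) (cons ⟨A₀, hA₀⟩ w)
  have key : ∀ {θ : Formula} {P : M.Num → M.Num → Prop},
      Defines θ p w (fun v => P (v 0) (v 1)) → ∀ (A : M.Sets) (b c : M.Num),
      (M.Sat (Function.update (Function.update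
      (interleave (fun _ => 0) (cons 0 p)) 2 b) 0 c) (cons A w)
      (θ.rename (oddMap Nat.succ) Nat.succ) ↔ P c b) := by
    intro θ P h A b c
    rw [h.sat_rename_succ]
    · simp [evens]
    · intro i
      rw [Function.update_of_ne (by omega), Function.update_of_ne (by omega)]
      exact interleave_odd _ _ (i + 1)
  have upd : ∀ A B : M.Sets, Function.update (cons A w) 0 B = cons B w := by
    intro A B; funext i; cases i <;> simp
  simp only [comprehensionFor, sat_imp, Sat, sat_iff, sat_ex, sat_exSet, upd, key h₁, key h₂] at ax
  obtain ⟨A, hA⟩ := ax h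
  have : {x | ∃ y, P y x} = (A : Set M.Num) := by
    ext x
    rw [Set.mem_ofPred_eq, ← hA x]
    simp [eval]
  rw [this]
  exact A.2

/-! ### Arithmetic -/

theorem bdd_induction {P : M.Num → Prop} (hP : Bdd fun v => P (v 0))
    (h₀ : P 0) (h₁ : ∀ x, P x → P (x + 1)) : ∀ x, P x := by
  have := sigma_induction (P := fun _ x => P x) (hP.subst fun _ => .var 1) ⟨0, h₀⟩
    fun x ⟨y, h⟩ => ⟨y, h₁ x h⟩
  exact fun x => (this x).elim fun _ h => h

namespace Arith

theorem succ_ne_zero (a : M.Num) : a + 1 ≠ 0 :=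
  basic_models (ψ := neg (eq (nv 0 + 1) 0)) (by simp [basicAxioms]) (fun _ => a)
    (fun _ => ⟨_, M.sets_nonempty.choose_spec⟩)

theorem succ_inj {a b : M.Num} (h : a + 1 = b + 1) : a = b :=
  (sat_imp _ _ _ _).1 (basic_models (ψ := imp (eq (nv 0 + 1) (nv 1 + 1)) (eq (nv 0) (nv 1)))
    (by simp [basicAxioms]) (cons a fun _ => b) (fun _ => ⟨_, M.sets_nonempty.choose_spec⟩)) h

theorem add_zero (a : M.Num) : a + 0 = a :=
  basic_models (ψ := eq (nv 0 + 0) (nv 0)) (by simp [basicAxioms]) (fun _ => a)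
    (fun _ => ⟨_, M.sets_nonempty.choose_spec⟩)

theorem add_succ (a b : M.Num) : a + (b + 1) = a + b + 1 :=
  basic_models (ψ := eq (nv 0 + (nv 1 + 1)) ((nv 0 + nv 1) + 1)) (by simp [basicAxioms])
    (cons a fun _ => b) (fun _ => ⟨_, M.sets_nonempty.choose_spec⟩)

theorem mul_zero (a : M.Num) : a * 0 = 0 :=
  basic_models (ψ := eq (nv 0 * 0) 0) (by simp [basicAxioms]) (fun _ => a)
    (fun _ => ⟨_, M.sets_nonempty.choose_spec⟩)

theorem mul_succ (a b : M.Num) : a * (b + 1) = a * b + a :=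
  basic_models (ψ := eq (nv 0 * (nv 1 + 1)) (nv 0 * nv 1 + nv 0)) (by simp [basicAxioms])
    (cons a fun _ => b) (fun _ => ⟨_, M.sets_nonempty.choose_spec⟩)

theorem not_lt_zero (a : M.Num) : ¬ a < 0 :=
  basic_models (ψ := neg (Formula.lt (nv 0) 0)) (by simp [basicAxioms]) (fun _ => a)
    (fun _ => ⟨_, M.sets_nonempty.choose_spec⟩)

theorem lt_succ {a b : M.Num} : a < b + 1 ↔ a < b ∨ a = b := by
  have := basic_models (M := M)
    (ψ := iff (Formula.lt (nv 0) (nv 1 + 1)) (or (Formula.lt (nv 0) (nv 1)) (eq (nv 0) (nv 1))))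
    (by simp [basicAxioms]) (cons a fun _ => b) (fun _ => ⟨_, M.sets_nonempty.choose_spec⟩)
  rw [sat_iff, sat_or] at this
  exact this

theorem add_assoc (a b c : M.Num) : a + b + c = a + (b + c) := by
  refine bdd_induction (P := fun c => a + b + c = a + (b + c))
    (.eq (.add (.const _) (.var 0)) (.add (.const _) (.add (.const _) (.var 0)))) ?_ ?_ c
  · simp only [add_zero]
  · intro c h; simp only [add_succ, h]

theorem zero_add (a : M.Num) : 0 + a = a := by
  refine bdd_induction (P := fun a => 0 + a = a) (.eq (.add (.const _) (.var 0)) (.var 0)) ?_ ?_ a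
  · exact add_zero 0
  · intro a h; rw [add_succ, h]

theorem succ_add (a b : M.Num) : a + 1 + b = a + b + 1 := by
  refine bdd_induction (P := fun b => a + 1 + b = a + b + 1)
    (.eq (.add (.const _) (.var 0)) (.add (.add (.const _) (.var 0)) (.const _))) ?_ ?_ b
  · simp only [add_zero]
  · intro b h; simp only [add_succ, h]

theorem add_comm (a b : M.Num) : a + b = b + a := by
  refine bdd_induction (P := fun b => a + b = b + a)
    (.eq (.add (.const _) (.var 0)) (.add (.var 0) (.const _))) ?_ ?_ b
  · rw [add_zero, zero_add]
  · intro b h; rw [add_succ, succ_add, h]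

theorem add_right_cancel {a b c : M.Num} : a + c = b + c → a = b := by
  refine bdd_induction (P := fun c => a + c = b + c → a = b)
    (.imp (.eq (.add (.const _) (.var 0)) (.add (.const _) (.var 0)))
      (.eq (.const _) (.const _))) ?_ ?_ c
  · simp only [add_zero, imp_self]
  · intro c h e; rw [add_succ, add_succ] at e; exact h (succ_inj e)

theorem add_mul (a b c : M.Num) : (a + b) * c = a * c + b * c := by
  refine bdd_induction (P := fun c => (a + b) * c = a * c + b * c)
    (.eq (.mul (.const _) (.var 0)) (.add (.mul (.const _) (.var 0)) (.mul (.const _) (.var 0))))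
    ?_ ?_ c
  · simp only [mul_zero, add_zero]
  · intro c h
    simp only [mul_succ, h]
    rw [add_assoc, add_assoc, ← add_assoc (b * c), ← add_assoc a, add_comm (b * c) a]

theorem zero_mul (a : M.Num) : 0 * a = 0 := by
  refine bdd_induction (P := fun a => 0 * a = 0) (.eq (.mul (.const _) (.var 0)) (.const _)) ?_ ?_ a
  · exact mul_zero 0
  · intro a h; rw [mul_succ, h, add_zero]

theorem mul_one (a : M.Num) : a * 1 = a := by
  rw [← zero_add (1 : M.Num), mul_succ, mul_zero, zero_add]

theorem one_mul (a : M.Num) : 1 * a = a := by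
  refine bdd_induction (P := fun a => 1 * a = a) (.eq (.mul (.const _) (.var 0)) (.var 0)) ?_ ?_ a
  · exact mul_zero 1
  · intro a h; rw [mul_succ, h]

theorem mul_comm (a b : M.Num) : a * b = b * a := by
  refine bdd_induction (P := fun b => a * b = b * a)
    (.eq (.mul (.const _) (.var 0)) (.mul (.var 0) (.const _))) ?_ ?_ b
  · rw [mul_zero, zero_mul]
  · intro b h; rw [mul_succ, add_mul, one_mul, h]

theorem mul_add (a b c : M.Num) : a * (b + c) = a * b + a * c := by
  rw [mul_comm, add_mul, mul_comm b, mul_comm c]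

theorem mul_assoc (a b c : M.Num) : a * b * c = a * (b * c) := by
  refine bdd_induction (P := fun c => a * b * c = a * (b * c))
    (.eq (.mul (.const _) (.var 0)) (.mul (.const _) (.mul (.const _) (.var 0)))) ?_ ?_ c
  · simp only [mul_zero]
  · intro c h; rw [mul_succ, mul_succ, mul_add, h]

theorem lt_add_succ (a b : M.Num) : a < a + b + 1 := by
  refine bdd_induction (P := fun b => a < a + b + 1)
    (.lt (.const _) (.add (.add (.const _) (.var 0)) (.const _))) ?_ ?_ b
  · rw [add_zero, lt_succ]; exact .inr rfl
  · intro b h; rw [← add_assoc, lt_succ]; exact .inl h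

/-- The difference is an unbounded witness, so this uses `Σ⁰₁` induction on the larger number. -/
theorem exists_add_of_lt {a b : M.Num} (h : a < b) : ∃ c, b = a + c + 1 := by
  have := sigma_induction (P := fun c b => a < b → b = a + c + 1)
    (.imp (.lt (.const _) (.var 1)) (.eq (.var 1) (.add (.add (.const _) (.var 0)) (.const _))))
    ⟨0, fun h => (not_lt_zero _ h).elim⟩ ?_ b
  · exact this.imp fun c hc => hc h
  · rintro b ⟨c, hc⟩
    by_cases hb : a < b
    · exact ⟨c + 1, fun _ => by rw [← add_assoc, ← hc hb]⟩
    · refine ⟨0, fun h => ?_⟩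
      rw [(lt_succ.1 h).resolve_left hb, add_zero]

theorem lt_iff {a b : M.Num} : a < b ↔ ∃ c, b = a + c + 1 :=
  ⟨exists_add_of_lt, fun ⟨c, hc⟩ => hc ▸ lt_add_succ a c⟩

theorem lt_irrefl (a : M.Num) : ¬ a < a := fun h => by
  obtain ⟨c, hc⟩ := exists_add_of_lt h
  rw [add_assoc, add_comm] at hc
  exact succ_ne_zero c (add_right_cancel (hc.symm.trans (zero_add a).symm))

theorem lt_trans {a b c : M.Num} (h₁ : a < b) (h₂ : b < c) : a < c := by
  obtain ⟨d, rfl⟩ := exists_add_of_lt h₁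
  obtain ⟨e, rfl⟩ := exists_add_of_lt h₂
  rw [lt_iff]
  exact ⟨d + 1 + e, by simp only [add_assoc]⟩

theorem zero_lt_succ (a : M.Num) : 0 < a + 1 := lt_iff.2 ⟨a, by rw [zero_add]⟩

theorem succ_lt_succ {a b : M.Num} (h : a < b) : a + 1 < b + 1 := by
  obtain ⟨c, rfl⟩ := exists_add_of_lt h
  exact lt_iff.2 ⟨c, by rw [succ_add a c]⟩

theorem lt_trichotomy (a b : M.Num) : a < b ∨ a = b ∨ b < a := by
  refine bdd_induction (P := fun a => a < b ∨ a = b ∨ b < a)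
    (.or (.lt (.var 0) (.const _)) (.or (.eq (.var 0) (.const _)) (.lt (.const _) (.var 0)))) ?_ ?_ a
  · refine bdd_induction (P := fun b => 0 < b ∨ 0 = b ∨ b < 0)
      (.or (.lt (.const _) (.var 0)) (.or (.eq (.const _) (.var 0)) (.lt (.var 0) (.const _)))) ?_ ?_ b
    · exact .inr (.inl rfl)
    · exact fun b _ => .inl (zero_lt_succ b)
  · rintro a (h | rfl | h)
    · rcases exists_add_of_lt h with ⟨c, rfl⟩
      refine bdd_induction
        (P := fun c => a + 1 < a + c + 1 ∨ a + 1 = a + c + 1 ∨ a + c + 1 < a + 1)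
        (.or (.lt (.const _) (.add (.add (.const _) (.var 0)) (.const _)))
          (.or (.eq (.const _) (.add (.add (.const _) (.var 0)) (.const _)))
            (.lt (.add (.add (.const _) (.var 0)) (.const _)) (.const _)))) ?_ ?_ c
      · exact .inr (.inl (by rw [add_zero]))
      · intro c _
        refine .inl (succ_lt_succ ?_)
        rw [← add_assoc]
        exact lt_add_succ a c
    · exact .inr (.inr (lt_succ.2 (.inr rfl)))
    · exact .inr (.inr (lt_succ.2 (.inl h)))

end Arith

/-! ### The numbers of a model as an ordered semiring. -/

open Arith in
noncomputable instance : LinearOrder M.Num where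
  le a b := a < b ∨ a = b
  lt a b := a < b
  le_refl a := .inr rfl
  le_trans a b c h₁ h₂ := by
    rcases h₁ with h₁ | rfl
    · rcases h₂ with h₂ | rfl
      · exact .inl (lt_trans h₁ h₂)
      · exact .inl h₁
    · exact h₂
  le_antisymm a b h₁ h₂ := by
    rcases h₁ with h₁ | h₁
    · rcases h₂ with h₂ | h₂
      · exact (lt_irrefl a (lt_trans h₁ h₂)).elim
      · exact h₂.symm
    · exact h₁
  lt_iff_le_not_ge a b := by
    refine ⟨fun h => ⟨.inl h, ?_⟩, fun h => h.1.resolve_right fun e => h.2 (.inr e.symm)⟩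
    rintro (h' | rfl)
    · exact lt_irrefl a (lt_trans h h')
    · exact lt_irrefl b h
  le_total a b := by
    rcases lt_trichotomy a b with h | h | h
    · exact .inl (.inl h)
    · exact .inl (.inr h)
    · exact .inr (.inl h)
  toDecidableLE := Classical.decRel _

instance : CommSemiring M.Num where
  add_assoc := Arith.add_assoc
  zero_add := Arith.zero_add
  add_zero := Arith.add_zero
  nsmul := nsmulRec
  add_comm := Arith.add_comm
  left_distrib := Arith.mul_add
  right_distrib := Arith.add_mul
  zero_mul := Arith.zero_mul
  mul_zero := Arith.mul_zero
  mul_assoc := Arith.mul_assoc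
  one_mul := Arith.one_mul
  mul_one := Arith.mul_one
  mul_comm := Arith.mul_comm

theorem lt_add_one_iff' {a b : M.Num} : a < b + 1 ↔ a ≤ b := Arith.lt_succ

theorem num_exists_add_of_le {a b : M.Num} (h : a ≤ b) : ∃ c, b = a + c := by
  obtain ⟨c, hc⟩ := Arith.exists_add_of_lt (lt_add_one_iff'.2 h)
  exact ⟨c, Arith.succ_inj hc⟩

theorem num_le_add (a b : M.Num) : a ≤ a + b := lt_add_one_iff'.1 (Arith.lt_add_succ a b)

instance : IsOrderedCancelAddMonoid M.Num where
  add_le_add_left a b h c := by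
    obtain ⟨d, rfl⟩ := num_exists_add_of_le h
    rw [add_right_comm]
    exact num_le_add _ _
  le_of_add_le_add_left a b c h := by
    obtain ⟨d, hd⟩ := num_exists_add_of_le h
    rw [add_assoc, add_comm a, add_comm a] at hd
    rw [Arith.add_right_cancel hd]
    exact num_le_add _ _

instance : CanonicallyOrderedAdd M.Num where
  exists_add_of_le := num_exists_add_of_le
  le_add_self a b := by rw [add_comm]; exact num_le_add _ _
  le_self_add := num_le_add

instance : Nontrivial M.Num := ⟨⟨0, 1, fun h => Arith.succ_ne_zero (0 : M.Num) (by rw [zero_add, h])⟩⟩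

instance : IsStrictOrderedRing M.Num where
  zero_le_one := (num_le_add 0 1).trans_eq (zero_add 1)
  mul_lt_mul_of_pos_left a ha b c h := by
    obtain ⟨d, rfl⟩ := Arith.exists_add_of_lt h
    obtain ⟨e, rfl⟩ := Arith.exists_add_of_lt ha
    have : (0 + e + 1) * (b + d + 1) = (0 + e + 1) * b + (d + e * d + e) + 1 := by ring
    rw [this]
    exact Arith.lt_add_succ _ _
  mul_lt_mul_of_pos_right a ha b c h := by
    obtain ⟨d, rfl⟩ := Arith.exists_add_of_lt h
    obtain ⟨e, rfl⟩ := Arith.exists_add_of_lt ha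
    have : (b + d + 1) * (0 + e + 1) = b * (0 + e + 1) + (d + e * d + e) + 1 := by ring
    rw [this]
    exact Arith.lt_add_succ _ _

theorem num_add_one_le_iff {a b : M.Num} : a + 1 ≤ b ↔ a < b := by
  rw [← lt_add_one_iff', add_lt_add_iff_right]

noncomputable instance : SuccOrder M.Num := .ofSuccLeIff (fun a => a + 1) num_add_one_le_iff

noncomputable instance : SuccAddOrder M.Num := ⟨fun _ => rfl⟩

open Classical in
noncomputable instance : Sub M.Num :=
  ⟨fun a b => if h : b ≤ a then (num_exists_add_of_le h).choose else 0⟩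

instance : OrderedSub M.Num where
  tsub_le_iff_right a b c := by
    by_cases h : b ≤ a
    · have e : a = b + (a - b) := by
        have : a - b = (num_exists_add_of_le h).choose := dif_pos h
        rw [this]
        exact (num_exists_add_of_le h).choose_spec
      nth_rw 2 [e]
      rw [add_comm b, add_le_add_iff_right]
    · have : a - b = 0 := dif_neg h
      rw [this]
      exact iff_of_true zero_le ((le_of_not_ge h).trans (le_add_self))

end Model

end SecondOrderArith

namespace SecondOrderArith

namespace Model

set_option linter.unusedSectionVars false

variable {M : Model.{u}} [hM : IsRCA M]

/-! ### Bounded quantifiers, pairing and projections -/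

theorem Bdd.ball {t : (ℕ → M.Num) → M.Num} {R : M.Num → (ℕ → M.Num) → Prop} (ht : Poly t)
    (hR : Bdd fun v => R (v 0) fun i => v (i + 1)) : Bdd fun v => ∀ a, a < t v → R a v :=
  .ball_cons ht hR

theorem Bdd.bex {t : (ℕ → M.Num) → M.Num} {R : M.Num → (ℕ → M.Num) → Prop} (ht : Poly t)
    (hR : Bdd fun v => R (v 0) fun i => v (i + 1)) : Bdd fun v => ∃ a, a < t v ∧ R a v :=
  (Bdd.ball (R := fun a v => ¬ R a v) ht hR.not).not.of_iff fun v => by push Not; rfl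

/-- The pairing function `⟨a, b⟩ = (a + b)² + a`. -/
def pr (a b : M.Num) : M.Num := (a + b) * (a + b) + a

/-- With `n = a + b`, the code is at most `n² + n < (n + 1)²`, so a larger sum gives a larger code.
-/
theorem pr_inj_aux {a b c d : M.Num} (h : pr a b = pr c d) : ¬ a + b < c + d := by
  intro hlt
  obtain ⟨e, he⟩ := Arith.exists_add_of_lt hlt
  refine lt_irrefl (pr a b) ?_
  conv_rhs => rw [h]
  unfold pr
  rw [he]
  have : (a + b + e + 1) * (a + b + e + 1) + c =
      (a + b) * (a + b) + a + (a + 2 * b + 2 * e * (a + b) + (e + 1) * e + e + c) + 1 := by ring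
  rw [this]
  exact Arith.lt_add_succ _ _

theorem pr_inj {a b c d : M.Num} : pr a b = pr c d ↔ a = c ∧ b = d := by
  refine ⟨fun h => ?_, fun ⟨h₁, h₂⟩ => h₁ ▸ h₂ ▸ rfl⟩
  have hs : a + b = c + d := le_antisymm (not_lt.1 (pr_inj_aux h.symm)) (not_lt.1 (pr_inj_aux h))
  unfold pr at h
  rw [hs] at h
  obtain rfl := add_left_cancel h
  exact ⟨rfl, add_left_cancel hs⟩

theorem left_le_pr (a b : M.Num) : a ≤ pr a b := le_add_self

theorem num_pos_iff {a : M.Num} : 0 < a ↔ a ≠ 0 := pos_iff_ne_zero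

theorem one_le_of_ne_zero {a : M.Num} (h : a ≠ 0) : 1 ≤ a := by
  have := Order.add_one_le_iff.2 (num_pos_iff.2 h)
  rwa [zero_add] at this

theorem num_le_mul_self (a : M.Num) : a ≤ a * a := by
  by_cases h : a = 0
  · rw [h]; exact zero_le
  · exact le_mul_of_one_le_left zero_le (one_le_of_ne_zero h)

theorem right_le_pr (a b : M.Num) : b ≤ pr a b :=
  le_add_self.trans ((num_le_mul_self _).trans le_self_add)

theorem Poly.pr {s t : (ℕ → M.Num) → M.Num} (hs : Poly s) (ht : Poly t) :
    Poly fun v => pr (s v) (t v) :=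
  .add (.mul (.add hs ht) (.add hs ht)) hs

/-! ### `Σ⁰₁` predicates -/

/-- Predicates of the form `∃ y, Q y` with `Q` bounded, with parameters. -/
def Sigma1 (P : (ℕ → M.Num) → Prop) : Prop :=
  ∃ Q : (ℕ → M.Num) → Prop, Bdd Q ∧ ∀ v, P v ↔ ∃ y, Q (cons y v)

theorem Bdd.sigma1 {P : (ℕ → M.Num) → Prop} (h : Bdd P) : Sigma1 P :=
  ⟨_, h.lift, fun _ => ⟨fun h => ⟨0, h⟩, fun ⟨_, h⟩ => h⟩⟩

theorem Sigma1.of_iff {P Q : (ℕ → M.Num) → Prop} (hP : Sigma1 P) (h : ∀ v, Q v ↔ P v) : Sigma1 Q :=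
  (funext fun v => propext (h v) : Q = P) ▸ hP

/-- Two unbounded witnesses are replaced by one common bound, under which both quantifiers are
bounded. -/
theorem Sigma1.ex {R : M.Num → (ℕ → M.Num) → Prop}
    (h : Sigma1 fun v => R (v 0) fun i => v (i + 1)) : Sigma1 fun v => ∃ a, R a v := by
  obtain ⟨Q, hQ, h⟩ := h
  refine ⟨fun v => ∃ a, a < v 0 + 1 ∧ ∃ y, y < v 0 + 1 ∧ Q (cons y (cons a fun i => v (i + 1))),
    .bex (.add (.var 0) (.const 1)) (.bex (.add (.var 1) (.const 1))
      ((hQ.subst (σ := fun i => match i with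
        | 0 => fun v => v 0
        | 1 => fun v => v 1
        | i + 2 => fun v => v (i + 3))
        (fun i => match i with
        | 0 => .var 0
        | 1 => .var 1
        | i + 2 => .var (i + 3))).of_iff fun v => ?_)), fun v => ?_⟩
  · apply iff_of_eq; congr 1; funext i
    rcases i with _ | _ | i <;> rfl
  · constructor
    · rintro ⟨a, ha⟩
      obtain ⟨y, hy⟩ := (h (cons a v)).1 ha
      exact ⟨a + y, a, Order.lt_add_one_iff.2 le_self_add, y, Order.lt_add_one_iff.2 le_add_self, hy⟩
    · rintro ⟨_, a, _, y, _, hy⟩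
      exact ⟨a, (h (cons a v)).2 ⟨y, hy⟩⟩

theorem Sigma1.and {P Q : (ℕ → M.Num) → Prop} (hP : Sigma1 P) (hQ : Sigma1 Q) :
    Sigma1 fun v => P v ∧ Q v := by
  obtain ⟨P', hP', hP⟩ := hP
  obtain ⟨Q', hQ', hQ⟩ := hQ
  have : Sigma1 fun v => ∃ a, ∃ b, P' (cons a v) ∧ Q' (cons b v) := by
    refine .ex (.ex (Bdd.sigma1 (.and ?_ ?_)))
    · refine (hP'.subst (σ := cons (fun v => v 1) fun i v => v (i + 2))
        (fun i => match i with | 0 => .var 1 | i + 1 => .var (i + 2))).of_iff fun v => ?_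
      apply iff_of_eq; congr 1; funext i; cases i <;> rfl
    · refine (hQ'.subst (σ := cons (fun v => v 0) fun i v => v (i + 2))
        (fun i => match i with | 0 => .var 0 | i + 1 => .var (i + 2))).of_iff fun v => ?_
      apply iff_of_eq; congr 1; funext i; cases i <;> rfl
  refine this.of_iff fun v => ?_
  rw [hP, hQ]
  exact ⟨fun ⟨⟨a, ha⟩, b, hb⟩ => ⟨a, b, ha, hb⟩, fun ⟨a, b, ha, hb⟩ => ⟨⟨a, ha⟩, b, hb⟩⟩

theorem Sigma1.or {P Q : (ℕ → M.Num) → Prop} (hP : Sigma1 P) (hQ : Sigma1 Q) :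
    Sigma1 fun v => P v ∨ Q v := by
  obtain ⟨P', hP', hP⟩ := hP
  obtain ⟨Q', hQ', hQ⟩ := hQ
  exact ⟨_, hP'.or hQ', fun v => by beta_reduce; rw [hP, hQ, exists_or]⟩

theorem Sigma1.subst {P : (ℕ → M.Num) → Prop} (hP : Sigma1 P) {σ : ℕ → (ℕ → M.Num) → M.Num}
    (hσ : ∀ i, Poly (σ i)) : Sigma1 fun v => P fun i => σ i v := by
  obtain ⟨P', hP', hP⟩ := hP
  refine ⟨_, hP'.subst (σ := cons (fun v => v 0) fun i v => σ i fun j => v (j + 1))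
    (fun i => match i with | 0 => .var 0 | i + 1 => (hσ i).lift), fun v => ?_⟩
  beta_reduce
  rw [hP]
  refine exists_congr fun y => ?_
  apply iff_of_eq; congr 1; funext i; cases i <;> rfl

theorem sigma1_induction {P : M.Num → Prop} (hP : Sigma1 fun v => P (v 0))
    (h₀ : P 0) (h₁ : ∀ x, P x → P (x + 1)) : ∀ x, P x := by
  obtain ⟨Q, hQ, h⟩ := hP
  have h' : ∀ x, P x ↔ ∃ y, Q (cons y fun _ => x) := fun x => h fun _ => x
  have := sigma_induction (P := fun y x => Q (cons y fun _ => x))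
    ((hQ.subst (σ := cons (fun v => v 0) fun _ v => v 1)
      (fun i => match i with | 0 => .var 0 | i + 1 => .var 1)).of_iff fun v => by
        apply iff_of_eq; congr 1; funext i; cases i <;> rfl)
    ((h' 0).1 h₀) (fun x hx => (h' _).1 (h₁ x ((h' x).2 hx)))
  exact fun x => (h' x).2 (this x)

/-! ### `Δ⁰₁` predicates are definable -/

theorem mem_sets_of_delta {P : M.Num → Prop} (h₁ : Sigma1 fun v => P (v 0))
    (h₂ : Sigma1 fun v => ¬ P (v 0)) : {x | P x} ∈ M.Sets := by
  obtain ⟨Q₁, hQ₁, h₁⟩ := h₁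
  obtain ⟨Q₂, hQ₂, h₂⟩ := h₂
  have e : ∀ {Q : (ℕ → M.Num) → Prop}, Bdd Q → Bdd fun v => Q (cons (v 0) fun _ => v 1) :=
    fun hQ => (hQ.subst (σ := cons (fun v => v 0) fun _ v => v 1)
      (fun i => match i with | 0 => .var 0 | i + 1 => .var 1)).of_iff fun v => by
        apply iff_of_eq; congr 1; funext i; cases i <;> rfl
  have := delta_comprehension (P := fun y x => Q₁ (cons y fun _ => x))
    (Q := fun y x => ¬ Q₂ (cons y fun _ => x)) (e hQ₁) (e hQ₂).not fun x => by
      rw [← h₁ fun _ => x, ← not_exists, ← h₂ fun _ => x, not_not]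
  convert this using 2
  funext x
  exact propext (h₁ fun _ => x)

/-- Pairing merges the first two entries until only one matters; the predicate is then membership in
a set of the model, which is atomic. The class `Γ` is left open because this is applied to `Δ⁰₁`
predicates and, once their sets exist, to all `Σ⁰₁` predicates. -/
theorem bdd_of_support {Γ : ((ℕ → M.Num) → Prop) → Prop}
    (hmem : ∀ P, Γ P → {x | P fun _ => x} ∈ M.Sets)
    (hpr : ∀ P, Γ P → Γ fun v => ∃ a, ∃ b, v 0 = pr a b ∧ P (cons a (cons b fun i => v (i + 1))))
    (n : ℕ) : ∀ {P : (ℕ → M.Num) → Prop}, Γ P →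
    (∀ v v' : ℕ → M.Num, (∀ i < n + 1, v i = v' i) → (P v ↔ P v')) → Bdd P := by
  induction n with
  | zero =>
    intro P h hs
    exact (Bdd.mem (.var 0) (hmem P h)).of_iff fun v => hs _ _ fun i hi => by
      rw [show i = 0 by omega]
  | succ n ih =>
    intro P h hs
    have := ih (hpr P h) fun v v' h => ?_
    · refine (this.subst (σ := cons (fun v => pr (v 0) (v 1)) fun i v => v (i + 2))
        (fun i => match i with | 0 => .pr (.var 0) (.var 1) | i + 1 => .var (i + 2))).of_iff
          fun v => ⟨fun h => ⟨v 0, v 1, rfl, ?_⟩, ?_⟩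
      · convert h using 1; funext i; rcases i with _ | _ | i <;> rfl
      · rintro ⟨a, b, hab, h⟩
        obtain ⟨rfl, rfl⟩ := pr_inj.1 hab
        convert h using 1; funext i; rcases i with _ | _ | i <;> rfl
    · refine exists_congr fun a => exists_congr fun b => and_congr ?_ (hs _ _ ?_)
      · rw [h 0 (by omega)]
      · intro i hi
        rcases i with _ | _ | i
        · rfl
        · rfl
        · exact h (i + 1) (by omega)

theorem Sigma1.unpair {P : (ℕ → M.Num) → Prop} (h : Sigma1 P) :
    Sigma1 fun v => ∃ a, ∃ b, v 0 = pr a b ∧ P (cons a (cons b fun i => v (i + 1))) := by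
  refine .ex (.ex (.and (Bdd.eq (.var 2) (.pr (.var 1) (.var 0))).sigma1
    ((h.subst (σ := cons (fun v => v 1) (cons (fun v => v 0) fun i v => v (i + 3)))
      (fun i => match i with | 0 => .var 1 | 1 => .var 0 | i + 2 => .var (i + 3))).of_iff
        fun v => ?_)))
  apply iff_of_eq; congr 1; funext i; rcases i with _ | _ | i <;> rfl

theorem Sigma1.exists_support {P : (ℕ → M.Num) → Prop} (h : Sigma1 P) :
    ∃ n : ℕ, ∀ v v' : ℕ → M.Num, (∀ i < n + 1, v i = v' i) → (P v ↔ P v') := by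
  obtain ⟨Q, hQ, h⟩ := h
  obtain ⟨n, hn⟩ := hQ.exists_support
  refine ⟨n, fun v v' hv => ?_⟩
  rw [h, h]
  refine exists_congr fun y => hn _ _ fun i hi => ?_
  cases i with
  | zero => rfl
  | succ i => exact hv i (by omega)

theorem bdd_of_delta {P : (ℕ → M.Num) → Prop} (h₁ : Sigma1 P) (h₂ : Sigma1 fun v => ¬ P v) :
    Bdd P := by
  obtain ⟨n, hn⟩ := h₁.exists_support
  refine bdd_of_support (Γ := fun P => Sigma1 P ∧ Sigma1 fun v => ¬ P v)
    (fun P h => mem_sets_of_delta (P := fun x => P fun _ => x) (h.1.subst fun _ => .var 0)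
      (h.2.subst fun _ => .var 0)) (fun P h => ⟨h.1.unpair, ?_⟩) n ⟨h₁, h₂⟩ hn
  -- The negation of an unpaired predicate holds if the first entry is not a pair, a bounded
  -- condition, or if its components violate the predicate.
  have hb : Bdd fun v : ℕ → M.Num => ¬ ∃ a, a < v 0 + 1 ∧ ∃ b, b < v 0 + 1 ∧ v 0 = pr a b :=
    .not (.bex (.add (.var 0) (.const 1)) (.bex (.add (.var 1) (.const 1))
      (.eq (.var 2) (.pr (.var 1) (.var 0)))))
  refine (hb.sigma1.or h.2.unpair).of_iff fun v => ?_
  constructor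
  · intro h
    by_cases hp : ∃ a, a < v 0 + 1 ∧ ∃ b, b < v 0 + 1 ∧ v 0 = pr a b
    · obtain ⟨a, _, b, _, hab⟩ := hp
      exact .inr ⟨a, b, hab, fun hP => h ⟨a, b, hab, hP⟩⟩
    · exact .inl hp
  · rintro (h | ⟨a, b, hab, h⟩) ⟨a', b', hab', h'⟩
    · refine h ⟨a', Order.lt_add_one_iff.2 ?_, b', Order.lt_add_one_iff.2 ?_, hab'⟩
      · rw [hab']; exact left_le_pr _ _
      · rw [hab']; exact right_le_pr _ _
    · obtain ⟨rfl, rfl⟩ := pr_inj.1 (hab.symm.trans hab')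
      exact h h'

/-! ### Definable functions -/

/-- Functions with a definable graph. -/
def RecFun (f : (ℕ → M.Num) → M.Num) : Prop := Bdd fun v => v 0 = f fun i => v (i + 1)

theorem Poly.recFun {f : (ℕ → M.Num) → M.Num} (h : Poly f) : RecFun f := .eq (.var 0) h.lift

theorem RecFun.subst {f : (ℕ → M.Num) → M.Num} (h : RecFun f) {σ : ℕ → (ℕ → M.Num) → M.Num}
    (hσ : ∀ i, Poly (σ i)) : RecFun fun v => f fun i => σ i v :=
  Bdd.subst (P := fun v => v 0 = f fun i => v (i + 1)) h
    (σ := fun i => match i with | 0 => fun v => v 0 | i + 1 => fun v => σ i fun j => v (j + 1))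
    (fun i => match i with | 0 => .var 0 | i + 1 => (hσ i).lift)

theorem RecFun.lift {f : (ℕ → M.Num) → M.Num} (h : RecFun f) :
    RecFun fun v => f fun i => v (i + 1) :=
  h.subst fun i => .var (i + 1)

/-- For a total function, `y ≠ f v` says that some `a` is the value and differs from `y`; so the
complement of the graph is `Σ⁰₁` as well. -/
theorem RecFun.of_sigma1 {f : (ℕ → M.Num) → M.Num}
    (h : Sigma1 fun v => v 0 = f fun i => v (i + 1)) : RecFun f := by
  refine bdd_of_delta h ?_
  have : Sigma1 fun v : ℕ → M.Num => ∃ a, a = f (fun i => v (i + 1)) ∧ v 0 ≠ a := by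
    refine .ex (.and ?_ (Bdd.eq (.var 1) (.var 0)).not.sigma1)
    exact h.subst (σ := fun i => match i with | 0 => fun v => v 0 | i + 1 => fun v => v (i + 2))
      (fun i => match i with | 0 => .var 0 | i + 1 => .var (i + 2))
  exact this.of_iff fun v => by simp

/-- Both the predicate and its negation can be stated by guessing the value of `f`, so the composite
is `Δ⁰₁`. -/
theorem Bdd.app {R : M.Num → (ℕ → M.Num) → Prop} {f : (ℕ → M.Num) → M.Num}
    (hR : Bdd fun v => R (v 0) fun i => v (i + 1)) (hf : RecFun f) : Bdd fun v => R (f v) v := by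
  refine bdd_of_delta ((Sigma1.ex (R := fun a v => a = f v ∧ R a v) (.and ?_ hR.sigma1)).of_iff
    fun v => by simp) ((Sigma1.ex (R := fun a v => a = f v ∧ ¬ R a v) (.and ?_ hR.not.sigma1)).of_iff
    fun v => by simp)
  · exact Bdd.sigma1 hf
  · exact Bdd.sigma1 hf

/-- Definable functions replace the first `n` entries one at a time; polynomial substitution takes
care of the rest. -/
theorem Bdd.rsubst_aux (n : ℕ) : ∀ {P : (ℕ → M.Num) → Prop}, Bdd P →
    ∀ {σ τ : ℕ → (ℕ → M.Num) → M.Num}, (∀ i, RecFun (σ i)) → (∀ i, Poly (τ i)) →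
    Bdd fun v => P fun i => if i < n then σ i v else τ i v := by
  induction n with
  | zero => intro P hP σ τ _ hτ; simpa using hP.subst hτ
  | succ n ih =>
    intro P hP σ τ hσ hτ
    refine (Bdd.app (R := fun a v => P fun i =>
      if i < n then σ i v else if i = n then a else τ i v) ?_ (hσ n)).of_iff fun v => ?_
    · refine (ih hP (σ := fun i v => σ i fun j => v (j + 1))
        (τ := fun i v => if i = n then v 0 else τ i fun j => v (j + 1))
        (fun i => (hσ i).lift) (fun i => ?_)).of_iff fun v => Iff.rfl
      by_cases h : i = n
      · simpa [h] using Poly.var 0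
      · simpa [h] using (hτ i).lift
    · apply iff_of_eq; congr 1; funext i
      rcases lt_trichotomy i n with h | rfl | h
      · simp [h, h.trans (Nat.lt_succ_self n)]
      · simp
      · rw [if_neg (by omega), if_neg (by omega), if_neg (by omega)]

theorem Bdd.rsubst {P : (ℕ → M.Num) → Prop} (hP : Bdd P) {σ : ℕ → (ℕ → M.Num) → M.Num}
    (hσ : ∀ i, RecFun (σ i)) : Bdd fun v => P fun i => σ i v := by
  obtain ⟨n, hn⟩ := hP.exists_support
  refine (Bdd.rsubst_aux n hP hσ (τ := fun _ _ => 0) fun _ => .const 0).of_iff fun v =>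
    hn _ _ fun i hi => by simp [hi]

theorem RecFun.rsubst {f : (ℕ → M.Num) → M.Num} (h : RecFun f) {σ : ℕ → (ℕ → M.Num) → M.Num}
    (hσ : ∀ i, RecFun (σ i)) : RecFun fun v => f fun i => σ i v :=
  Bdd.rsubst (P := fun v => v 0 = f fun i => v (i + 1)) h
    (σ := fun i => match i with | 0 => fun v => v 0 | i + 1 => fun v => σ i fun j => v (j + 1))
    (fun i => match i with | 0 => (Poly.var 0).recFun | i + 1 => (hσ i).lift)

/-- An environment of functions from a list, followed by a constant tail. -/
def env {α : Type*} (d : α) : List α → ℕ → α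
  | [] => fun _ => d
  | a :: l => cons a (env d l)

theorem env_cases {α : Type*} {p : α → Prop} {d : α} (hd : p d) :
    ∀ {l : List α}, (∀ a ∈ l, p a) → ∀ i, p (env d l i)
  | [], _, _ => hd
  | a :: _, h, 0 => h a List.mem_cons_self
  | _ :: _, h, i + 1 => env_cases hd (fun b hb => h b (List.mem_cons_of_mem _ hb)) i

theorem RecFun.var (i : ℕ) : RecFun fun v : ℕ → M.Num => v i := (Poly.var i).recFun

theorem RecFun.const (a : M.Num) : RecFun fun _ => a := (Poly.const a).recFun

theorem Bdd.comp₁ {P : M.Num → Prop} (hP : Bdd fun v => P (v 0)) {f : (ℕ → M.Num) → M.Num}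
    (hf : RecFun f) : Bdd fun v => P (f v) :=
  hP.rsubst (σ := env (fun _ => 0) [f]) (env_cases (.const 0) (by simpa using hf))

theorem Bdd.comp₂ {P : M.Num → M.Num → Prop} (hP : Bdd fun v => P (v 0) (v 1))
    {f g : (ℕ → M.Num) → M.Num} (hf : RecFun f) (hg : RecFun g) : Bdd fun v => P (f v) (g v) :=
  hP.rsubst (σ := env (fun _ => 0) [f, g]) (env_cases (.const 0) (by simpa using ⟨hf, hg⟩))

theorem RecFun.comp₁ {g : M.Num → M.Num} (hg : RecFun fun v => g (v 0))
    {f : (ℕ → M.Num) → M.Num} (hf : RecFun f) : RecFun fun v => g (f v) :=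
  hg.rsubst (σ := env (fun _ => 0) [f]) (env_cases (.const 0) (by simpa using hf))

theorem RecFun.comp₂ {k : M.Num → M.Num → M.Num} (hk : RecFun fun v => k (v 0) (v 1))
    {f g : (ℕ → M.Num) → M.Num} (hf : RecFun f) (hg : RecFun g) : RecFun fun v => k (f v) (g v) :=
  hk.rsubst (σ := env (fun _ => 0) [f, g]) (env_cases (.const 0) (by simpa using ⟨hf, hg⟩))

theorem RecFun.comp₃ {k : M.Num → M.Num → M.Num → M.Num}
    (hk : RecFun fun v => k (v 0) (v 1) (v 2)) {f g h : (ℕ → M.Num) → M.Num} (hf : RecFun f)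
    (hg : RecFun g) (hh : RecFun h) : RecFun fun v => k (f v) (g v) (h v) :=
  hk.rsubst (σ := env (fun _ => 0) [f, g, h]) (env_cases (.const 0) (by simpa using ⟨hf, hg, hh⟩))

theorem RecFun.add {f g : (ℕ → M.Num) → M.Num} (hf : RecFun f) (hg : RecFun g) :
    RecFun fun v => f v + g v :=
  .comp₂ (k := fun a b => a + b) (Poly.add (.var 0) (.var 1)).recFun hf hg

theorem RecFun.mul {f g : (ℕ → M.Num) → M.Num} (hf : RecFun f) (hg : RecFun g) :
    RecFun fun v => f v * g v :=
  .comp₂ (k := fun a b => a * b) (Poly.mul (.var 0) (.var 1)).recFun hf hg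

theorem RecFun.pr {f g : (ℕ → M.Num) → M.Num} (hf : RecFun f) (hg : RecFun g) :
    RecFun fun v => pr (f v) (g v) :=
  .add (.mul (.add hf hg) (.add hf hg)) hf

theorem Bdd.eq' {f g : (ℕ → M.Num) → M.Num} (hf : RecFun f) (hg : RecFun g) :
    Bdd fun v => f v = g v :=
  .comp₂ (P := fun a b => a = b) (.eq (.var 0) (.var 1)) hf hg

theorem Bdd.lt' {f g : (ℕ → M.Num) → M.Num} (hf : RecFun f) (hg : RecFun g) :
    Bdd fun v => f v < g v :=
  .comp₂ (P := fun a b => a < b) (.lt (.var 0) (.var 1)) hf hg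

theorem Bdd.le' {f g : (ℕ → M.Num) → M.Num} (hf : RecFun f) (hg : RecFun g) :
    Bdd fun v => f v ≤ g v :=
  (Bdd.lt' hg hf).not.of_iff fun _ => not_lt.symm

theorem Bdd.mem' {f : (ℕ → M.Num) → M.Num} {A : Set M.Num} (hf : RecFun f) (hA : A ∈ M.Sets) :
    Bdd fun v => f v ∈ A :=
  .comp₁ (P := fun a => a ∈ A) (.mem (.var 0) hA) hf

theorem Bdd.ball' {f : (ℕ → M.Num) → M.Num} {R : M.Num → (ℕ → M.Num) → Prop} (hf : RecFun f)
    (hR : Bdd fun v => R (v 0) fun i => v (i + 1)) : Bdd fun v => ∀ a, a < f v → R a v :=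
  Bdd.app (R := fun b v => ∀ a, a < b → R a v) (.ball (.var 0) (hR.subst
    (σ := fun i => match i with | 0 => fun v => v 0 | i + 1 => fun v => v (i + 2))
    (fun i => match i with | 0 => .var 0 | i + 1 => .var (i + 2)))) hf

theorem Bdd.bex' {f : (ℕ → M.Num) → M.Num} {R : M.Num → (ℕ → M.Num) → Prop} (hf : RecFun f)
    (hR : Bdd fun v => R (v 0) fun i => v (i + 1)) : Bdd fun v => ∃ a, a < f v ∧ R a v :=
  (Bdd.ball' (R := fun a v => ¬ R a v) hf hR.not).not.of_iff fun v => by push Not; rfl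

theorem RecFun.sub {f g : (ℕ → M.Num) → M.Num} (hf : RecFun f) (hg : RecFun g) :
    RecFun fun v => f v - g v := by
  refine .comp₂ (k := fun a b => a - b) ?_ hf hg
  refine (Bdd.or (.and (.le' (.var 2) (.var 1)) (.eq' (.add (.var 0) (.var 2)) (.var 1)))
    (.and (.lt' (.var 1) (.var 2)) (.eq' (.var 0) (.const 0)))).of_iff fun v => ?_
  show v 0 = v 1 - v 2 ↔ _
  rcases le_or_gt (v 2) (v 1) with h | h
  · rw [eq_tsub_iff_add_eq_of_le h]; simp [h, h.not_gt]
  · rw [tsub_eq_zero_of_le h.le]; simp [h, h.not_ge]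

theorem RecFun.ite {P : (ℕ → M.Num) → Prop} [DecidablePred P] {f g : (ℕ → M.Num) → M.Num}
    (hP : Bdd P)
    (hf : RecFun f) (hg : RecFun g) : RecFun fun v => if P v then f v else g v := by
  refine ((hP.lift.and hf).or (hP.lift.not.and hg)).of_iff fun v => ?_
  by_cases h : P fun i => v (i + 1) <;> simp [h]

theorem mem_sets {P : M.Num → Prop} (h : Bdd fun v => P (v 0)) : {x | P x} ∈ M.Sets :=
  mem_sets_of_delta h.sigma1 h.not.sigma1

theorem exists_least {P : M.Num → Prop} (hP : Bdd fun v => P (v 0)) (h : ∃ x, P x) :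
    ∃ x, P x ∧ ∀ y, y < x → ¬ P y := by
  by_contra! hc
  have : ∀ x, ∀ y, y < x → ¬ P y := by
    refine bdd_induction (P := fun x => ∀ y, y < x → ¬ P y)
      (.ball (.var 0) (hP.comp₁ (.var 0)).not) (fun y hy => (not_lt_zero hy).elim) ?_
    intro x ih y hy hPy
    rcases (Order.lt_add_one_iff.1 hy).lt_or_eq with h | rfl
    · exact ih y h hPy
    · obtain ⟨z, hz, hPz⟩ := hc y hPy
      exact ih z hz hPz
  obtain ⟨x, hx⟩ := h
  exact this (x + 1) x (Order.lt_add_one_iff.2 le_rfl) hx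

theorem strong_induction {P : M.Num → Prop} (hP : Bdd fun v => P (v 0))
    (h : ∀ x, (∀ y, y < x → P y) → P x) : ∀ x, P x := by
  by_contra! hc
  obtain ⟨x, hx, hy⟩ := exists_least hP.not hc
  exact hx (h x fun y hyx => not_not.1 (hy y hyx))

/-- A function that is bounded-definable as the least solution of a definable condition. -/
theorem RecFun.of_least {R : M.Num → (ℕ → M.Num) → Prop} {f : (ℕ → M.Num) → M.Num}
    (hR : Bdd fun v => R (v 0) fun i => v (i + 1)) (h₁ : ∀ v, R (f v) v)
    (h₂ : ∀ v y, y < f v → ¬ R y v) : RecFun f := by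
  refine (hR.and (Bdd.ball (R := fun a v => ¬ R a fun i => v (i + 1)) (.var 0)
    (hR.subst (σ := fun i => match i with | 0 => fun v => v 0 | i + 1 => fun v => v (i + 2))
    (fun i => match i with | 0 => .var 0 | i + 1 => .var (i + 2))).not)).of_iff fun v => ?_
  constructor
  · intro h
    rw [h]
    exact ⟨h₁ _, h₂ _⟩
  · rintro ⟨h, h'⟩
    exact le_antisymm (not_lt.1 fun hl => h' _ hl (h₁ _)) (not_lt.1 fun hl => h₂ _ _ hl h)

end Model

end SecondOrderArith

namespace SecondOrderArith

namespace Model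

set_option linter.unusedSectionVars false

variable {M : Model.{u}} [hM : IsRCA M]

/-! ### Codes of finite sets -/

theorem num_dvd_iff {a b : M.Num} : a ∣ b ↔ ∃ k, k < b + 1 ∧ b = a * k := by
  refine ⟨fun ⟨k, hk⟩ => ?_, fun ⟨k, _, hk⟩ => ⟨k, hk⟩⟩
  by_cases ha : a = 0
  · exact ⟨0, Order.lt_add_one_iff.2 zero_le, by rw [hk, ha, zero_mul, mul_zero]⟩
  · refine ⟨k, Order.lt_add_one_iff.2 ?_, hk⟩
    rw [hk]
    exact le_mul_of_one_le_left zero_le (one_le_of_ne_zero ha)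

theorem Bdd.dvd {f g : (ℕ → M.Num) → M.Num} (hf : RecFun f) (hg : RecFun g) :
    Bdd fun v => f v ∣ g v := by
  refine .comp₂ (P := fun a b => a ∣ b) ?_ hf hg
  exact (Bdd.bex (.add (.var 1) (.const 1)) (.eq (.var 2) (.mul (.var 1) (.var 0)))).of_iff
    fun v => num_dvd_iff

theorem num_dvd_of_dvd_add {d a b : M.Num} (h : d ∣ a + b) (ha : d ∣ a) : d ∣ b := by
  obtain ⟨c, rfl⟩ := ha
  obtain ⟨e, he⟩ := h
  rcases le_total c e with hce | hce
  · obtain ⟨k, rfl⟩ := num_exists_add_of_le hce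
    rw [mul_add] at he
    exact ⟨k, add_left_cancel he⟩
  · obtain ⟨k, rfl⟩ := num_exists_add_of_le hce
    have : d * e + (d * k + b) = d * e + 0 := by
      rw [add_zero]
      exact (by ring : _ = d * (e + k) + b).trans he
    have := add_left_cancel this
    rw [add_eq_zero] at this
    rw [this.2]
    exact dvd_zero d

/-- The moduli used to code finite sets. -/
def modulus (u x : M.Num) : M.Num := 1 + (x + 1) * u

/-- A substitute for coprimality of the moduli. Eliminating `u` from moduli `i` and `j` shows that
modulus `i` divides `m` times the distance of `i` and `j`. That distance divides `u`, so modulus `i`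
divides `m * u * (i + 1)`, which differs from a multiple of the modulus by `m`. -/
theorem modulus_dvd_of_dvd_mul {u i j m : M.Num} (hij : i ≠ j)
    (hu : ∀ k l, i = j + (k + 1) ∨ j = i + (k + 1) → l = k + 1 → l ∣ u)
    (h : modulus u i ∣ m * modulus u j) : modulus u i ∣ m := by
  have key : ∀ k, k + 1 ∣ u → modulus u i ∣ m * (k + 1) → modulus u i ∣ m := by
    rintro k ⟨c, hc⟩ hk
    refine num_dvd_of_dvd_add (a := m * u * (i + 1)) ⟨m, by unfold modulus; ring⟩ ?_
    rw [show m * u * (i + 1) = m * (k + 1) * (c * (i + 1)) by rw [hc]; ring]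
    exact hk.mul_right _
  rcases lt_or_gt_of_ne hij with hlt | hlt
  · obtain ⟨k, rfl⟩ := Arith.exists_add_of_lt hlt
    refine key k (hu k _ (.inr (add_assoc _ _ _)) rfl) ?_
    refine num_dvd_of_dvd_add (a := m * modulus u (i + k + 1) * (i + 1)) ?_ (h.mul_right _)
    exact ⟨m * (i + k + 1 + 1), by unfold modulus; ring⟩
  · obtain ⟨k, rfl⟩ := Arith.exists_add_of_lt hlt
    refine key k (hu k _ (.inl (add_assoc _ _ _)) rfl) ?_
    refine num_dvd_of_dvd_add (a := m * modulus u (j + k + 1) * (j + 1)) ?_ ⟨m * (j + 1), by ring⟩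
    have : m * modulus u (j + k + 1) * (j + 1) + m * (k + 1) =
        m * modulus u j * (j + k + 1 + 1) := by unfold modulus; ring
    rw [this]
    exact h.mul_right _

/-- The witness plays the role of a factorial, before recursion is available. -/
theorem exists_common_multiple (a : M.Num) : ∃ u : M.Num, u ≠ 0 ∧ ∀ i, i < a → i + 1 ∣ u := by
  refine sigma_induction (P := fun u a => u ≠ 0 ∧ ∀ i, i < a → i + 1 ∣ u)
    (.and (.not (.eq (.var 0) (.const 0)))
      (.ball (.var 1) (.dvd (.add (.var 0) (.const 1)) (.var 1)))) ?_ ?_ a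
  · exact ⟨1, one_ne_zero, fun i hi => (not_lt_zero hi).elim⟩
  · rintro a ⟨u, hu, h⟩
    refine ⟨u * (a + 1), mul_ne_zero hu (Arith.succ_ne_zero a), fun i hi => ?_⟩
    rcases (Order.lt_add_one_iff.1 hi).lt_or_eq with hlt | rfl
    · exact (h i hlt).mul_right _
    · exact ⟨u, mul_comm _ _⟩

/-- `x` belongs to the finite set with code `(a, u, m)`. -/
def InCode (a u m x : M.Num) : Prop := x < a ∧ modulus u x ∣ m

theorem RecFun.modulus {f g : (ℕ → M.Num) → M.Num} (hf : RecFun f) (hg : RecFun g) :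
    RecFun fun v => modulus (f v) (g v) :=
  .add (.const 1) (.mul (.add hg (.const 1)) hf)

theorem Bdd.inCode {f g h k : (ℕ → M.Num) → M.Num} (hf : RecFun f) (hg : RecFun g)
    (hh : RecFun h) (hk : RecFun k) : Bdd fun v => InCode (f v) (g v) (h v) (k v) :=
  .and (.lt' hk hf) (.dvd (.modulus hg hk) hh)

/-- The code `m` is the product of the moduli of the elements, built by `Σ⁰₁` induction on the
elements treated so far. -/
theorem exists_code {A : M.Num → Prop} (hA : Bdd fun v => A (v 0)) (a : M.Num) :
    ∃ u m, ∀ x, InCode a u m x ↔ x < a ∧ A x := by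
  obtain ⟨u, hu₀, hu⟩ := exists_common_multiple a
  have : ∀ j, ∃ m, ∀ i, i < a → (modulus u i ∣ m ↔ i < j ∧ A i) := by
    refine sigma_induction (P := fun m j => ∀ i, i < a → (modulus u i ∣ m ↔ i < j ∧ A i))
      (.ball (.const a) (.iff (.dvd (.modulus (.const u) (.var 0)) (.var 1))
        (.and (.lt (.var 0) (.var 2)) (hA.comp₁ (.var 0))))) ?_ ?_
    -- The empty product works because `u ≠ 0` makes every modulus exceed `1`.
    · refine ⟨1, fun i _ => iff_of_false ?_ fun h => not_lt_zero h.1⟩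
      rintro ⟨c, hc⟩
      have hc0 : c ≠ 0 := by rintro rfl; simp at hc
      have : (1 : M.Num) < modulus u i * c := by
        refine lt_of_lt_of_le ?_ (le_mul_of_one_le_right zero_le (one_le_of_ne_zero hc0))
        unfold modulus
        exact lt_add_of_pos_right _ (num_pos_iff.2 (mul_ne_zero (Arith.succ_ne_zero i) hu₀))
      exact this.ne hc
    · rintro j ⟨m, hm⟩
      by_cases hj : j < a ∧ A j
      · refine ⟨m * modulus u j, fun i hi => ?_⟩
        by_cases hij : i = j
        · subst hij
          exact iff_of_true (dvd_mul_left _ _) ⟨Order.lt_add_one_iff.2 le_rfl, hj.2⟩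
        · have : modulus u i ∣ m * modulus u j ↔ modulus u i ∣ m := by
            refine ⟨modulus_dvd_of_dvd_mul hij ?_, fun h => h.mul_right _⟩
            rintro k l hk rfl
            refine hu k ?_
            rcases hk with rfl | rfl
            · exact lt_of_lt_of_le (Order.lt_add_one_iff.2 le_add_self)
                ((add_assoc j k 1).le.trans hi.le)
            · exact lt_of_lt_of_le (Order.lt_add_one_iff.2 le_add_self)
                ((add_assoc i k 1).le.trans hj.1.le)
          rw [this, hm i hi, Order.lt_add_one_iff, le_iff_lt_or_eq]
          simp [hij]
      · refine ⟨m, fun i hi => ?_⟩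
        rw [hm i hi, Order.lt_add_one_iff, le_iff_lt_or_eq]
        constructor
        · exact fun h => ⟨.inl h.1, h.2⟩
        · rintro ⟨h | rfl, h'⟩
          · exact ⟨h, h'⟩
          · exact (hj ⟨hi, h'⟩).elim
  obtain ⟨m, hm⟩ := this a
  refine ⟨u, m, fun x => ⟨fun h => ⟨h.1, ((hm x h.1).1 h.2).2⟩, fun h => ⟨h.1, (hm x h.1).2 h⟩⟩⟩

/-! ### Primitive recursion -/

/-- `(a, u, m)` codes a computation, by the recursion `f₀`, `f` with parameter `s`, that assigns the
value `y` to the argument `n`. -/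
def Computation (f₀ : M.Num → M.Num) (f : M.Num → M.Num → M.Num → M.Num)
    (a u m s n y : M.Num) : Prop :=
  InCode a u m (pr n y) ∧ ∀ i, i < a → ∀ z, z < a → InCode a u m (pr i z) →
    (i = 0 ∧ z = f₀ s) ∨ ∃ j, j < a ∧ ∃ w, w < a ∧
      i = j + 1 ∧ z = f s j w ∧ InCode a u m (pr j w)

theorem InCode.lt_of_pr {a u m i z : M.Num} (h : InCode a u m (pr i z)) : i < a ∧ z < a :=
  ⟨(left_le_pr i z).trans_lt h.1, (right_le_pr i z).trans_lt h.1⟩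

/-- Induction on the argument; the values range below the bounds of the two codes, which keeps the
induction hypothesis bounded. -/
theorem computation_unique {f₀ : M.Num → M.Num} {f : M.Num → M.Num → M.Num → M.Num}
    {a u m a' u' m' s n y y' : M.Num} (h : Computation f₀ f a u m s n y)
    (h' : Computation f₀ f a' u' m' s n y') : y = y' := by
  have : ∀ i, ∀ z, z < a → ∀ z', z' < a' → InCode a u m (pr i z) → InCode a' u' m' (pr i z') →
      z = z' := by
    refine bdd_induction (P := fun i => ∀ z, z < a → ∀ z', z' < a' → InCode a u m (pr i z) →
      InCode a' u' m' (pr i z') → z = z') (.ball (.const a) (.ball (.const a')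
        (.imp (.inCode (.const _) (.const _) (.const _) (.pr (.var 2) (.var 1)))
          (.imp (.inCode (.const _) (.const _) (.const _) (.pr (.var 2) (.var 0)))
            (.eq (.var 1) (.var 0)))))) ?_ ?_
    · intro z _ z' _ hz hz'
      rcases h.2 _ hz.lt_of_pr.1 _ hz.lt_of_pr.2 hz with ⟨_, e⟩ | ⟨j, _, w, _, e, _⟩
      · rcases h'.2 _ hz'.lt_of_pr.1 _ hz'.lt_of_pr.2 hz' with ⟨_, e'⟩ | ⟨j, _, w, _, e', _⟩
        · rw [e, e']
        · exact (Arith.succ_ne_zero j e'.symm).elim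
      · exact (Arith.succ_ne_zero j e.symm).elim
    · intro i ih z _ z' _ hz hz'
      rcases h.2 _ hz.lt_of_pr.1 _ hz.lt_of_pr.2 hz with ⟨e, _⟩ | ⟨j, _, w, _, e, ez, hj⟩
      · exact (Arith.succ_ne_zero i e).elim
      · rcases h'.2 _ hz'.lt_of_pr.1 _ hz'.lt_of_pr.2 hz' with ⟨e, _⟩ | ⟨j', _, w', _, e', ez', hj'⟩
        · exact (Arith.succ_ne_zero i e).elim
        · obtain rfl := Arith.succ_inj e
          obtain rfl := Arith.succ_inj e'
          rw [ez, ez', ih w hj.lt_of_pr.2 w' hj'.lt_of_pr.2 hj hj']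
  exact this n y h.1.lt_of_pr.2 y' h'.1.lt_of_pr.2 h.1 h'.1

theorem Bdd.computation {f₀ : M.Num → M.Num} {f : M.Num → M.Num → M.Num → M.Num}
    (hf₀ : RecFun fun v => f₀ (v 0)) (hf : RecFun fun v => f (v 0) (v 1) (v 2))
    {a u m s n y : (ℕ → M.Num) → M.Num} (ha : RecFun a) (hu : RecFun u) (hm : RecFun m)
    (hs : RecFun s) (hn : RecFun n) (hy : RecFun y) :
    Bdd fun v => Computation f₀ f (a v) (u v) (m v) (s v) (n v) (y v) := by
  refine .and (.inCode ha hu hm (.pr hn hy)) (.ball' ha (.ball' ha.lift (.imp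
    (.inCode ha.lift.lift hu.lift.lift hm.lift.lift (.pr (.var 1) (.var 0)))
    (.or (.and (.eq' (.var 1) (.const 0)) (.eq' (.var 0) (hf₀.comp₁ hs.lift.lift)))
      (.bex' ha.lift.lift (.bex' ha.lift.lift.lift (.and (.eq' (.var 3) (.add (.var 1) (.const 1)))
        (.and (.eq' (.var 2) (hf.comp₃ hs.lift.lift.lift.lift (.var 1) (.var 0)))
          (.inCode ha.lift.lift.lift.lift hu.lift.lift.lift.lift hm.lift.lift.lift.lift
            (.pr (.var 1) (.var 0)))))))))))

/-- A computation is prolonged by recoding it with one more pair; old entries keep their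
justifications in the new code. -/
theorem exists_computation {f₀ : M.Num → M.Num} {f : M.Num → M.Num → M.Num → M.Num}
    (hf₀ : RecFun fun v => f₀ (v 0)) (hf : RecFun fun v => f (v 0) (v 1) (v 2)) (s n : M.Num) :
    ∃ y a u m, Computation f₀ f a u m s n y := by
  refine sigma1_induction (P := fun n => ∃ y a u m, Computation f₀ f a u m s n y)
    (.ex (.ex (.ex (.ex (Bdd.computation hf₀ hf (.var 2) (.var 1) (.var 0) (.const s) (.var 4)
      (.var 3)).sigma1)))) ?_ ?_ n
  · obtain ⟨u, m, h⟩ := exists_code (A := fun x => x = pr 0 (f₀ s)) (.eq (.var 0) (.const _))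
      (pr 0 (f₀ s) + 1)
    refine ⟨f₀ s, _, u, m, (h _).2 ⟨Order.lt_add_one_iff.2 le_rfl, rfl⟩, fun i _ z _ hiz => .inl ?_⟩
    exact pr_inj.1 ((h _).1 hiz).2
  · rintro n ⟨y, a, u, m, hc⟩
    obtain ⟨u', m', h⟩ := exists_code
      (A := fun x => InCode a u m x ∨ x = pr (n + 1) (f s n y))
      (.or (.inCode (.const _) (.const _) (.const _) (.var 0)) (.eq (.var 0) (.const _)))
      (a + pr (n + 1) (f s n y) + 1)
    have hle : ∀ x, InCode a u m x → InCode (a + pr (n + 1) (f s n y) + 1) u' m' x := fun x hx =>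
      (h x).2 ⟨hx.1.trans_le (by rw [add_assoc]; exact le_self_add), .inl hx⟩
    refine ⟨f s n y, _, u', m', (h _).2 ⟨Order.lt_add_one_iff.2 le_add_self, .inr rfl⟩,
      fun i _ z _ hiz => ?_⟩
    rcases ((h _).1 hiz).2 with hiz | hiz
    · rcases hc.2 _ hiz.lt_of_pr.1 _ hiz.lt_of_pr.2 hiz with h | ⟨j, _, w, _, e, ez, hj⟩
      · exact .inl h
      · have := hle _ hj
        exact .inr ⟨j, this.lt_of_pr.1, w, this.lt_of_pr.2, e, ez, this⟩
    · obtain ⟨rfl, rfl⟩ := pr_inj.1 hiz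
      have := hle _ hc.1
      exact .inr ⟨n, this.lt_of_pr.1, y, this.lt_of_pr.2, rfl, rfl, this⟩

/-- Existence and uniqueness of computations give a total function with `Σ⁰₁` graph. -/
theorem exists_primitive_recursion {f₀ : M.Num → M.Num} {f : M.Num → M.Num → M.Num → M.Num}
    (hf₀ : RecFun fun v => f₀ (v 0)) (hf : RecFun fun v => f (v 0) (v 1) (v 2)) :
    ∃ g : M.Num → M.Num → M.Num, (RecFun fun v => g (v 0) (v 1)) ∧ (∀ s, g s 0 = f₀ s) ∧
      ∀ s n, g s (n + 1) = f s n (g s n) := by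
  choose g hg using exists_computation hf₀ hf
  have hiff : ∀ s n y, y = g s n ↔ ∃ a u m, Computation f₀ f a u m s n y := by
    refine fun s n y => ⟨fun h => h ▸ hg s n, ?_⟩
    rintro ⟨a, u, m, h⟩
    obtain ⟨a', u', m', h'⟩ := hg s n
    exact computation_unique h h'
  refine ⟨g, ?_, fun s => ?_, fun s n => ?_⟩
  · refine .of_sigma1 ((Sigma1.ex (.ex (.ex (Bdd.computation hf₀ hf (.var 2) (.var 1) (.var 0)
      (.var 4) (.var 5) (.var 3)).sigma1))).of_iff fun v => hiff (v 1) (v 2) (v 0))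
  · obtain ⟨a, u, m, h⟩ := hg s 0
    rcases h.2 _ h.1.lt_of_pr.1 _ h.1.lt_of_pr.2 h.1 with ⟨_, e⟩ | ⟨j, _, w, _, e, _⟩
    · exact e
    · exact (Arith.succ_ne_zero j e.symm).elim
  · obtain ⟨a, u, m, h⟩ := hg s (n + 1)
    rcases h.2 _ h.1.lt_of_pr.1 _ h.1.lt_of_pr.2 h.1 with ⟨e, _⟩ | ⟨j, _, w, _, e, ez, hj⟩
    · exact (Arith.succ_ne_zero n e).elim
    · obtain rfl := Arith.succ_inj e
      rw [ez, (hiff s n w).2 ⟨a, u, m, hj, h.2⟩]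

end Model

end SecondOrderArith

namespace SecondOrderArith

namespace Model

set_option linter.unusedSectionVars false

variable {M : Model.{u}} [hM : IsRCA M]

/-! ### Strong `Σ⁰₁` collection -/

-- Let `cnt s n` be the number of `x < n` with a witness below `s`. If no stage sufficed for `m`,
-- then `cnt s m` could always be increased, and `Σ⁰₁` induction would push it beyond its upper
-- bound `m`.
open Classical in
theorem strong_collection {P : M.Num → M.Num → Prop} (hP : Bdd fun v => P (v 0) (v 1))
    (m : M.Num) : ∃ s, ∀ x, x < m → ∀ y, P y x → ∃ z, z < s ∧ P z x := by
  have hK : Bdd fun v => ∃ y, y < v 0 ∧ P y (v 1) :=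
    .bex (.var 0) (hP.comp₂ (.var 0) (.var 2))
  obtain ⟨cnt, hcnt, h0, h1⟩ := exists_primitive_recursion (f₀ := fun _ => (0 : M.Num))
    (f := fun s n z => if ∃ y, y < s ∧ P y n then z + 1 else z) (.const 0)
    (.ite (hK.comp₂ (P := fun a b => ∃ y, y < a ∧ P y b) (.var 0) (.var 1))
      (.add (.var 2) (.const 1)) (.var 2))
  have hle : ∀ s n, cnt s n ≤ n := by
    intro s
    refine bdd_induction (.le' (hcnt.comp₂ (.const s) (.var 0)) (.var 0)) (h0 s).le ?_
    intro n ih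
    rw [h1]
    split_ifs
    · gcongr
    · exact ih.trans le_self_add
  -- A single `x` that gains a witness between the two stages makes the count strictly larger at
  -- every `n` beyond `x`.
  have hmono : ∀ s s', s ≤ s' → ∀ x, (¬ ∃ y, y < s ∧ P y x) → (∃ y, y < s' ∧ P y x) → ∀ n,
      cnt s n ≤ cnt s' n ∧ (x < n → cnt s n < cnt s' n) := by
    intro s s' hs x hx hx'
    refine bdd_induction (.and (.le' (hcnt.comp₂ (.const s) (.var 0)) (hcnt.comp₂ (.const s') (.var 0)))
      (.imp (.lt (.const x) (.var 0))
        (.lt' (hcnt.comp₂ (.const s) (.var 0)) (hcnt.comp₂ (.const s') (.var 0))))) ?_ ?_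
    · exact ⟨by rw [h0, h0], fun h => (not_lt_zero h).elim⟩
    · rintro n ⟨ih₁, ih₂⟩
      rw [h1, h1]
      have hK : (∃ y, y < s ∧ P y n) → ∃ y, y < s' ∧ P y n :=
        fun ⟨y, hy, h⟩ => ⟨y, hy.trans_le hs, h⟩
      have key : x < n + 1 → x < n ∨ x = n := fun h => (Order.lt_add_one_iff.1 h).lt_or_eq
      split_ifs with c₁ c₂ c₂
      · refine ⟨by gcongr, fun h => ?_⟩
        rcases key h with h | rfl
        · have := ih₂ h
          gcongr
        · exact (hx c₁).elim
      · exact (c₂ (hK c₁)).elim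
      · exact ⟨ih₁.trans le_self_add, fun _ => Order.lt_add_one_iff.2 ih₁⟩
      · refine ⟨ih₁, fun h => ?_⟩
        rcases key h with h | rfl
        · exact ih₂ h
        · exact (c₂ hx').elim
  by_contra! hc
  have : ∀ k, ∃ s, k ≤ cnt s m := by
    refine sigma1_induction (P := fun k => ∃ s, k ≤ cnt s m)
      (.ex (Bdd.le' (.var 1) (hcnt.comp₂ (.var 0) (.const m))).sigma1) ⟨0, zero_le⟩ ?_
    rintro k ⟨s, hs⟩
    obtain ⟨x, hx, y, hy, hn⟩ := hc s
    refine ⟨s + y + 1, Order.add_one_le_iff.2 (hs.trans_lt ?_)⟩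
    refine (hmono s (s + y + 1) (by rw [add_assoc]; exact le_self_add) x ?_ ?_ m).2 hx
    · rintro ⟨z, hz, h⟩; exact hn z hz h
    · exact ⟨y, Order.lt_add_one_iff.2 le_add_self, hy⟩
  obtain ⟨s, hs⟩ := this (m + 1)
  exact (Order.add_one_le_iff.1 hs).not_ge (hle s m)

/-! ### The largest power of two dividing a number -/

theorem even_or_odd (a : M.Num) : ∃ b, a = 2 * b ∨ a = 2 * b + 1 := by
  refine sigma1_induction (P := fun a => ∃ b, a = 2 * b ∨ a = 2 * b + 1)
    (.ex (Bdd.or (.eq (.var 1) (.mul (.const 2) (.var 0)))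
      (.eq (.var 1) (.add (.mul (.const 2) (.var 0)) (.const 1)))).sigma1)
    ⟨0, .inl (mul_zero 2).symm⟩ ?_ a
  rintro a ⟨b, rfl | rfl⟩
  · exact ⟨b, .inr rfl⟩
  · exact ⟨b + 1, .inl (by ring)⟩

theorem even_ne_odd (a b : M.Num) : 2 * a ≠ 2 * b + 1 := by
  intro h
  rcases le_or_gt a b with hab | hab
  · exact (Order.lt_add_one_iff.2 (mul_le_mul_right hab 2)).ne h
  · obtain ⟨c, rfl⟩ := Arith.exists_add_of_lt hab
    have : 2 * b + 1 + (2 * c + 1) = 2 * b + 1 + 0 := by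
      rw [add_zero]
      exact (by ring : _ = 2 * (b + c + 1)).trans h
    exact Arith.succ_ne_zero _ (add_left_cancel this)

/-- `u` is a power of two: all its divisors other than `1` are even. -/
def Pow2 (u : M.Num) : Prop := u ≠ 0 ∧ ∀ d, d < u + 1 → d ∣ u → d = 1 ∨ 2 ∣ d

theorem Bdd.pow2 {f : (ℕ → M.Num) → M.Num} (hf : RecFun f) : Bdd fun v => Pow2 (f v) := by
  refine .comp₁ (P := Pow2) ?_ hf
  exact .and (.not (.eq (.var 0) (.const 0))) (.ball (.add (.var 0) (.const 1))
    (.imp (.dvd (.var 0) (.var 1)) (.or (.eq (.var 0) (.const 1)) (.dvd (.const 2) (.var 0)))))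

theorem num_le_of_dvd {a b : M.Num} (hb : b ≠ 0) (h : a ∣ b) : a ≤ b := by
  obtain ⟨c, rfl⟩ := h
  exact le_mul_of_one_le_right zero_le (one_le_of_ne_zero (right_ne_zero_of_mul hb))

theorem Pow2.dvd {u : M.Num} (hu : Pow2 u) {d : M.Num} (h : d ∣ u) : d = 1 ∨ 2 ∣ d :=
  hu.2 d (Order.lt_add_one_iff.2 (num_le_of_dvd hu.1 h)) h

theorem pow2_one : Pow2 (1 : M.Num) :=
  ⟨one_ne_zero, fun _ _ h => .inl (le_antisymm (num_le_of_dvd one_ne_zero h)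
    (one_le_of_ne_zero (ne_zero_of_dvd_ne_zero one_ne_zero h)))⟩

theorem Pow2.two_mul {u : M.Num} (hu : Pow2 u) : Pow2 (2 * u) := by
  refine ⟨mul_ne_zero two_ne_zero hu.1, fun d _ ⟨c, hc⟩ => ?_⟩
  obtain ⟨e, rfl | rfl⟩ := even_or_odd d
  · exact .inr (dvd_mul_right _ _)
  · obtain ⟨c', rfl | rfl⟩ := even_or_odd c
    · refine hu.dvd ⟨c', ?_⟩
      refine mul_left_cancel₀ (two_ne_zero (α := M.Num)) ?_
      rw [hc]; ring
    · refine (even_ne_odd u (2 * e * c' + e + c') ?_).elim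
      rw [hc]; ring

theorem Pow2.exists_half {u : M.Num} (hu : Pow2 u) (h : u ≠ 1) : ∃ w, u = 2 * w ∧ Pow2 w := by
  obtain ⟨w, rfl⟩ := (hu.dvd dvd_rfl).resolve_left h
  exact ⟨w, rfl, right_ne_zero_of_mul hu.1, fun d _ hd => hu.dvd (hd.mul_left 2)⟩

theorem num_lt_two_mul {a : M.Num} (h : a ≠ 0) : a < 2 * a := by
  rw [_root_.two_mul]
  exact lt_add_of_pos_right _ (num_pos_iff.2 h)

/-- Halve both powers until the smaller one is `1`; the larger one is then even. -/
theorem Pow2.two_mul_dvd {u w : M.Num} (hu : Pow2 u) (hw : Pow2 w) (h : u < w) : 2 * u ∣ w := by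
  -- The larger power is quantified below `w + 1` so that the induction predicate stays bounded.
  refine strong_induction (P := fun u => ∀ w', w' < w + 1 → Pow2 u → Pow2 w' → u < w' → 2 * u ∣ w')
    (.ball (.const _) (.imp (.pow2 (.var 1)) (.imp (.pow2 (.var 0)) (.imp (.lt (.var 1) (.var 0))
      (.dvd (.mul (.const 2) (.var 1)) (.var 0)))))) ?_ u w (Order.lt_add_one_iff.2 le_rfl) hu hw h
  intro u ih w' hw'w hu hw' hlt
  have hw1 : w' ≠ 1 := ((one_le_of_ne_zero hu.1).trans_lt hlt).ne'
  obtain ⟨z, rfl, hz⟩ := hw'.exists_half hw1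
  by_cases hu1 : u = 1
  · rw [hu1, mul_one]; exact dvd_mul_right _ _
  · obtain ⟨t, rfl, ht⟩ := hu.exists_half hu1
    refine mul_dvd_mul_left 2 (ih t (num_lt_two_mul ht.1) z ?_ ht hz ?_)
    · exact (num_lt_two_mul hz.1).trans hw'w
    · exact lt_of_mul_lt_mul_left hlt zero_le

/-- Halve until the number is odd; the bounds on `u` and `a` make strong induction applicable. -/
theorem exists_two_part {p : M.Num} (hp : p ≠ 0) : ∃ u, Pow2 u ∧ ∃ a, p = u * (2 * a + 1) := by
  have : ∀ p : M.Num, p ≠ 0 → ∃ u, u < p + 1 ∧ (Pow2 u ∧ ∃ a, a < p + 1 ∧ p = u * (2 * a + 1)) := by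
    refine strong_induction (.imp (.not (.eq (.var 0) (.const 0)))
      (.bex (.add (.var 0) (.const 1)) (.and (.pow2 (.var 0)) (.bex (.add (.var 1) (.const 1))
      (.eq (.var 2) (.mul (.var 1) (.add (.mul (.const 2) (.var 0)) (.const 1)))))))) ?_
    intro p ih hp
    obtain ⟨b, rfl | rfl⟩ := even_or_odd p
    · have hb := right_ne_zero_of_mul hp
      have hlt := num_lt_two_mul hb
      obtain ⟨u, hu, hu', a, ha, e⟩ := ih b hlt hb
      refine ⟨2 * u, ?_, hu'.two_mul, a, ha.trans ?_, ?_⟩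
      · exact Order.lt_add_one_iff.2 (mul_le_mul_right (Order.lt_add_one_iff.1 hu) 2)
      · gcongr
      · nth_rw 1 [e]; ring
    · refine ⟨1, ?_, pow2_one, b, ?_, (one_mul _).symm⟩
      · exact Order.lt_add_one_iff.2 le_add_self
      · refine Order.lt_add_one_iff.2 (le_trans ?_ le_self_add)
        rw [two_mul]; exact le_self_add
  obtain ⟨u, _, hu, a, _, h⟩ := this p hp
  exact ⟨u, hu, a, h⟩

open Classical in
/-- The largest power of two that divides `p`, and `0` for `p = 0`. -/
noncomputable def twoPart (p : M.Num) : M.Num :=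
  if h : p = 0 then 0 else (exists_two_part h).choose

theorem twoPart_zero : twoPart (0 : M.Num) = 0 := dif_pos rfl

theorem twoPart_spec {p : M.Num} (hp : p ≠ 0) :
    Pow2 (twoPart p) ∧ ∃ a, p = twoPart p * (2 * a + 1) := by
  have : twoPart p = (exists_two_part hp).choose := dif_neg hp
  rw [this]
  exact (exists_two_part hp).choose_spec

theorem lt_twoPart {u p : M.Num} (hu : Pow2 u) (hp : p ≠ 0) (h : 2 * u ∣ p) : u < twoPart p := by
  by_contra! hc
  obtain ⟨h2, a, ha⟩ := twoPart_spec hp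
  have : 2 * twoPart p ∣ p := by
    rcases hc.lt_or_eq with hlt | he
    · exact (h2.two_mul_dvd hu hlt).trans ((dvd_mul_left u 2).trans h)
    · rwa [he]
  obtain ⟨c, hc⟩ := this
  refine even_ne_odd c a (mul_left_cancel₀ h2.1 ?_)
  exact (by ring : _ = 2 * twoPart p * c).trans (hc.symm.trans ha)

theorem twoPart_eq {u p a : M.Num} (hu : Pow2 u) (h : p = u * (2 * a + 1)) : twoPart p = u := by
  have hp : p ≠ 0 := h ▸ mul_ne_zero hu.1 (Arith.succ_ne_zero _)
  obtain ⟨h2, b, hb⟩ := twoPart_spec hp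
  rcases lt_trichotomy (twoPart p) u with hlt | he | hlt
  · have := lt_twoPart h2 hp ((h2.two_mul_dvd hu hlt).trans ⟨_, h⟩)
    exact (lt_irrefl _ this).elim
  · exact he
  · obtain ⟨c, hc⟩ := (hu.two_mul_dvd h2 hlt).trans ⟨_, hb⟩
    refine (even_ne_odd c a (mul_left_cancel₀ hu.1 ?_)).elim
    exact (by ring : _ = 2 * u * c).trans (hc.symm.trans h)

theorem RecFun.twoPart {f : (ℕ → M.Num) → M.Num} (hf : RecFun f) :
    RecFun fun v => twoPart (f v) := by
  refine .comp₁ (g := Model.twoPart) ?_ hf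
  have : Bdd fun v : ℕ → M.Num => (v 1 = 0 ∧ v 0 = 0) ∨
      (v 1 ≠ 0 ∧ Pow2 (v 0) ∧ ∃ a, a < v 1 + 1 ∧ v 1 = v 0 * (2 * a + 1)) :=
    .or (.and (.eq (.var 1) (.const 0)) (.eq (.var 0) (.const 0)))
    (.and (.not (.eq (.var 1) (.const 0))) (.and (.pow2 (.var 0)) (.bex (.add (.var 1) (.const 1))
      (.eq (.var 2) (.mul (.var 1) (.add (.mul (.const 2) (.var 0)) (.const 1)))))))
  refine this.of_iff fun v => ?_
  show v 0 = Model.twoPart (v 1) ↔ _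
  by_cases h : v 1 = 0
  · simp [h, twoPart_zero]
  · simp only [h, false_and, ne_eq, not_false_eq_true, true_and, false_or]
    refine ⟨fun e => ?_, fun ⟨h2, a, _, ha⟩ => (twoPart_eq h2 ha).symm⟩
    obtain ⟨h2, a, ha⟩ := twoPart_spec h
    rw [e]
    refine ⟨h2, a, ?_, ha⟩
    show a < v 1 + 1
    refine Order.lt_add_one_iff.2 ?_
    rw [ha]
    refine le_trans ?_ (le_mul_of_one_le_left zero_le (one_le_of_ne_zero h2.1))
    refine le_trans ?_ le_self_add
    rw [two_mul]
    exact le_self_add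

theorem twoPart_add_of_lt {p q : M.Num} (hp : p ≠ 0) (hq : q ≠ 0) (h : twoPart p < twoPart q) :
    twoPart (p + q) = twoPart p := by
  obtain ⟨hu, a, ha⟩ := twoPart_spec hp
  obtain ⟨hw, b, hb⟩ := twoPart_spec hq
  obtain ⟨c, hc⟩ := hu.two_mul_dvd hw h
  refine twoPart_eq hu (a := a + c * (2 * b + 1)) ?_
  nth_rw 1 [ha, hb]
  rw [hc]
  ring

theorem lt_twoPart_add_of_eq {p q : M.Num} (hp : p ≠ 0) (hq : q ≠ 0) (h : twoPart p = twoPart q) :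
    twoPart p < twoPart (p + q) := by
  obtain ⟨hu, a, ha⟩ := twoPart_spec hp
  obtain ⟨-, b, hb⟩ := twoPart_spec hq
  refine lt_twoPart hu (fun h => hp (add_eq_zero.1 h).1) ⟨a + b + 1, ?_⟩
  nth_rw 1 [ha, hb]
  rw [← h]
  ring

/-! ### Homogeneous sets for the jump colouring -/

/-- `x` is enumerated before stage `s`. -/
def Stage (P : M.Num → M.Num → Prop) (s x : M.Num) : Prop := ∃ y, y < s ∧ P y x

/-- The stages `p` and `q` agree below the two-part of `p`. -/
def Agree (P : M.Num → M.Num → Prop) (p q : M.Num) : Prop :=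
  ∀ x, x < twoPart p → (Stage P p x ↔ Stage P q x)

/-- The two bits of the jump colouring. -/
def SameBits (P : M.Num → M.Num → Prop) (p q p' q' : M.Num) : Prop :=
  (twoPart p < twoPart q ↔ twoPart p' < twoPart q') ∧ (Agree P p q ↔ Agree P p' q')

theorem num_sub_ne_zero {a b : M.Num} (h : a < b) : b - a ≠ 0 :=
  (tsub_pos_of_lt h).ne'

theorem num_sub_add_sub {a b c : M.Num} (hab : a < b) (hbc : b < c) :
    (b - a) + (c - b) = c - a := by
  rw [add_comm]
  exact tsub_add_tsub_cancel hbc.le hab.le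

/-- The jump argument for gaps of `X`: every gap decides enumeration below its two-part, and
two-parts are unbounded. So the complement of the enumerated set is `Σ⁰₁` too, and `Δ⁰₁`
comprehension applies. -/
theorem mem_sets_of_homogeneous {P : M.Num → M.Num → Prop} (hP : Bdd fun v => P (v 0) (v 1))
    {X : Set M.Num} (hX : X ∈ M.Sets) (hinf : ∀ a, ∃ b, a < b ∧ b ∈ X)
    (hom : ∀ a b c a' b' c', a ∈ X → b ∈ X → c ∈ X → a < b → b < c → a' ∈ X → b' ∈ X → c' ∈ X →
      a' < b' → b' < c' → SameBits P (b - a) (c - b) (b' - a') (c' - b')) :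
    {x | ∃ y, P y x} ∈ M.Sets := by
  obtain ⟨a₀, -, ha₀⟩ := hinf 0
  obtain ⟨b₀, hab₀, hb₀⟩ := hinf a₀
  have lt_bit : ∀ a b c, a ∈ X → b ∈ X → c ∈ X → a < b → b < c →
      twoPart (b - a) < twoPart (c - b) := by
    by_contra! hc
    obtain ⟨a₁, b₁, c₁, ha₁, hb₁, hc₁, hab₁, hbc₁, h₁⟩ := hc
    have ge : ∀ a b c, a ∈ X → b ∈ X → c ∈ X → a < b → b < c →
        twoPart (c - b) ≤ twoPart (b - a) := fun a b c ha hb hc hab hbc =>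
      not_lt.1 fun h => h₁.not_gt
        ((hom a b c a₁ b₁ c₁ ha hb hc hab hbc ha₁ hb₁ hc₁ hab₁ hbc₁).1.1 h)
    -- Infinite descent as a `Σ⁰₁` induction: among any further points of `X` a gap of smaller
    -- two-part appears, since two equal ones in a row would add up to a larger one.
    have : ∀ n, ∃ a b, (a ∈ X ∧ b ∈ X ∧ a < b) ∧ twoPart (b - a) + n ≤ twoPart (b₀ - a₀) := by
      refine sigma1_induction (.ex (.ex (Bdd.and (.and (.mem (.var 1) hX) (.and (.mem (.var 0) hX)
        (.lt (.var 1) (.var 0)))) (.le' (.add (.twoPart (.sub (.var 0) (.var 1))) (.var 2))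
        (.const _))).sigma1)) ⟨a₀, b₀, ⟨ha₀, hb₀, hab₀⟩, by rw [add_zero]⟩ ?_
      rintro n ⟨a, b, ⟨ha, hb, hab⟩, hn⟩
      obtain ⟨c, hbc, hc⟩ := hinf b
      obtain ⟨d, hcd, hd⟩ := hinf c
      have fin : ∀ {p q}, p ∈ X → q ∈ X → p < q → twoPart (q - p) < twoPart (b - a) →
          ∃ a b, (a ∈ X ∧ b ∈ X ∧ a < b) ∧ twoPart (b - a) + (n + 1) ≤ twoPart (b₀ - a₀) := by
        intro p q hp hq hpq h
        refine ⟨p, q, ⟨hp, hq, hpq⟩, le_trans ?_ hn⟩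
        rw [← add_assoc, Order.add_one_le_iff]
        gcongr
      have h₁ := ge a b c ha hb hc hab hbc
      have h₂ := ge b c d hb hc hd hbc hcd
      rcases h₁.lt_or_eq with h₁ | h₁
      · exact fin hb hc hbc h₁
      rcases h₂.lt_or_eq with h₂ | h₂
      · exact fin hc hd hcd (h₁ ▸ h₂)
      · have := lt_twoPart_add_of_eq (num_sub_ne_zero hbc) (num_sub_ne_zero hcd) h₂.symm
        rw [num_sub_add_sub hbc hcd, h₁] at this
        exact (this.not_ge (ge a b d ha hb hd hab (hbc.trans hcd))).elim
    obtain ⟨a, b, -, h⟩ := this (twoPart (b₀ - a₀) + 1)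
    have : twoPart (b₀ - a₀) + 1 ≤ twoPart (b₀ - a₀) := le_add_self.trans h
    exact (Order.add_one_le_iff.1 this).false
  have unb : ∀ e, ∃ a b, (a ∈ X ∧ b ∈ X ∧ a < b) ∧ e < twoPart (b - a) := by
    refine sigma1_induction (.ex (.ex (Bdd.and (.and (.mem (.var 1) hX) (.and (.mem (.var 0) hX)
        (.lt (.var 1) (.var 0)))) (.lt' (.var 2) (.twoPart (.sub (.var 0) (.var 1))))).sigma1))
        ⟨a₀, b₀, ⟨ha₀, hb₀, hab₀⟩, num_pos_iff.2 (twoPart_spec (num_sub_ne_zero hab₀)).1.1⟩ ?_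
    rintro n ⟨a, b, ⟨ha, hb, hab⟩, hn⟩
    obtain ⟨c, hbc, hc⟩ := hinf b
    exact ⟨b, c, ⟨hb, hc, hbc⟩, (Order.add_one_le_iff.2 hn).trans_lt (lt_bit a b c ha hb hc hab hbc)⟩
  have part_eq : ∀ a b c, a ∈ X → b ∈ X → c ∈ X → a < b → b < c →
      twoPart (c - a) = twoPart (b - a) := fun a b c ha hb hc hab hbc => by
    rw [← num_sub_add_sub hab hbc]
    exact twoPart_add_of_lt (num_sub_ne_zero hab) (num_sub_ne_zero hbc)
      (lt_bit a b c ha hb hc hab hbc)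
  have far : ∀ a s, ∃ b, a < b ∧ b ∈ X ∧ s ≤ b - a := by
    intro a s
    obtain ⟨b, hb, hbX⟩ := hinf (a + s)
    exact ⟨b, le_self_add.trans_lt hb, hbX, le_tsub_of_add_le_left hb.le⟩
  -- The gaps from `a₀` to points beyond `b₀` have the two-part of `b₀ - a₀`, so one application of
  -- collection below it gives a stage after which they are correct.
  have agree : ∀ a b c, a ∈ X → b ∈ X → c ∈ X → a < b → b < c → Agree P (b - a) (c - b) := by
    obtain ⟨s, hs⟩ := strong_collection hP (twoPart (b₀ - a₀))
    obtain ⟨b, hb₀b, hb, hsb⟩ := far b₀ s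
    obtain ⟨c, hbc, hc, hsc⟩ := far b s
    have hab := hab₀.trans hb₀b
    have hsb' : s ≤ b - a₀ := hsb.trans (tsub_le_tsub_left hab₀.le b)
    have key : ∀ t, s ≤ t → ∀ x, x < twoPart (b₀ - a₀) → (Stage P t x ↔ ∃ y, P y x) := by
      refine fun t ht x hx => ⟨fun ⟨y, _, hy⟩ => ⟨y, hy⟩, fun ⟨y, hy⟩ => ?_⟩
      obtain ⟨z, hz, hz'⟩ := hs x hx y hy
      exact ⟨z, hz.trans_le ht, hz'⟩
    have : Agree P (b - a₀) (c - b) := by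
      intro x hx
      rw [part_eq a₀ b₀ b ha₀ hb₀ hb hab₀ hb₀b] at hx
      rw [key _ hsb' x hx, key _ hsc x hx]
    exact fun a' b' c' ha' hb' hc' hab' hbc' =>
      (hom a₀ b c a' b' c' ha₀ hb hc hab hbc ha' hb' hc' hab' hbc').2.1 this
  have decide : ∀ a b, a ∈ X → b ∈ X → a < b → ∀ x, x < twoPart (b - a) →
      ((∃ y, P y x) ↔ Stage P (b - a) x) := by
    refine fun a b ha hb hab x hx => ⟨fun ⟨y, hy⟩ => ?_, fun ⟨y, _, hy⟩ => ⟨y, hy⟩⟩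
    obtain ⟨c, hbc, hc, hy'⟩ := far b (y + 1)
    exact (agree a b c ha hb hc hab hbc x hx).2 ⟨y, Order.add_one_le_iff.1 hy', hy⟩
  have hS : Bdd fun v => Stage P (v 0) (v 1) := .bex (.var 0) (hP.comp₂ (.var 0) (.var 2))
  refine mem_sets_of_delta (.ex hP.sigma1) ?_
  -- Non-membership is witnessed by a gap whose two-part exceeds the number and at whose stage the
  -- number has not appeared.
  have : Sigma1 fun v : ℕ → M.Num => ∃ a b, (a ∈ X ∧ b ∈ X ∧ a < b) ∧
      v 0 < twoPart (b - a) ∧ ¬ Stage P (b - a) (v 0) :=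
    .ex (.ex (Bdd.and (.and (.mem (.var 1) hX) (.and (.mem (.var 0) hX) (.lt (.var 1) (.var 0))))
      (.and (.lt' (.var 2) (.twoPart (.sub (.var 0) (.var 1))))
        (hS.comp₂ (.sub (.var 0) (.var 1)) (.var 2)).not)).sigma1)
  refine this.of_iff fun v => ⟨fun h => ?_, ?_⟩
  · obtain ⟨a, b, hab, hlt⟩ := unb (v 0)
    exact ⟨a, b, hab, hlt, fun hS => h ((decide a b hab.1 hab.2.1 hab.2.2 _ hlt).2 hS)⟩
  · rintro ⟨a, b, hab, hlt, hn⟩ h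
    exact hn ((decide a b hab.1 hab.2.1 hab.2.2 _ hlt).1 h)

end Model

end SecondOrderArith

namespace SecondOrderArith

namespace Model

set_option linter.unusedSectionVars false

variable {M : Model.{u}}

/-! ### The two principles unfolded in a model. -/

theorem eval_add (v : ℕ → M.Num) (s t : Term) : M.eval v (s + t) = M.eval v s + M.eval v t := rfl
theorem eval_zero (v : ℕ → M.Num) : M.eval v 0 = 0 := rfl
theorem eval_one (v : ℕ → M.Num) : M.eval v 1 = 1 := rfl
theorem eval_var (v : ℕ → M.Num) (i : ℕ) : M.eval v (.var i) = v i := rfl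
theorem eval_pair (v : ℕ → M.Num) (s t : Term) :
    M.eval v (s.pair t) = pr (M.eval v s) (M.eval v t) := rfl
theorem sat_lt (v : ℕ → M.Num) (w : ℕ → M.Sets) (s t : Term) :
    M.Sat v w (.lt s t) ↔ M.eval v s < M.eval v t := Iff.rfl
theorem sat_eq (v : ℕ → M.Num) (w : ℕ → M.Sets) (s t : Term) :
    M.Sat v w (.eq s t) ↔ M.eval v s = M.eval v t := Iff.rfl
theorem sat_mem (v : ℕ → M.Num) (w : ℕ → M.Sets) (t : Term) (X : ℕ) :
    M.Sat v w (.mem t X) ↔ M.eval v t ∈ (w X : Set M.Num) := Iff.rfl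
theorem sat_and (v : ℕ → M.Num) (w : ℕ → M.Sets) (φ ψ : Formula) :
    M.Sat v w (.and φ ψ) ↔ M.Sat v w φ ∧ M.Sat v w ψ := Iff.rfl
theorem sat_all (v : ℕ → M.Num) (w : ℕ → M.Sets) (x : ℕ) (φ : Formula) :
    M.Sat v w (.all x φ) ↔ ∀ a, M.Sat (Function.update v x a) w φ := Iff.rfl
theorem sat_allSet (v : ℕ → M.Num) (w : ℕ → M.Sets) (X : ℕ) (φ : Formula) :
    M.Sat v w (.allSet X φ) ↔ ∀ A, M.Sat v (Function.update w X A) φ := Iff.rfl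

theorem sat_ZRT3_iff (v : ℕ → M.Num) (w : ℕ → M.Sets) : M.Sat v w ZRT3 ↔
    ∀ (k : M.Num) (C : M.Sets), ((∀ x, x ∈ C.1 → ∃ a b c i, (a < b ∧ b < c) ∧ i < k ∧
        x = pr (pr (pr a b) c) i) ∧
      ∀ a b c, a < b ∧ b < c → ∃ i, pr (pr (pr a b) c) i ∈ C.1 ∧
        ∀ j, pr (pr (pr a b) c) j ∈ C.1 → j = i) ∧
      (∀ a b c t i, a < b ∧ b < c →
        (pr (pr (pr a b) c) i ∈ C.1 ↔ pr (pr (pr (a + t) (b + t)) (c + t)) i ∈ C.1)) →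
      ∃ X : M.Sets, (∀ a, ∃ b, a < b ∧ b ∈ X.1) ∧ ∃ i, i < k ∧ ∀ a b c,
        (a < b ∧ b < c) ∧ (a ∈ X.1 ∧ b ∈ X.1 ∧ c ∈ X.1) → pr (pr (pr a b) c) i ∈ C.1 := by
  simp only [ZRT3, isColouringOfTriples, isTranslationInvariant, isInfinite, Formula.alls,
    Formula.exs, List.foldr, sat_lt, sat_eq, sat_mem, sat_and, sat_all, sat_allSet, sat_imp,
    sat_iff, sat_ex, sat_exSet, eval_pair, eval_add, eval_var, Function.update_apply,
    Nat.reduceEqDiff, reduceIte, OfNat.zero_ne_ofNat, OfNat.one_ne_ofNat,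
    OfNat.ofNat_ne_zero, OfNat.ofNat_ne_one, zero_ne_one, one_ne_zero]

/-- The set `F` is the graph of a function. -/
def IsFunctionGraph (F : Set M.Num) : Prop :=
  (∀ x, x ∈ F → ∃ a b, x = pr a b) ∧ ∀ a, ∃ b, pr a b ∈ F ∧ ∀ c, pr a c ∈ F → c = b

theorem sat_AHT2_iff (v : ℕ → M.Num) (w : ℕ → M.Sets) : M.Sat v w AHT2 ↔
    ∀ (k : M.Num) (C : M.Sets), ((∀ x, x ∈ C.1 → ∃ a b i, i < k ∧ x = pr (pr a b) i) ∧
      ∀ a b, ∃ i, pr (pr a b) i ∈ C.1 ∧ ∀ j, pr (pr a b) j ∈ C.1 → j = i) →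
      ∃ Y : M.Sets, (∀ a, ∃ b, a < b ∧ b ∈ Y.1) ∧ ∃ F : M.Sets, (IsFunctionGraph F.1 ∧
        (∀ a b c d, a < b ∧ pr a c ∈ F.1 ∧ pr b d ∈ F.1 → c < d) ∧
        ∀ a, a ∈ Y.1 ↔ ∃ b, pr b a ∈ F.1) ∧ ∃ G : M.Sets, (IsFunctionGraph G.1 ∧ pr 0 0 ∈ G.1 ∧
          ∀ a b c, pr a b ∈ G.1 ∧ pr a c ∈ F.1 → pr (a + 1) (b + c) ∈ G.1) ∧
          ∃ i, i < k ∧ ∀ k₀ k₁ k₂ g₀ g₁ g₂ p q, ((k₀ < k₁ ∨ k₀ = k₁) ∧ k₁ < k₂) ∧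
            (pr k₀ g₀ ∈ G.1 ∧ pr (k₁ + 1) g₁ ∈ G.1 ∧ pr (k₂ + 1) g₂ ∈ G.1) ∧
            (g₀ + p = g₁ ∧ g₁ + q = g₂) → pr (pr p q) i ∈ C.1 := by
  simp only [AHT2, isColouringOfPairs, isInfinite, Formula.alls, isIncreasingEnumeration,
    isFunction, isPartialSums, isMonochromaticAFS2, Formula.le, sat_or, IsFunctionGraph,
    Formula.exs, List.foldr, sat_lt, sat_eq, sat_mem, sat_and, sat_all, sat_allSet, sat_imp,
    sat_iff, sat_ex, sat_exSet, eval_pair, eval_add, eval_var, eval_zero, eval_one,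
    Function.update_apply,
    Nat.reduceEqDiff, reduceIte, OfNat.zero_ne_ofNat, OfNat.one_ne_ofNat,
    OfNat.ofNat_ne_zero, OfNat.ofNat_ne_one, zero_ne_one, one_ne_zero]

end Model

end SecondOrderArith

namespace SecondOrderArith

namespace Model

set_option linter.unusedSectionVars false

variable {M : Model.{u}}

/-! ### The principles for definable functions -/

/-- `ZRT3` for definable colourings. -/
def TranslationRamsey (M : Model.{u}) [IsRCA M] : Prop :=
  ∀ (k : M.Num) (col : M.Num → M.Num → M.Num → M.Num), (RecFun fun v => col (v 0) (v 1) (v 2)) →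
    (∀ a b c, a < b → b < c → col a b c < k) →
    (∀ a b c t, a < b → b < c → col (a + t) (b + t) (c + t) = col a b c) →
    ∃ X ∈ M.Sets, (∀ a, ∃ b, a < b ∧ b ∈ X) ∧ ∃ i, ∀ a b c, a ∈ X → b ∈ X → c ∈ X → a < b → b < c →
      col a b c = i

/-- `AHT2` for definable colourings. -/
def AdjacentHindman (M : Model.{u}) [IsRCA M] : Prop :=
  ∀ (k : M.Num) (col : M.Num → M.Num → M.Num), (RecFun fun v => col (v 0) (v 1)) →
    (∀ a b, col a b < k) →
    ∃ F G : M.Num → M.Num, (RecFun fun v => F (v 0)) ∧ (RecFun fun v => G (v 0)) ∧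
      (∀ a b, a < b → F a < F b) ∧ G 0 = 0 ∧ (∀ n, G (n + 1) = G n + F n) ∧
      ∃ i, ∀ k₀ k₁ k₂ p q, k₀ ≤ k₁ → k₁ < k₂ → G k₀ + p = G (k₁ + 1) →
        G (k₁ + 1) + q = G (k₂ + 1) → col p q = i

variable [hM : IsRCA M]

theorem exists_graph {f : M.Num → M.Num} (hf : RecFun fun v => f (v 0)) :
    ∃ F ∈ M.Sets, (∀ x ∈ F, ∃ a b, x = pr a b) ∧ ∀ a b, pr a b ∈ F ↔ b = f a := by
  refine ⟨{x | ∃ a, a < x + 1 ∧ x = pr a (f a)}, mem_sets (.bex (.add (.var 0) (.const 1))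
    (.eq' (.var 1) (.pr (.var 0) (hf.comp₁ (.var 0))))), ?_, fun a b => ?_⟩
  · rintro x ⟨a, _, h⟩; exact ⟨a, f a, h⟩
  · constructor
    · rintro ⟨c, _, h⟩
      obtain ⟨rfl, rfl⟩ := pr_inj.1 h
      rfl
    · rintro rfl; exact ⟨a, Order.lt_add_one_iff.2 (left_le_pr _ _), rfl⟩

theorem IsFunctionGraph.exists_fun {F : Set M.Num} (h : IsFunctionGraph F) (hF : F ∈ M.Sets) :
    ∃ f : M.Num → M.Num, (RecFun fun v => f (v 0)) ∧ ∀ a b, pr a b ∈ F ↔ b = f a := by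
  choose f hf hu using h.2
  have key : ∀ a b, pr a b ∈ F ↔ b = f a := fun a b => ⟨hu a b, fun h => h ▸ hf a⟩
  exact ⟨f, (Bdd.mem (.pr (.var 1) (.var 0)) hF).of_iff fun v => (key (v 1) (v 0)).symm, key⟩

theorem isFunctionGraph_of {f : M.Num → M.Num} {F : Set M.Num} (h : ∀ x ∈ F, ∃ a b, x = pr a b)
    (hf : ∀ a b, pr a b ∈ F ↔ b = f a) : IsFunctionGraph F :=
  ⟨h, fun a => ⟨f a, (hf a _).2 rfl, fun c hc => (hf a c).1 hc⟩⟩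

theorem translationRamsey_of_sat {v : ℕ → M.Num} {w : ℕ → M.Sets} (h : M.Sat v w ZRT3) :
    TranslationRamsey M := by
  intro k col hcol hk hinv
  have hC : {x | ∃ a, a < x + 1 ∧ ∃ b, b < x + 1 ∧ ∃ c, c < x + 1 ∧ (a < b ∧ b < c) ∧
      x = pr (pr (pr a b) c) (col a b c)} ∈ M.Sets :=
    mem_sets (.bex (.add (.var 0) (.const 1)) (.bex (.add (.var 1) (.const 1))
      (.bex (.add (.var 2) (.const 1)) (.and (.and (.lt (.var 2) (.var 1)) (.lt (.var 1) (.var 0)))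
        (.eq' (.var 3) (.pr (.pr (.pr (.var 2) (.var 1)) (.var 0))
          (hcol.comp₃ (.var 2) (.var 1) (.var 0))))))))
  generalize hCdef : {x | ∃ a, a < x + 1 ∧ ∃ b, b < x + 1 ∧ ∃ c, c < x + 1 ∧ (a < b ∧ b < c) ∧
      x = pr (pr (pr a b) c) (col a b c)} = C at hC
  have mem : ∀ a b c i, pr (pr (pr a b) c) i ∈ C ↔ (a < b ∧ b < c) ∧ i = col a b c := by
    intro a b c i
    rw [← hCdef]
    constructor
    · rintro ⟨a', _, b', _, c', _, h, e₁⟩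
      obtain ⟨e₂, rfl⟩ := pr_inj.1 e₁
      obtain ⟨e₃, rfl⟩ := pr_inj.1 e₂
      obtain ⟨rfl, rfl⟩ := pr_inj.1 e₃
      exact ⟨h, rfl⟩
    · rintro ⟨h, rfl⟩
      refine ⟨a, Order.lt_add_one_iff.2 ?_, b, Order.lt_add_one_iff.2 ?_, c,
        Order.lt_add_one_iff.2 ?_, h, rfl⟩
      · exact (left_le_pr a b).trans ((left_le_pr _ c).trans (left_le_pr _ _))
      · exact (right_le_pr a b).trans ((left_le_pr _ c).trans (left_le_pr _ _))
      · exact (right_le_pr _ c).trans (left_le_pr _ _)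
  have shape : ∀ x, x ∈ C → ∃ a b c i, (a < b ∧ b < c) ∧ i < k ∧ x = pr (pr (pr a b) c) i := by
    intro x hx
    rw [← hCdef] at hx
    obtain ⟨a, _, b, _, c, _, h, e⟩ := hx
    exact ⟨a, b, c, _, h, hk a b c h.1 h.2, e⟩
  have inv : ∀ a b c t i, a < b ∧ b < c →
      (pr (pr (pr a b) c) i ∈ C ↔ pr (pr (pr (a + t) (b + t)) (c + t)) i ∈ C) := by
    intro a b c t i h
    rw [mem, mem, hinv a b c t h.1 h.2, add_lt_add_iff_right, add_lt_add_iff_right]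
  obtain ⟨X, hX, i, _, hi⟩ := (sat_ZRT3_iff v w).1 h k ⟨C, hC⟩ ⟨⟨shape, fun a b c h =>
    ⟨col a b c, (mem _ _ _ _).2 ⟨h, rfl⟩, fun j hj => ((mem _ _ _ _).1 hj).2⟩⟩, inv⟩
  exact ⟨X.1, X.2, hX, i, fun a b c ha hb hc hab hbc =>
    ((mem _ _ _ _).1 (hi a b c ⟨⟨hab, hbc⟩, ha, hb, hc⟩)).2.symm⟩

theorem sat_of_translationRamsey (h : TranslationRamsey M) (v : ℕ → M.Num) (w : ℕ → M.Sets) :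
    M.Sat v w ZRT3 := by
  rw [sat_ZRT3_iff]
  rintro k ⟨C, hC⟩ ⟨⟨hb, hu⟩, hinv⟩
  dsimp only at hb hu hinv ⊢
  -- The value `0` off increasing triples only makes the graph definable; it need not be a legal
  -- colour.
  have : ∀ a b c, ∃ i, (a < b ∧ b < c → pr (pr (pr a b) c) i ∈ C) ∧ (¬ (a < b ∧ b < c) → i = 0) := by
    intro a b c
    by_cases h : a < b ∧ b < c
    · obtain ⟨i, hi, _⟩ := hu a b c h; exact ⟨i, fun _ => hi, fun h' => (h' h).elim⟩
    · exact ⟨0, fun h' => (h h').elim, fun _ => rfl⟩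
  choose col hcol hcol0 using this
  have key : ∀ a b c, a < b → b < c → ∀ i, pr (pr (pr a b) c) i ∈ C ↔ i = col a b c := by
    intro a b c hab hbc i
    obtain ⟨j, hj, hj'⟩ := hu a b c ⟨hab, hbc⟩
    exact ⟨fun h => (hj' i h).trans (hj' _ (hcol a b c ⟨hab, hbc⟩)).symm,
      fun h => h ▸ hcol a b c ⟨hab, hbc⟩⟩
  have hrec : RecFun fun v : ℕ → M.Num => col (v 0) (v 1) (v 2) := by
    have : Bdd fun v : ℕ → M.Num => ((v 1 < v 2 ∧ v 2 < v 3) ∧ pr (pr (pr (v 1) (v 2)) (v 3)) (v 0) ∈ C)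
        ∨ (¬ (v 1 < v 2 ∧ v 2 < v 3) ∧ v 0 = 0) :=
      .or (.and (.and (.lt (.var 1) (.var 2)) (.lt (.var 2) (.var 3)))
        (.mem (.pr (.pr (.pr (.var 1) (.var 2)) (.var 3)) (.var 0)) hC))
        (.and (.not (.and (.lt (.var 1) (.var 2)) (.lt (.var 2) (.var 3)))) (.eq (.var 0) (.const 0)))
    refine this.of_iff fun v => ?_
    show v 0 = col (v 1) (v 2) (v 3) ↔ _
    by_cases h : v 1 < v 2 ∧ v 2 < v 3
    · rw [key _ _ _ h.1 h.2]; simp [h]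
    · rw [hcol0 _ _ _ h]; simp only [h, false_and, false_or, not_false_eq_true, true_and]
  have hlt : ∀ a b c, a < b → b < c → col a b c < k := by
    intro a b c hab hbc
    obtain ⟨a', b', c', i', _, hi', e⟩ := hb _ ((key a b c hab hbc _).2 rfl)
    rw [(pr_inj.1 e).2]
    exact hi'
  have htr : ∀ a b c t, a < b → b < c → col (a + t) (b + t) (c + t) = col a b c := by
    intro a b c t hab hbc
    symm
    rw [← key (a + t) (b + t) (c + t) (by gcongr) (by gcongr), ← hinv a b c t _ ⟨hab, hbc⟩]
    exact hcol a b c ⟨hab, hbc⟩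
  obtain ⟨X, hX, hinf, i, hi⟩ := h k col hrec hlt htr
  refine ⟨⟨X, hX⟩, hinf, i, ?_, fun a b c ⟨⟨hab, hbc⟩, ha, hb, hc⟩ =>
    (key a b c hab hbc i).2 (hi a b c ha hb hc hab hbc).symm⟩
  -- That `i` is a legal colour is read off from one triple in `X`.
  obtain ⟨a, _, ha⟩ := hinf 0
  obtain ⟨b, hab, hbX⟩ := hinf a
  obtain ⟨c, hbc, hc⟩ := hinf b
  rw [← hi a b c ha hbX hc hab hbc]
  exact hlt a b c hab hbc

theorem adjacentHindman_of_sat {v : ℕ → M.Num} {w : ℕ → M.Sets} (h : M.Sat v w AHT2) :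
    AdjacentHindman M := by
  intro k col hcol hk
  have hC : {x | ∃ a, a < x + 1 ∧ ∃ b, b < x + 1 ∧ x = pr (pr a b) (col a b)} ∈ M.Sets :=
    mem_sets (.bex (.add (.var 0) (.const 1)) (.bex (.add (.var 1) (.const 1))
      (.eq' (.var 2) (.pr (.pr (.var 1) (.var 0)) (hcol.comp₂ (.var 1) (.var 0))))))
  generalize hCdef : {x | ∃ a, a < x + 1 ∧ ∃ b, b < x + 1 ∧ x = pr (pr a b) (col a b)} = C at hC
  have mem : ∀ a b i, pr (pr a b) i ∈ C ↔ i = col a b := by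
    intro a b i
    rw [← hCdef]
    constructor
    · rintro ⟨a', _, b', _, e₁⟩
      obtain ⟨e₂, rfl⟩ := pr_inj.1 e₁
      obtain ⟨rfl, rfl⟩ := pr_inj.1 e₂
      rfl
    · rintro rfl
      refine ⟨a, Order.lt_add_one_iff.2 ?_, b, Order.lt_add_one_iff.2 ?_, rfl⟩
      · exact (left_le_pr a b).trans (left_le_pr _ _)
      · exact (right_le_pr a b).trans (left_le_pr _ _)
  have shape : ∀ x, x ∈ C → ∃ a b i, i < k ∧ x = pr (pr a b) i := by
    intro x hx
    rw [← hCdef] at hx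
    obtain ⟨a, _, b, _, e⟩ := hx
    exact ⟨a, b, _, hk a b, e⟩
  obtain ⟨Y, hY, F, ⟨hF, hFlt, _⟩, G, ⟨hG, hG0, hG1⟩, i, _, hi⟩ :=
    (sat_AHT2_iff v w).1 h k ⟨C, hC⟩ ⟨shape, fun a b =>
      ⟨col a b, (mem a b _).2 rfl, fun j hj => (mem a b j).1 hj⟩⟩
  obtain ⟨f, hf, hfF⟩ := hF.exists_fun F.2
  obtain ⟨g, hg, hgG⟩ := hG.exists_fun G.2
  refine ⟨f, g, hf, hg, fun a b hab => hFlt a b _ _ ⟨hab, (hfF _ _).2 rfl, (hfF _ _).2 rfl⟩,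
    ((hgG _ _).1 hG0).symm, fun n => ((hgG _ _).1 (hG1 n _ _ ⟨(hgG _ _).2 rfl,
      (hfF _ _).2 rfl⟩)).symm, i, fun k₀ k₁ k₂ p q h₀ h₁ hp hq => ?_⟩
  exact ((mem p q i).1 (hi k₀ k₁ k₂ _ _ _ p q ⟨⟨h₀.lt_or_eq, h₁⟩, ⟨(hgG _ _).2 rfl,
    (hgG _ _).2 rfl, (hgG _ _).2 rfl⟩, hp, hq⟩)).symm

theorem le_of_strictMono {F : M.Num → M.Num} (hF : RecFun fun v => F (v 0))
    (h : ∀ a b, a < b → F a < F b) : ∀ n, n ≤ F n := by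
  refine bdd_induction (.le' (.var 0) (hF.comp₁ (.var 0))) zero_le fun n ih => ?_
  exact Order.add_one_le_iff.2 (ih.trans_lt (h n (n + 1) (Order.lt_add_one_iff.2 le_rfl)))

theorem strictMono_of_lt_succ {F : M.Num → M.Num} (hF : RecFun fun v => F (v 0))
    (h : ∀ n, F n < F (n + 1)) : ∀ a b, a < b → F a < F b := by
  intro a
  refine bdd_induction (.imp (.lt (.const a) (.var 0)) (.lt' (.const (F a)) (hF.comp₁ (.var 0))))
    (fun h => (not_lt_zero h).elim) fun n ih hlt => ?_
  rcases (Order.lt_add_one_iff.1 hlt).lt_or_eq with h' | rfl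
  · exact (ih h').trans (h n)
  · exact h a

theorem sat_of_adjacentHindman (h : AdjacentHindman M) (v : ℕ → M.Num) (w : ℕ → M.Sets) :
    M.Sat v w AHT2 := by
  rw [sat_AHT2_iff]
  rintro k ⟨C, hC⟩ ⟨hb, hu⟩
  dsimp only at hb hu ⊢
  choose col hcol hcolu using hu
  have key : ∀ a b i, pr (pr a b) i ∈ C ↔ i = col a b := fun a b i =>
    ⟨hcolu a b i, fun h => h ▸ hcol a b⟩
  have hlt : ∀ a b, col a b < k := by
    intro a b
    obtain ⟨a', b', i, hi, e⟩ := hb _ (hcol a b)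
    rw [(pr_inj.1 e).2]
    exact hi
  obtain ⟨f, g, hf, hg, hmono, hg0, hg1, i, hi⟩ := h k col
    ((Bdd.mem (.pr (.pr (.var 1) (.var 2)) (.var 0)) hC).of_iff
      fun v => (key (v 1) (v 2) (v 0)).symm) hlt
  obtain ⟨F, hFs, hF, hFf⟩ := exists_graph hf
  obtain ⟨G, hGs, hG, hGg⟩ := exists_graph hg
  have hle := le_of_strictMono hf hmono
  refine ⟨⟨{x | ∃ n, n < x + 1 ∧ x = f n}, mem_sets (.bex (.add (.var 0) (.const 1))
    (.eq' (.var 1) (hf.comp₁ (.var 0))))⟩, fun a => ⟨f (a + 1), ?_, a + 1, ?_, rfl⟩, ⟨F, hFs⟩,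
    ⟨isFunctionGraph_of hF hFf, ?_, fun a => ?_⟩, ⟨G, hGs⟩, ⟨isFunctionGraph_of hG hGg, ?_, ?_⟩,
    i, ?_, ?_⟩
  · exact Order.add_one_le_iff.1 (hle _)
  · exact Order.lt_add_one_iff.2 (hle _)
  · rintro a b c d ⟨hab, hc, hd⟩
    rw [(hFf _ _).1 hc, (hFf _ _).1 hd]
    exact hmono a b hab
  · simp only [hFf]
    exact ⟨fun ⟨n, _, h⟩ => ⟨n, h⟩, fun ⟨n, h⟩ => ⟨n, Order.lt_add_one_iff.2 (h ▸ hle n), h⟩⟩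
  · exact (hGg _ _).2 hg0.symm
  · rintro a b c ⟨hb, hc⟩
    rw [hGg, (hGg _ _).1 hb, (hFf _ _).1 hc, hg1]
  · have e₁ : g 0 + f 0 = g (0 + 1) := (hg1 0).symm
    have e₂ : g (0 + 1) + f (0 + 1) = g (0 + 1 + 1) := (hg1 _).symm
    rw [← hi 0 0 (0 + 1) _ _ le_rfl (Order.lt_add_one_iff.2 le_rfl) e₁ e₂]
    exact hlt _ _
  · rintro k₀ k₁ k₂ g₀ g₁ g₂ p q ⟨⟨h₀, h₁⟩, ⟨e₀, e₁, e₂⟩, hp, hq⟩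
    rw [(hGg _ _).1 e₀, (hGg _ _).1 e₁] at hp
    rw [(hGg _ _).1 e₁, (hGg _ _).1 e₂] at hq
    exact (key _ _ _).2 (hi k₀ k₁ k₂ p q (le_iff_lt_or_eq.2 h₀) h₁ hp hq).symm

/-! ### The equivalence -/

-- Colour gaps `(p, q)` like the triple `0, p, p + q`. Invariance moves any triple of partial sums
-- to this position, so the partial sums are homogeneous.
open Classical in
theorem AdjacentHindman.translationRamsey (h : AdjacentHindman M) : TranslationRamsey M := by
  intro k col hcol hk hinv
  obtain ⟨F, G, hF, hG, hmono, hG0, hG1, i, hi⟩ := h k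
    -- The default for zero gaps is the colour of an actual triple, which guarantees that it is
    -- below `k`.
    (fun p q => if 0 < p ∧ 0 < q then col 0 p (p + q) else col 0 1 (1 + 1))
    (.ite (.and (.lt (.const 0) (.var 0)) (.lt (.const 0) (.var 1)))
      (hcol.comp₃ (.const 0) (.var 0) (.add (.var 0) (.var 1))) (.const _)) (fun p q => by
        split_ifs with hpq
        · exact hk _ _ _ hpq.1 (lt_add_of_pos_right _ hpq.2)
        · exact hk _ _ _ zero_lt_one (lt_add_of_pos_right _ zero_lt_one))
  have hG' : RecFun fun v : ℕ → M.Num => G (v 0 + 1) := hG.comp₁ (.add (.var 0) (.const 1))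
  have hGlt : ∀ a b, a < b → G (a + 1) < G (b + 1) := by
    refine strictMono_of_lt_succ (F := fun n => G (n + 1)) hG' fun n => ?_
    show G (n + 1) < G (n + 1 + 1)
    rw [hG1 (n + 1)]
    exact lt_add_of_pos_right _ (lt_of_lt_of_le (Arith.zero_lt_succ n) (le_of_strictMono hF hmono _))
  have hGle := le_of_strictMono (F := fun n => G (n + 1)) hG' hGlt
  -- `G 0` is left out: if `F 0 = 0` it coincides with `G 1`.
  refine ⟨{x | ∃ n, n < x + 1 ∧ x = G (n + 1)}, mem_sets (.bex (.add (.var 0) (.const 1))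
    (.eq' (.var 1) (hG'.comp₁ (g := fun n => G (n + 1)) (.var 0)))), fun a =>
    ⟨G (a + 1 + 1), ?_, a + 1, ?_, rfl⟩, i, ?_⟩
  · exact Order.add_one_le_iff.1 (hGle _)
  · exact Order.lt_add_one_iff.2 (hGle _)
  · rintro a b c ⟨x, _, rfl⟩ ⟨y, _, rfl⟩ ⟨z, _, rfl⟩ hab hbc
    have lt_of : ∀ x y, G (x + 1) < G (y + 1) → x < y := fun x y h => by
      by_contra! hc
      rcases hc.lt_or_eq with hc | rfl
      · exact (hGlt _ _ hc).not_gt h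
      · exact lt_irrefl _ h
    have hxy := lt_of x y hab
    have hyz := lt_of y z hbc
    -- The block of terms from `x + 1` to `y` has sum `G (y + 1) - G (x + 1)`.
    have := hi (x + 1) y z (G (y + 1) - G (x + 1)) (G (z + 1) - G (y + 1))
      (Order.add_one_le_iff.2 hxy) hyz (add_tsub_cancel_of_le hab.le) (add_tsub_cancel_of_le hbc.le)
    rw [if_pos ⟨tsub_pos_of_lt hab, tsub_pos_of_lt hbc⟩, num_sub_add_sub hab hbc] at this
    rw [← this, ← hinv 0 _ _ (G (x + 1)) (tsub_pos_of_lt hab)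
      ((tsub_lt_tsub_iff_right hab.le).2 hbc), zero_add, tsub_add_cancel_of_le hab.le,
      tsub_add_cancel_of_le (hab.trans hbc).le]

/-- Colour triples by their two gaps. The gaps between successive points of a homogeneous sequence
form the solution, once the sequence is thinned so that these gaps increase. -/
theorem TranslationRamsey.adjacentHindman (h : TranslationRamsey M) : AdjacentHindman M := by
  intro k col hcol hk
  obtain ⟨X, hX, hinf, i, hi⟩ := h k (fun a b c => col (b - a) (c - b))
    (hcol.comp₂ (.sub (.var 1) (.var 0)) (.sub (.var 2) (.var 1))) (fun _ _ _ _ _ => hk _ _)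
    (fun a b c t _ _ => by simp only [add_tsub_add_eq_tsub_right])
  -- More than doubling at each step makes every new gap exceed the last point, hence the last gap.
  -- Taking the least such point makes the choice definable.
  have hnext : ∀ a, ∃ b, (a + a < b ∧ b ∈ X) ∧ ∀ c, c < b → ¬ (a + a < c ∧ c ∈ X) := fun a =>
    exists_least (P := fun b => a + a < b ∧ b ∈ X)
      (.and (.lt (.const _) (.var 0)) (.mem (.var 0) hX)) (hinf _)
  choose next hnext hleast using hnext
  have hrec : RecFun fun v : ℕ → M.Num => next (v 0) :=
    .of_least (R := fun b v => v 0 + v 0 < b ∧ b ∈ X) (.and (.lt (.add (.var 1) (.var 1)) (.var 0))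
      (.mem (.var 0) hX)) (fun v => hnext (v 0)) fun v => hleast (v 0)
  obtain ⟨g, hg, hg0, hg1⟩ := exists_primitive_recursion (f₀ := fun _ => next 0)
    (f := fun _ _ z => next z) (.const _) (hrec.comp₁ (.var 2))
  have hx : RecFun fun v : ℕ → M.Num => g 0 (v 0) := hg.comp₂ (.const 0) (.var 0)
  have hlt : ∀ n, g 0 n + g 0 n < g 0 (n + 1) := fun n => by rw [hg1]; exact (hnext _).1
  have hmem : ∀ n, g 0 n ∈ X := by
    refine bdd_induction (.mem' hx hX) ?_ fun n _ => ?_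
    · rw [hg0]; exact (hnext _).2
    · rw [hg1]; exact (hnext _).2
  have hmono : ∀ a b, a < b → g 0 a < g 0 b :=
    strictMono_of_lt_succ hx fun n => le_self_add.trans_lt (hlt n)
  have hle : ∀ n, g 0 0 ≤ g 0 n := fun n => by
    rcases (zero_le (a := n)).lt_or_eq with h | h
    · exact (hmono _ _ h).le
    · rw [← h]
  refine ⟨fun n => g 0 (n + 1) - g 0 n, fun n => g 0 n - g 0 0,
    .sub (hx.comp₁ (g := fun n => g 0 n) (.add (.var 0) (.const 1))) hx, .sub hx (.const _), ?_,
    tsub_self _, fun n => ?_, i, ?_⟩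
  · refine strictMono_of_lt_succ (F := fun n => g 0 (n + 1) - g 0 n)
      (.sub (hx.comp₁ (g := fun n => g 0 n) (.add (.var 0) (.const 1))) hx) fun n => ?_
    exact lt_of_le_of_lt tsub_le_self (lt_tsub_of_add_lt_left (hlt _))
  · have := hmono n (n + 1) (Order.lt_add_one_iff.2 le_rfl)
    show g 0 (n + 1) - g 0 0 = g 0 n - g 0 0 + (g 0 (n + 1) - g 0 n)
    rw [add_comm (g 0 n - g 0 0), tsub_add_tsub_cancel this.le (hle n)]
  · intro k₀ k₁ k₂ p q h₀ h₁ hp hq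
    have l₁ : k₀ < k₁ + 1 := Order.lt_add_one_iff.2 h₀
    have l₂ : k₁ + 1 < k₂ + 1 := by gcongr
    rw [← hi _ _ _ (hmem k₀) (hmem (k₁ + 1)) (hmem (k₂ + 1)) (hmono _ _ l₁) (hmono _ _ l₂)]
    have aux : ∀ a b p, a < b → g 0 a - g 0 0 + p = g 0 b - g 0 0 → p = g 0 b - g 0 a := by
      intro a b p hab h
      rw [← tsub_add_tsub_cancel (hmono a b hab).le (hle a), add_comm] at h
      exact add_right_cancel h
    rw [aux _ _ p l₁ hp, aux _ _ q l₂ hq]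

/-! ### Arithmetical comprehension -/

-- The jump colouring of gaps is translation invariant, and four colours record its two bits.
open Classical in
theorem TranslationRamsey.mem_sets (h : TranslationRamsey M) {P : M.Num → M.Num → Prop}
    (hP : Bdd fun v => P (v 0) (v 1)) : {x | ∃ y, P y x} ∈ M.Sets := by
  have hS : Bdd fun v => Stage P (v 0) (v 1) := .bex (.var 0) (hP.comp₂ (.var 0) (.var 2))
  have hA : Bdd fun v => Agree P (v 0) (v 1) := .ball' (.twoPart (.var 0))
    (.iff (hS.comp₂ (.var 1) (.var 0)) (hS.comp₂ (.var 2) (.var 0)))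
  have h₁₂ : (1 : M.Num) ≠ 1 + 1 := (lt_add_of_pos_right _ zero_lt_one).ne
  have h₁₃ : (1 : M.Num) ≠ 1 + 1 + 1 := by
    rw [add_assoc]; exact (lt_add_of_pos_right _ (Arith.zero_lt_succ _)).ne
  have h₂₃ : (1 + 1 : M.Num) ≠ 1 + 1 + 1 := (lt_add_of_pos_right _ zero_lt_one).ne
  let bits : M.Num → M.Num → M.Num := fun p q =>
    if twoPart p < twoPart q then (if Agree P p q then 0 else 1)
    else (if Agree P p q then 1 + 1 else 1 + 1 + 1)
  have hbits : RecFun fun v : ℕ → M.Num => bits (v 0) (v 1) :=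
    .ite (.lt' (.twoPart (.var 0)) (.twoPart (.var 1))) (.ite hA (.const _) (.const _))
      (.ite hA (.const _) (.const _))
  have same : ∀ p q p' q', bits p q = bits p' q' → SameBits P p q p' q' := by
    intro p q p' q' h
    simp only [bits] at h
    unfold SameBits
    split_ifs at h with c₁ c₂ c₃ c₄ <;>
      first
      | exact ⟨iff_of_true ‹_› ‹_›, iff_of_true ‹_› ‹_›⟩
      | exact ⟨iff_of_true ‹_› ‹_›, iff_of_false ‹_› ‹_›⟩
      | exact ⟨iff_of_false ‹_› ‹_›, iff_of_true ‹_› ‹_›⟩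
      | exact ⟨iff_of_false ‹_› ‹_›, iff_of_false ‹_› ‹_›⟩
      | exact (zero_ne_one h).elim
      | exact (zero_ne_one h.symm).elim
      | exact (Arith.succ_ne_zero _ h).elim
      | exact (Arith.succ_ne_zero _ h.symm).elim
      | exact (h₁₂ h).elim
      | exact (h₁₂ h.symm).elim
      | exact (h₁₃ h).elim
      | exact (h₁₃ h.symm).elim
      | exact (h₂₃ h).elim
      | exact (h₂₃ h.symm).elim
  obtain ⟨X, hX, hinf, i, hi⟩ := h (1 + 1 + 1 + 1) (fun a b c => bits (b - a) (c - b))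
    (hbits.comp₂ (.sub (.var 1) (.var 0)) (.sub (.var 2) (.var 1))) (fun a b c _ _ => by
      have l : ∀ x : M.Num, x < x + 1 := fun x => lt_add_of_pos_right _ zero_lt_one
      simp only [bits]
      split_ifs
      · exact Arith.zero_lt_succ _
      · exact (l 1).trans ((l _).trans (l _))
      · exact (l _).trans (l _)
      · exact l _)
    (fun a b c t _ _ => by simp only [add_tsub_add_eq_tsub_right])
  refine mem_sets_of_homogeneous hP hX hinf fun a b c a' b' c' ha hb hc hab hbc ha' hb' hc' hab' hbc' =>
    same _ _ _ _ ?_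
  exact (hi a b c ha hb hc hab hbc).trans (hi a' b' c' ha' hb' hc' hab' hbc').symm

/-- Since every `Σ⁰₁` set now belongs to the model, it can serve as a set parameter, and an
unbounded quantifier disappears. -/
theorem TranslationRamsey.bdd_of_sigma1 (h : TranslationRamsey M) {P : (ℕ → M.Num) → Prop}
    (hP : Sigma1 P) : Bdd P := by
  obtain ⟨n, hn⟩ := hP.exists_support
  refine bdd_of_support (Γ := Sigma1) (fun P hP => ?_) (fun P hP => hP.unpair) n hP hn
  obtain ⟨Q, hQ, hPQ⟩ := hP
  have := h.mem_sets (P := fun y x => Q (cons y fun _ => x))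
    ((hQ.subst (σ := cons (fun v => v 0) fun _ v => v 1)
      (fun i => match i with | 0 => .var 0 | i + 1 => .var 1)).of_iff fun v => by
        apply iff_of_eq; congr 1; funext i; cases i <;> rfl)
  convert this using 2
  funext x
  exact propext (hPQ _)

theorem poly_eval : ∀ t : Term, Poly fun v : ℕ → M.Num => M.eval v t
  | .var i => .var i
  | .zero => .const _
  | .one => .const _
  | .add s t => .add (poly_eval s) (poly_eval t)
  | .mul s t => .mul (poly_eval s) (poly_eval t)

/-- Induction on the formula: each number quantifier is absorbed by `bdd_of_sigma1` applied to the
negated matrix. -/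
theorem TranslationRamsey.bdd_sat (h : TranslationRamsey M) (w : ℕ → M.Sets) (φ : Formula)
    (hφ : φ.IsArithmetical) : Bdd fun v => M.Sat v w φ := by
  induction φ with
  | eq s t => exact .eq (poly_eval s) (poly_eval t)
  | lt s t => exact .lt (poly_eval s) (poly_eval t)
  | mem t X => exact .mem (poly_eval t) (w X).2
  | neg φ ih => exact .not (ih hφ)
  | and φ ψ ih₁ ih₂ => exact .and (ih₁ hφ.1) (ih₂ hφ.2)
  | all x φ ih =>
    have h₁ : Bdd fun v : ℕ → M.Num => M.Sat (Function.update (fun i => v (i + 1)) x (v 0)) w φ := by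
      refine ((ih hφ).subst (σ := fun i v => if i = x then v 0 else v (i + 1)) fun i => ?_).of_iff
        fun v => ?_
      · by_cases hi : i = x
        · simpa [hi] using Poly.var 0
        · simpa [hi] using Poly.var (i + 1)
      · apply iff_of_eq; congr 1; funext i; simp [Function.update_apply]
    have h₂ : Sigma1 fun v : ℕ → M.Num => ∃ a, ¬ M.Sat (Function.update v x a) w φ :=
      .ex h₁.not.sigma1
    exact (h.bdd_of_sigma1 h₂).not.of_iff fun v => by simp [Sat]
  | allSet X φ => exact hφ.elim

theorem TranslationRamsey.models_ACA₀ (h : TranslationRamsey M) {φ : Formula} (hφ : φ ∈ ACA₀) :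
    M.Models φ := by
  rcases hφ with (hφ | rfl) | ⟨φ, x, X, ha, hX, rfl⟩
  · exact basic_models hφ
  · intro v w
    rw [inductionAxiom, sat_imp]
    rintro ⟨h₀, h₁⟩ a
    simp only [sat_all, sat_imp, sat_mem, eval_add, eval_var, eval_one, Function.update_self] at h₀ h₁ ⊢
    exact bdd_induction (P := fun a => a ∈ (w 0).1) (.mem (.var 0) (w 0).2) h₀ h₁ a
  · intro v w
    rw [comprehensionFor, sat_exSet]
    have hb : Bdd fun u : ℕ → M.Num => M.Sat (Function.update v x (u 0)) w φ := by
      refine ((h.bdd_sat w φ ha).subst (σ := fun i u => if i = x then u 0 else v i)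
        fun i => ?_).of_iff fun u => ?_
      · by_cases hi : i = x
        · simpa [hi] using Poly.var 0
        · simpa [hi] using Poly.const (v i)
      · apply iff_of_eq; congr 1; funext i; simp [Function.update_apply]
    refine ⟨⟨_, Model.mem_sets (P := fun a => M.Sat (Function.update v x a) w φ) hb⟩, fun a => ?_⟩
    rw [sat_iff, sat_mem, eval_var, Function.update_self, Function.update_self]
    refine Iff.trans Iff.rfl (sat_congr_set _ fun Y hY => ?_)
    rw [Function.update_of_ne]
    rintro rfl
    exact hX hY

end Model

/-! ### From models to entailment. -/

theorem isRCA_of_models {M : Model.{u}} {T : Set Formula} (hT : RCA₀ ⊆ T)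
    (h : ∀ ψ ∈ T, M.Models ψ) : M.IsRCA := ⟨fun ψ hψ => h ψ (hT hψ)⟩

open Model in
theorem entails_of_ZRT3 {φ : Formula} (hφ : φ ∈ ACA₀) : Entails.{u} (RCA₀ ∪ {ZRT3}) φ := by
  intro M hM
  have := isRCA_of_models Set.subset_union_left hM
  have hZ : M.Models ZRT3 := hM _ (.inr rfl)
  exact (translationRamsey_of_sat (hZ (fun _ => 0)
    fun _ => ⟨_, M.sets_nonempty.choose_spec⟩)).models_ACA₀ hφ

open Model in
theorem entails_of_AHT2 {φ : Formula} (hφ : φ ∈ ACA₀) : Entails.{u} (RCA₀ ∪ {AHT2}) φ := by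
  intro M hM
  have := isRCA_of_models Set.subset_union_left hM
  have hA : M.Models AHT2 := hM _ (.inr rfl)
  exact (adjacentHindman_of_sat (hA (fun _ => 0)
    fun _ => ⟨_, M.sets_nonempty.choose_spec⟩)).translationRamsey.models_ACA₀ hφ

open Model in
theorem entails_AHT2_iff_ZRT3 : Entails.{u} RCA₀ (Formula.iff AHT2 ZRT3) := by
  intro M hM v w
  have := isRCA_of_models subset_rfl hM
  rw [sat_iff]
  exact ⟨fun h => sat_of_translationRamsey (adjacentHindman_of_sat h).translationRamsey v w,
    fun h => sat_of_adjacentHindman (translationRamsey_of_sat h).adjacentHindman v w⟩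

end SecondOrderArith

theorem theorem5 :
    (∃ c : ℕ → ℕ → Fin 4, Computable₂ c ∧
      ∀ Y : Set ℕ, AdjacentHindman.IsSolution c Y →
        AdjacentHindman.Computes Y AdjacentHindman.haltingSet) ∧
    (∀ φ ∈ SecondOrderArith.ACA₀,
      SecondOrderArith.Entails.{u} (SecondOrderArith.RCA₀ ∪ {SecondOrderArith.AHT2}) φ) ∧
    (∀ φ ∈ SecondOrderArith.ACA₀,
      SecondOrderArith.Entails.{u} (SecondOrderArith.RCA₀ ∪ {SecondOrderArith.ZRT3}) φ) ∧
    SecondOrderArith.Entails.{u} SecondOrderArith.RCA₀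
      (SecondOrderArith.Formula.iff SecondOrderArith.AHT2 SecondOrderArith.ZRT3) := by
  exact ⟨AdjacentHindman.exists_colouring_computing_haltingSet,
    fun _ h => SecondOrderArith.entails_of_AHT2 h,
    fun _ h => SecondOrderArith.entails_of_ZRT3 h,
    SecondOrderArith.entails_AHT2_iff_ZRT3⟩
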